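/- \textbf{Setting.} Let $p_0=(0,0)$, $p_1=(1,0)$, $p_2=(\tfrac12,\tfrac{\sqrt3}{2})$, $f_i(x)=(x+p_i)/2$ on $\mathbb R^2$, $V_1=\{p_0,p_1,p_2\}$, $V_{n+1}=\bigcup_i f_i(V_n)$, and let $K=\overline{\bigcup_n V_n}$ be the Sierpiński gasket. Let $X$ be the set of finite words over $\{0,1,2\}$, $|w|$ the length of $w$, $o$ the empty word, $f_w=f_{w_1}\circ\dots\circ f_{w_n}$, $K_w=f_w(K)$ and, for $n=|w|\ge1$, $p_w=f_{w_1\dots w_{n-1}}(p_{w_n})$. Let $\lambda\in(1/5,1/3)$, $C_1,C_2>0$ and $c\in(0,\lambda)$. Define symmetric conductances on $X$: $c(w,wi)=c(wi,w)=(3\lambda)^{-|w|}$ for $i\in\{0,1,2\}$; if $|w|=|v|=n\ge1$, $w\ne v$ and $K_w\cap K_v\ne\emptyset$, then $c(w,v)=C_1(3\lambda)^{-n}$ if $p_w\ne p_v$ and $c(w,v)=C_2(3\lambda)^{-n}$ if $p_w=p_v$; and $c(x,y)=0$ for all other pairs. Let $P(x,y)=c(x,y)/\sum_z c(x,z)$,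 $G=\sum_{n\ge0}P^{(n)}$, and let $\bar X$ be the Martin compactification of $X$, i.e. the smallest compactification of the discrete space $X$ to which all Martin kernels $G(x,\cdot)/G(o,\cdot)$, $x\in X$, extend continuously. Let $m(x)=(c/(3\lambda))^{|x|}$, regarded as a measure on $X$ and, by $m(\bar X\setminus X)=0$, also on $\bar X$. Put $D(u)=\frac12\sum_{x,y\in X}c(x,y)(u(x)-u(y))^2$. Let $\mathcal F_X$ be the closure of the finitely supported functions with respect to $D(u)+\|u\|_{L^2(X;m)}^2$, let $(\mathcal F_X)_{\mathrm{loc}}$ be the set of functions that agree on each relatively compact open (i.e. finite) set with an element of $\mathcal F_X$, let $\tau_ku=((-k)\vee u)\wedge k$, and let $(\mathcal E^{\mathrm{ref}},\mathcal F^{\mathrm{ref}}_a)$ be the active reflected Dirichlet form: $$\mathcal F^{\mathrm{ref}}_a=\Big\{u\in L^2(X;m):\tau_ku\in(\mathcal F_X)_{\mathrm{loc}}\ \forall k\ge1,\ \sup_{k\ge1}D(\tau_ku)<\infty\Big\},\qquad \mathcal E^{\mathrm{ref}}(u,u)=\lim_{k\to\infty}D(\tau_ku).$$ Let $$\mathcal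 F_{\bar X}=\{u\in C(\bar X):D(u|_X)<\infty\}\subseteq L^2(\bar X;m),\qquad \mathcal E_{\bar X}(u,u)=D(u|_X).$$ The bilinear forms are obtained by polarization. \textbf{Theorem.} $(\mathcal E_{\bar X},\mathcal F_{\bar X})$ on $L^2(\bar X;m)$ is a regular representation, in Fukushima's sense, of $(\mathcal E^{\mathrm{ref}},\mathcal F^{\mathrm{ref}}_a)$ on $L^2(X;m)$. That is: $(\mathcal E^{\mathrm{ref}},\mathcal F^{\mathrm{ref}}_a)$ is a Dirichlet form on $L^2(X;m)$; $(\mathcal E_{\bar X},\mathcal F_{\bar X})$ is a regular Dirichlet form on $L^2(\bar X;m)$; and, writing $\mathcal F_b=\mathcal F\cap L^\infty$, there is an algebra isomorphism $\Phi$ from $(\mathcal F^{\mathrm{ref}}_a)_b$ onto $(\mathcal F_{\bar X})_b$ such that for all $u\in(\mathcal F^{\mathrm{ref}}_a)_b$ $$\|u\|_{L^\infty(X;m)}=\|\Phi(u)\|_{L^\infty(\bar X;m)},\quad (u,u)_{L^2(X;m)}=(\Phi(u),\Phi(u))_{L^2(\bar X;m)},\quad \mathcal E^{\mathrm{ref}}(u,u)=\mathcal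 E_{\bar X}(\Phi(u),\Phi(u)).$$ Moreover $\Phi$ can be chosen such that every $u\in(\mathcal F^{\mathrm{ref}}_a)_b$ extends continuously to $\bar X$ and $\Phi(u)$ is this extension. -/

import Mathlib

open MeasureTheory Filter Topology
open scoped ENNReal

/-! ### Dirichlet forms and Fukushima's representations -/

section DirichletForms

variable {α β : Type*} [MeasurableSpace α] [MeasurableSpace β]

/-- The form `E₁(u, u) = E(u, u) + (u, u)` on `L²(α; μ)`. -/
noncomputable def formOne {μ : Measure α} (E : Lp ℝ 2 μ → Lp ℝ 2 μ → ℝ) (u : Lp ℝ 2 μ) : ℝ :=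
  E u u + inner ℝ u u

/-- `(E, F)` is a (symmetric) Dirichlet form on `L²(α; μ)`: `F` is a dense linear subspace, `E` is a
nonnegative definite symmetric bilinear form on `F`, closed and Markovian. The values of `E`
outside `F` are irrelevant. -/
structure IsDirichletForm (μ : Measure α) (F : Set (Lp ℝ 2 μ)) (E : Lp ℝ 2 μ → Lp ℝ 2 μ → ℝ) :
    Prop where
  sigmaFinite : SigmaFinite μ
  zero_mem : (0 : Lp ℝ 2 μ) ∈ F
  add_mem : ∀ u ∈ F, ∀ v ∈ F, u + v ∈ F
  smul_mem : ∀ a : ℝ, ∀ u ∈ F, a • u ∈ F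
  dense : Dense F
  form_symm : ∀ u ∈ F, ∀ v ∈ F, E u v = E v u
  form_add : ∀ u ∈ F, ∀ v ∈ F, ∀ w ∈ F, E (u + v) w = E u w + E v w
  form_smul : ∀ a : ℝ, ∀ u ∈ F, ∀ v ∈ F, E (a • u) v = a * E u v
  form_nonneg : ∀ u ∈ F, 0 ≤ E u u
  closed : ∀ u : ℕ → Lp ℝ 2 μ, (∀ n, u n ∈ F) →
    (∀ ε > 0, ∃ N, ∀ k ≥ N, ∀ l ≥ N, formOne E (u k - u l) < ε) →
    ∃ v ∈ F, Tendsto (fun n => formOne E (u n - v)) atTop (𝓝 0)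
  markov : ∀ u ∈ F, ∃ v ∈ F, (v =ᵐ[μ] fun x => min (max (u x) 0) 1) ∧ E v v ≤ E u u

/-- `(E, F)` is a regular Dirichlet form on `L²(α; μ)`: `α` is a locally compact separable
metrizable space, `μ` is a Radon measure with full support, and the continuous compactly supported
functions that belong to `F` are `E₁`-dense in `F` and uniformly dense in `C_c(α)`. -/
structure IsRegularDirichletForm [TopologicalSpace α] [BorelSpace α] (μ : Measure α)
    (F : Set (Lp ℝ 2 μ)) (E : Lp ℝ 2 μ → Lp ℝ 2 μ → ℝ) : Prop
    extends IsDirichletForm μ F E where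
  locallyCompact : LocallyCompactSpace α
  separable : TopologicalSpace.SeparableSpace α
  metrizable : TopologicalSpace.MetrizableSpace α
  radon : IsFiniteMeasureOnCompacts μ
  full_support : μ.IsOpenPosMeasure
  form_dense : ∀ u ∈ F, ∀ ε > 0, ∃ v ∈ F,
    (∃ g : α → ℝ, Continuous g ∧ HasCompactSupport g ∧ v =ᵐ[μ] g) ∧ formOne E (u - v) < ε
  uniform_dense : ∀ f : α → ℝ, Continuous f → HasCompactSupport f → ∀ ε > 0,
    ∃ g : α → ℝ, Continuous g ∧ HasCompactSupport g ∧ (∃ v ∈ F, v =ᵐ[μ] g) ∧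
      ∀ x, |f x - g x| < ε

/-- `F_b = F ∩ L^∞(α; μ)`. -/
def boundedPart {μ : Measure α} (F : Set (Lp ℝ 2 μ)) : Set (Lp ℝ 2 μ) :=
  {u | u ∈ F ∧ eLpNorm u ∞ μ < ∞}

/-- `Φ` (restricted to `F_b`) is an isomorphism of algebras from `F_b` onto `F'_b` that preserves
the `L^∞`-norm, the `L²`-inner product and the form. -/
structure IsFormIsomorphism (μ : Measure α) (F : Set (Lp ℝ 2 μ)) (E : Lp ℝ 2 μ → Lp ℝ 2 μ → ℝ)
    (ν : Measure β) (F' : Set (Lp ℝ 2 ν)) (E' : Lp ℝ 2 ν → Lp ℝ 2 ν → ℝ)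
    (Φ : Lp ℝ 2 μ → Lp ℝ 2 ν) : Prop where
  bijOn : Set.BijOn Φ (boundedPart F) (boundedPart F')
  map_add : ∀ u ∈ boundedPart F, ∀ v ∈ boundedPart F, Φ (u + v) = Φ u + Φ v
  map_smul : ∀ a : ℝ, ∀ u ∈ boundedPart F, Φ (a • u) = a • Φ u
  map_mul : ∀ u ∈ boundedPart F, ∀ v ∈ boundedPart F, ∃ w ∈ boundedPart F,
    (w =ᵐ[μ] fun x => u x * v x) ∧ (Φ w =ᵐ[ν] fun x => Φ u x * Φ v x)
  norm_top : ∀ u ∈ boundedPart F, eLpNorm (Φ u) ∞ ν = eLpNorm u ∞ μ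
  inner_eq : ∀ u ∈ boundedPart F, inner ℝ (Φ u) (Φ u) = inner ℝ u u
  form_eq : ∀ u ∈ boundedPart F, E' (Φ u) (Φ u) = E u u

/-- The Dirichlet form `(E', F')` on `L²(β; ν)` is a regular representation, in Fukushima's sense,
of the Dirichlet form `(E, F)` on `L²(α; μ)`, through the isomorphism `Φ`. -/
structure IsRegularRepresentation (μ : Measure α) (F : Set (Lp ℝ 2 μ))
    (E : Lp ℝ 2 μ → Lp ℝ 2 μ → ℝ) [TopologicalSpace β] [BorelSpace β]
    (ν : Measure β) (F' : Set (Lp ℝ 2 ν)) (E' : Lp ℝ 2 ν → Lp ℝ 2 ν → ℝ)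
    (Φ : Lp ℝ 2 μ → Lp ℝ 2 ν) : Prop where
  dirichlet : IsDirichletForm μ F E
  regular : IsRegularDirichletForm ν F' E'
  isomorphism : IsFormIsomorphism μ F E ν F' E' Φ

/-- The bilinear form obtained by polarization from an energy `Q(u) = E(u, u)`. -/
noncomputable def polarForm {V : Type*} [AddCommGroup V] (Q : V → ℝ≥0∞) (u v : V) : ℝ :=
  ((Q (u + v)).toReal - (Q (u - v)).toReal) / 4

end DirichletForms

namespace SierpinskiRep

/-! ### The Sierpiński gasket and the Sierpiński graph -/

/-- The three corners `p₀ = (0,0)`, `p₁ = (1,0)`, `p₂ = (1/2, √3/2)`. -/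
noncomputable def corner : Fin 3 → EuclideanSpace ℝ (Fin 2) :=
  ![!₂[0, 0], !₂[1, 0], !₂[1 / 2, √3 / 2]]

/-- `f_i(x) = (x + p_i) / 2`. -/
noncomputable def contr (i : Fin 3) (x : EuclideanSpace ℝ (Fin 2)) : EuclideanSpace ℝ (Fin 2) :=
  (1 / 2 : ℝ) • (x + corner i)

/-- The vertex sets: `gasketVertices n` is `V_{n+1}`, that is, `V₁ = {p₀, p₁, p₂}` and
`V_{n+1} = f₀(V_n) ∪ f₁(V_n) ∪ f₂(V_n)`. -/
noncomputable def gasketVertices : ℕ → Set (EuclideanSpace ℝ (Fin 2))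
  | 0 => Set.range corner
  | n + 1 => ⋃ i : Fin 3, contr i '' gasketVertices n

/-- The Sierpiński gasket, the closure of `⋃ V_n`. -/
noncomputable def gasket : Set (EuclideanSpace ℝ (Fin 2)) := closure (⋃ n, gasketVertices n)

/-- The nodes of the Sierpiński graph: finite words over `{0, 1, 2}`, the root being the empty
word. The set of nodes is a discrete space. -/
def Word : Type := List (Fin 3)

instance : TopologicalSpace Word := ⊥
instance : MeasurableSpace Word := ⊤
instance : DiscreteTopology Word := ⟨rfl⟩
instance : DiscreteMeasurableSpace Word := ⟨fun _ => trivial⟩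
instance : Countable Word := inferInstanceAs (Countable (List (Fin 3)))

/-- The root (the empty word). -/
def Word.root : Word := ([] : List (Fin 3))

/-- `|w|`, the length of a word. -/
def Word.len (w : Word) : ℕ := List.length w

/-- `w₁ … w_n i`, a child node of `w₁ … w_n`. -/
def Word.child (w : Word) (i : Fin 3) : Word := List.append w [i]

/-- `f_w = f_{w₁} ∘ … ∘ f_{w_n}`. -/
noncomputable def Word.map (w : Word) (x : EuclideanSpace ℝ (Fin 2)) : EuclideanSpace ℝ (Fin 2) :=
  List.foldr contr x w

/-- `K_w = f_w(K)`. -/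
noncomputable def Word.cell (w : Word) : Set (EuclideanSpace ℝ (Fin 2)) := w.map '' gasket

/-- `p_w = f_{w₁ … w_{n-1}}(p_{w_n})` for a word of length `n ≥ 1` (the value at the empty word is
not used). -/
noncomputable def Word.vertex : Word → EuclideanSpace ℝ (Fin 2) := fun w =>
  match List.getLast? w with
  | some i => Word.map (List.dropLast w) (corner i)
  | none => 0

/-- Vertical edges: one node is the father of the other. -/
def VertAdj (x y : Word) : Prop := (∃ i, y = x.child i) ∨ ∃ i, x = y.child i

/-- Horizontal edges. -/
def HorAdj (x y : Word) : Prop :=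
  1 ≤ x.len ∧ x.len = y.len ∧ x ≠ y ∧ (x.cell ∩ y.cell).Nonempty

section Walk

variable (lam C₁ C₂ : ℝ)

open Classical in
/-- The conductances: `1 / (3λ)^n` on vertical edges between levels `n` and `n + 1`, and on level
`n` the value `C₁ / (3λ)^n` for horizontal edges of type I (`p_x ≠ p_y`) and `C₂ / (3λ)^n` for those
of type II (`p_x = p_y`). -/
noncomputable def conductance (x y : Word) : ℝ :=
  if VertAdj x y then 1 / (3 * lam) ^ min x.len y.len
  else if HorAdj x y then (if x.vertex ≠ y.vertex then C₁ else C₂) / (3 * lam) ^ x.len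
  else 0

/-- `π(x) = ∑_y c(x, y)`. -/
noncomputable def totalConductance (x : Word) : ℝ := ∑' y, conductance lam C₁ C₂ x y

/-- The transition probability `P(x, y) = c(x, y) / π(x)`. -/
noncomputable def transition (x y : Word) : ℝ≥0∞ :=
  ENNReal.ofReal (conductance lam C₁ C₂ x y / totalConductance lam C₁ C₂ x)

open Classical in
/-- The `n`-step transition probability `P⁽ⁿ⁾(x, y)`. -/
noncomputable def transitionPow : ℕ → Word → Word → ℝ≥0∞
  | 0, x, y => if x = y then 1 else 0
  | n + 1, x, y => ∑' z, transition lam C₁ C₂ x z * transitionPow n z y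

/-- The Green function. -/
noncomputable def green (x y : Word) : ℝ≥0∞ := ∑' n, transitionPow lam C₁ C₂ n x y

/-- The Martin kernel `K(x, y) = G(x, y) / G(o, y)`. -/
noncomputable def martinKernel (x y : Word) : ℝ≥0∞ :=
  green lam C₁ C₂ x y / green lam C₁ C₂ Word.root y

open Classical in
/-- The map that sends a node `y` to the family of values at `y` of all indicator functions of
single nodes and of all Martin kernels `K(x, ·)`. -/
noncomputable def martinMap (y : Word) : (Word → Bool) × (Word → ℝ≥0∞) :=
  (fun x => decide (x = y), fun x => martinKernel lam C₁ C₂ x y)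

/-- The Martin compactification `X̄`: the smallest compactification of the discrete space of nodes to
which every Martin kernel `K(x, ·)` extends continuously. It is the closure of the image of the
nodes under `martinMap` in a product of compact spaces; the indicator functions of the nodes, which
extend continuously to every compactification of a discrete space, make the set of nodes an open
discrete subspace of `X̄`. Each `K(x, ·)` is bounded, so that a continuous extension with values in `[0, ∞]` is
one with real values. The characteristic properties are checked below. -/
def MartinCompactification : Type := ↥(closure (Set.range (martinMap lam C₁ C₂)))

noncomputable instance : TopologicalSpace (MartinCompactification lam C₁ C₂) :=
  inferInstanceAs (TopologicalSpace ↥(closure (Set.range (martinMap lam C₁ C₂))))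
noncomputable instance : MeasurableSpace (MartinCompactification lam C₁ C₂) := borel _
instance : BorelSpace (MartinCompactification lam C₁ C₂) := ⟨rfl⟩
instance : T2Space (MartinCompactification lam C₁ C₂) :=
  inferInstanceAs (T2Space ↥(closure (Set.range (martinMap lam C₁ C₂))))
instance : CompactSpace (MartinCompactification lam C₁ C₂) :=
  isCompact_iff_compactSpace.mp isClosed_closure.isCompact

/-- The inclusion of the nodes `X ⊆ X̄`. -/
noncomputable def incl (y : Word) : MartinCompactification lam C₁ C₂ :=
  ⟨martinMap lam C₁ C₂ y, subset_closure ⟨y, rfl⟩⟩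

theorem isEmbedding_incl : IsEmbedding (incl lam C₁ C₂) := by
  classical
  have hinj : Function.Injective (incl lam C₁ C₂) := by
    intro y z h
    have h1 := congrFun (congrArg (fun p => p.1.1) h) y
    simpa [incl, martinMap] using h1
  refine ⟨⟨Eq.symm ?_⟩, hinj⟩
  refine @eq_bot_of_singletons_open _ (TopologicalSpace.induced _ _) fun y => ?_
  refine isOpen_induced_iff.mpr ⟨{p | p.1.1 y = true}, ?_, ?_⟩
  · have hc : Continuous fun p : MartinCompactification lam C₁ C₂ => p.1.1 y :=
      (continuous_apply y).comp (continuous_fst.comp continuous_subtype_val)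
    exact (isOpen_discrete {true}).preimage hc
  · ext z
    simp [incl, martinMap, eq_comm (a := z)]

theorem denseRange_incl : DenseRange (incl lam C₁ C₂) := by
  intro p
  refine closure_subtype.mpr (closure_mono ?_ p.2)
  rintro _ ⟨y, rfl⟩
  exact ⟨incl lam C₁ C₂ y, ⟨y, rfl⟩, rfl⟩

/-- Every Martin kernel extends continuously to `X̄`. -/
theorem exists_extension (x : Word) : ∃ g : MartinCompactification lam C₁ C₂ → ℝ≥0∞,
    Continuous g ∧ ∀ y, g (incl lam C₁ C₂ y) = martinKernel lam C₁ C₂ x y :=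
  ⟨fun p => p.1.2 x,
    (continuous_apply x).comp (continuous_snd.comp continuous_subtype_val), fun _ => rfl⟩

/-- `X̄` is the smallest such compactification. -/
theorem exists_map_of_extension {Y : Type*} [TopologicalSpace Y] [CompactSpace Y] [T2Space Y]
    (e : Word → Y) (he : IsEmbedding e) (hd : DenseRange e)
    (hK : ∀ x, ∃ g : Y → ℝ≥0∞, Continuous g ∧ ∀ y, g (e y) = martinKernel lam C₁ C₂ x y) :
    ∃ φ : Y → MartinCompactification lam C₁ C₂, Continuous φ ∧
      ∀ y, φ (e y) = incl lam C₁ C₂ y := by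
  classical
  choose g hg hge using hK
  have hop : ∀ x, IsClopen {p | p = e x} := by
    intro x
    refine ⟨isClosed_singleton, ?_⟩
    obtain ⟨U, hU, hUx⟩ := he.isInducing.isOpen_iff.mp (isOpen_discrete ({x} : Set Word))
    suffices h : {p | p = e x} = U from h ▸ hU
    refine Set.Subset.antisymm ?_ fun p hp => ?_
    · rintro _ rfl
      change x ∈ e ⁻¹' U
      simp [hUx]
    · by_contra hne
      obtain ⟨z, hz1, hz2⟩ := hd.exists_mem_open
        (hU.inter (isClosed_singleton (x := e x)).isOpen_compl) ⟨p, hp, hne⟩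
      have hzx : z ∈ e ⁻¹' U := hz1
      rw [hUx] at hzx
      exact hz2 (by rw [Set.mem_singleton_iff.mp hzx]; rfl)
  let ψ : Y → (Word → Bool) × (Word → ℝ≥0∞) := fun p => (fun x => decide (p = e x), fun x => g x p)
  have hψ : Continuous ψ := by
    refine (continuous_pi fun x => ?_).prodMk (continuous_pi hg)
    refine continuous_bool_rng true |>.mpr ?_
    convert hop x using 1
    ext p
    simp
  have hψe : ∀ y, ψ (e y) = martinMap lam C₁ C₂ y := fun y => by
    simp only [ψ, martinMap, hge, Prod.mk.injEq, and_true]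
    funext x
    simp only [he.injective.eq_iff, eq_comm]
  have hmem : ∀ p, ψ p ∈ closure (Set.range (martinMap lam C₁ C₂)) := fun p =>
    hd.induction_on p (isClosed_closure.preimage hψ) fun y => by
      rw [hψe]; exact subset_closure ⟨y, rfl⟩
  exact ⟨fun p => ⟨ψ p, hmem p⟩, hψ.subtype_mk _, fun y => Subtype.ext (hψe y)⟩

/-! ### Energy, reflected form and the form on the compactification -/

/-- The energy `½ ∑_{x,y} c(x, y) (u(x) - u(y))²` of a function on the nodes. -/
noncomputable def energy (u : Word → ℝ) : ℝ≥0∞ :=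
  (1 / 2) * ∑' x, ∑' y, ENNReal.ofReal (conductance lam C₁ C₂ x y * (u x - u y) ^ 2)

/-- The measure on the nodes with `m({x}) = (c / (3λ))^|x|`. -/
noncomputable def nodeMeasure (c : ℝ) : Measure Word :=
  Measure.sum fun x => ENNReal.ofReal ((c / (3 * lam)) ^ x.len) • Measure.dirac x

/-- The measure `m` on `X̄`, carried by the nodes. -/
noncomputable def martinMeasure (c : ℝ) : Measure (MartinCompactification lam C₁ C₂) :=
  (nodeMeasure lam c).map (incl lam C₁ C₂)

variable (c : ℝ)

/-- `F_X`, the closure of the finitely supported functions with respect to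
`E_X(u, u) + (u, u)`. -/
def minimalDomain : Set (Lp ℝ 2 (nodeMeasure lam c)) :=
  {u | ∀ ε > 0, ∃ v : Word → ℝ, v.support.Finite ∧
    energy lam C₁ C₂ (⇑u - v) + eLpNorm (⇑u - v) 2 (nodeMeasure lam c) ^ 2 < ε}

/-- `(F_X)_loc`: the functions that coincide `m`-a.e. on every relatively compact open set with an
element of `F_X`. -/
def localDomain : Set (Word → ℝ) :=
  {u | ∀ G : Set Word, IsOpen G → IsCompact (closure G) →
    ∃ v ∈ minimalDomain lam C₁ C₂ c, ∀ᵐ x ∂(nodeMeasure lam c), x ∈ G → u x = v x}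

/-- `τ_k u = ((-k) ∨ u) ∧ k`. -/
noncomputable def truncation (k : ℕ) (u : Word → ℝ) : Word → ℝ :=
  fun x => min (max (-(k : ℝ)) (u x)) k

/-- The reflected Dirichlet space `F^ref`: the (finite) functions `u` with `τ_k u ∈ (F_X)_loc` for
all `k ≥ 1` and `sup_k Ê(τ_k u, τ_k u) < ∞`. Since `E_X` is of pure jump type, `Ê` is the
energy. -/
def reflectedSpace : Set (Word → ℝ) :=
  {u | (∀ k, 1 ≤ k → truncation k u ∈ localDomain lam C₁ C₂ c) ∧
    ⨆ k, ⨆ _ : 1 ≤ k, energy lam C₁ C₂ (truncation k u) < ∞}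

/-- `E^ref(u, u) = lim_k Ê(τ_k u, τ_k u)`. -/
noncomputable def reflectedEnergy (u : Word → ℝ) : ℝ≥0∞ :=
  limUnder atTop fun k => energy lam C₁ C₂ (truncation k u)

/-- The active reflected Dirichlet space `F^ref_a = F^ref ∩ L²(X; m)`. -/
def activeReflectedDomain : Set (Lp ℝ 2 (nodeMeasure lam c)) :=
  {u | ⇑u ∈ reflectedSpace lam C₁ C₂ c}

/-- The form `E^ref` on `L²(X; m)`. -/
noncomputable def reflectedForm : Lp ℝ 2 (nodeMeasure lam c) → Lp ℝ 2 (nodeMeasure lam c) → ℝ :=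
  polarForm fun u => reflectedEnergy lam C₁ C₂ ⇑u

/-- `F_X̄`: the continuous functions on `X̄` of finite energy, as elements of `L²(X̄; m)`. -/
def martinDomain : Set (Lp ℝ 2 (martinMeasure lam C₁ C₂ c)) :=
  {u | ∃ f : C(MartinCompactification lam C₁ C₂, ℝ), u =ᵐ[martinMeasure lam C₁ C₂ c] f ∧
    energy lam C₁ C₂ (f ∘ incl lam C₁ C₂) < ∞}

/-- The form `E_X̄(u, u) = ½ ∑_{x,y ∈ X} c(x, y) (u(x) - u(y))²` on `L²(X̄; m)`; the values of `u` at
the nodes are those of any representative, as every node has positive measure. -/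
noncomputable def martinForm :
    Lp ℝ 2 (martinMeasure lam C₁ C₂ c) → Lp ℝ 2 (martinMeasure lam C₁ C₂ c) → ℝ :=
  polarForm fun u => energy lam C₁ C₂ (⇑u ∘ incl lam C₁ C₂)

end Walk

end SierpinskiRep

open SierpinskiRep

/-! Both measures are finite and carried by the nodes, with an atom at every node, so an L²-class is
simply a function on the nodes (`Carries`), and both forms turn out to be the energy D on the
functions of finite energy. Two facts carry the theorem: a function of finite energy extends
continuously to X̄ (`exists_extension_of_energy`), and these extensions are uniformly dense in C(X̄)
(`energyAlgebra_closure`).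

The link between energy and Martin kernels is the function λ^|x|, which is harmonic away from the
root. Dividing by it turns harmonicity into `gen v x = 0`, where `gen` has weight 3 towards the
father and only λ towards each child. This drift to the root gives a maximum principle for bounded
functions without any condition at infinity (`maxPrinciple`), with the powers θ^|x| as barriers. The
Green function G(·, x) divided by λ^|·| is bounded, annihilated by `gen` off x and the root, and
constant if x is the root; by reversibility K(x, ·) is a positive multiple of it
(`martinKernel_eq`).

Extension: finite energy bounds the increments at x by a multiple of √(3λ)^|x|, and 3λ < 1. Let a
combination of Green quotients agree with u on the ball of radius j. Outside the ball it is harmonic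
while `gen u` is geometrically small, so the barrier bounds the difference by a multiple of √(3λ)^j
(`exists_potential_near`). Thus u is a uniform limit of combinations of Martin kernels.

Density: by Stone–Weierstrass it suffices to approximate each Martin kernel uniformly by functions
of finite energy. A Harnack inequality, carried into the depth by a comparison with a cutoff
function (`exists_lower_bound`), makes the oscillation of harmonic functions on stars decay
geometrically. From a deep level on, the kernel may then be replaced by a harmonic spline on the
gasket. From one level to the next the spline energy shrinks by 3/5 and the conductances grow by
1/(3λ); the total energy is finite because 5λ > 1 (`energy_spline_lt_top`). -/

namespace SierpinskiRep

/-! ### Barycentric coordinates and the combinatorics of horizontal edges -/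

/-- The barycentric coordinates with respect to the three corners. -/
noncomputable def bary (j : Fin 3) (x : EuclideanSpace ℝ (Fin 2)) : ℝ :=
  ![1 - x 0 - x 1 / √3, x 0 - x 1 / √3, 2 * x 1 / √3] j

theorem continuous_bary (j : Fin 3) : Continuous (bary j) := by
  fin_cases j
  · change Continuous fun x : EuclideanSpace ℝ (Fin 2) => 1 - x 0 - x 1 / √3
    fun_prop
  · change Continuous fun x : EuclideanSpace ℝ (Fin 2) => x 0 - x 1 / √3
    fun_prop
  · change Continuous fun x : EuclideanSpace ℝ (Fin 2) => 2 * x 1 / √3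
    fun_prop

theorem sum_bary (x : EuclideanSpace ℝ (Fin 2)) : ∑ j, bary j x = 1 := by
  simp [bary, Fin.sum_univ_three]; ring

/-- In these coordinates f_i halves everything and adds 1/2 to the coordinate i, so the letters of a
word can be read off from the points of its cell. -/
theorem bary_contr (i j : Fin 3) (x : EuclideanSpace ℝ (Fin 2)) :
    bary j (contr i x) = (bary j x + if i = j then 1 else 0) / 2 := by
  have h3 : √3 ≠ 0 := by positivity
  have h3' : √3 * √3 = 3 := Real.mul_self_sqrt (by norm_num)
  fin_cases i <;> fin_cases j <;> simp [bary, contr, corner] <;> field_simp <;> ring_nf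

theorem bary_corner_nonneg (i j : Fin 3) : 0 ≤ bary j (corner i) := by
  have h3 : √3 ≠ 0 := by positivity
  fin_cases i <;> fin_cases j <;> simp [bary, corner] <;> field_simp <;> norm_num

theorem bary_nonneg (j : Fin 3) {x : EuclideanSpace ℝ (Fin 2)} (hx : x ∈ gasket) :
    0 ≤ bary j x := by
  have hV : ∀ n, ∀ y ∈ gasketVertices n, 0 ≤ bary j y := by
    intro n
    induction n with
    | zero => rintro _ ⟨i, rfl⟩; exact bary_corner_nonneg i j
    | succ n ih =>
      intro y hy
      simp only [gasketVertices, Set.mem_iUnion] at hy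
      obtain ⟨i, z, hz, rfl⟩ := hy
      rw [bary_contr]
      have := ih z hz
      split_ifs <;> linarith
  refine closure_minimal (t := {x | 0 ≤ bary j x}) ?_
    (isClosed_le continuous_const (continuous_bary j)) hx
  intro y hy
  obtain ⟨n, hn⟩ := Set.mem_iUnion.mp hy
  exact hV n y hn

theorem bary_le_one (j : Fin 3) {x : EuclideanSpace ℝ (Fin 2)} (hx : x ∈ gasket) :
    bary j x ≤ 1 := by
  rw [← sum_bary x]
  exact Finset.single_le_sum (f := fun j => bary j x) (fun i _ => bary_nonneg i hx)
    (Finset.mem_univ j)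

theorem corner_mem (i : Fin 3) : corner i ∈ gasket :=
  subset_closure (Set.mem_iUnion.mpr ⟨0, ⟨i, rfl⟩⟩)

theorem continuous_contr (i : Fin 3) : Continuous (contr i) := by
  unfold contr; fun_prop

theorem contr_injective (i : Fin 3) : Function.Injective (contr i) := by
  intro x y h
  simpa [contr] using h

theorem contr_mem (i : Fin 3) {x : EuclideanSpace ℝ (Fin 2)} (hx : x ∈ gasket) :
    contr i x ∈ gasket := by
  have h := image_closure_subset_closure_image (continuous_contr i)
    (s := ⋃ n, gasketVertices n) ⟨x, hx, rfl⟩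
  refine closure_mono ?_ h
  rintro _ ⟨y, hy, rfl⟩
  obtain ⟨n, hn⟩ := Set.mem_iUnion.mp hy
  exact Set.mem_iUnion.mpr ⟨n + 1, Set.mem_iUnion.mpr ⟨i, y, hn, rfl⟩⟩

theorem contr_corner_comm (i j : Fin 3) : contr i (corner j) = contr j (corner i) := by
  simp [contr, add_comm]

theorem contr_corner_self (i : Fin 3) : contr i (corner i) = corner i := by
  rw [contr, ← two_smul ℝ (corner i), smul_smul]; norm_num

theorem map_append (x y : List (Fin 3)) (q : EuclideanSpace ℝ (Fin 2)) :
    Word.map (x ++ y : List (Fin 3)) q = Word.map x (Word.map y q) := by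
  simp [Word.map, List.foldr_append]

theorem map_cons (i : Fin 3) (y : List (Fin 3)) (q : EuclideanSpace ℝ (Fin 2)) :
    Word.map (i :: y : List (Fin 3)) q = contr i (Word.map y q) := rfl

theorem map_mem (x : List (Fin 3)) {q : EuclideanSpace ℝ (Fin 2)} (hq : q ∈ gasket) :
    Word.map x q ∈ gasket := by
  induction x with
  | nil => exact hq
  | cons i x ih => exact contr_mem i ih

theorem map_replicate_corner (k : ℕ) (i : Fin 3) :
    Word.map (List.replicate k i) (corner i) = corner i := by
  induction k with
  | zero => rfl
  | succ k ih => rw [List.replicate_succ, map_cons, ih, contr_corner_self]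

theorem cell_append_subset (x y : List (Fin 3)) :
    Word.cell (x ++ y : List (Fin 3)) ⊆ Word.cell x := by
  rintro _ ⟨q, hq, rfl⟩
  exact ⟨Word.map y q, map_mem y hq, (map_append x y q).symm⟩

theorem map_corner_mem_cell (x : Word) (i : Fin 3) : x.map (corner i) ∈ x.cell :=
  ⟨_, corner_mem i, rfl⟩

/-- A first letter other than i would leave the coordinate i at most 1/2. -/
theorem eq_replicate_of_mem_cell (y : List (Fin 3)) (i : Fin 3) :
    ∀ q ∈ Word.cell y, bary i q = 1 → y = List.replicate y.length i := by
  induction y with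
  | nil => intros; rfl
  | cons l y ih =>
    rintro _ ⟨q, hq, rfl⟩ h1
    rw [map_cons, bary_contr] at h1
    have h2 := bary_le_one i (map_mem y hq)
    split_ifs at h1 with hl
    · subst hl
      rw [List.length_cons, List.replicate_succ, ← ih _ ⟨q, hq, rfl⟩ (by linarith)]
    · linarith

/-! ### Horizontal edges as exchanges of letters -/

/-- The two words are of the form `u i j … j` and `u j i … i`. -/
def IsFlip (x y : List (Fin 3)) : Prop :=
  ∃ (u : List (Fin 3)) (i j : Fin 3) (k : ℕ), i ≠ j ∧ x = u ++ i :: List.replicate k j ∧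
    y = u ++ j :: List.replicate k i

/-- A common prefix is removed by injectivity of the contractions. At the first distinct letters i ≠
j, a common point has coordinate i at least 1/2 seen from x and at most 1/2 seen from y, hence both
are equalities and the tail of y sits at the corner i; symmetrically, the tail of x sits at the
corner j. -/
theorem isFlip_of_inter (x : List (Fin 3)) : ∀ y : List (Fin 3), x.length = y.length → x ≠ y →
    (Word.cell x ∩ Word.cell y).Nonempty → IsFlip x y := by
  induction x with
  | nil => intro y hl hne; exact absurd (List.length_eq_zero_iff.mp hl.symm).symm hne
  | cons i x ih =>
    intro y hl hne ⟨q, hqx, hqy⟩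
    cases y with
    | nil => simp at hl
    | cons j y =>
      obtain ⟨a, ha, rfl⟩ := hqx
      obtain ⟨b, hb, hab⟩ := hqy
      rw [map_cons, map_cons] at hab
      by_cases hij : i = j
      · subst hij
        have := contr_injective i hab
        obtain ⟨u, i', j', k, h1, h2, h3⟩ := ih y (by simpa using hl) (by simpa using hne)
          ⟨_, ⟨a, ha, rfl⟩, ⟨b, hb, this⟩⟩
        exact ⟨i :: u, i', j', k, h1, by simp [h2], by simp [h3]⟩
      · have hl' : x.length = y.length := by simpa using hl
        have hx := map_mem x ha
        have hy := map_mem y hb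
        have e1 := congrArg (bary i) hab
        have e2 := congrArg (bary j) hab
        rw [bary_contr, bary_contr] at e1 e2
        rw [if_neg (Ne.symm hij), if_pos rfl] at e1
        rw [if_neg hij, if_pos rfl] at e2
        have y1 := eq_replicate_of_mem_cell y i _ ⟨b, hb, rfl⟩
          (le_antisymm (bary_le_one i hy) (by linarith [bary_nonneg i hx]))
        have x1 := eq_replicate_of_mem_cell x j _ ⟨a, ha, rfl⟩
          (le_antisymm (bary_le_one j hx) (by linarith [bary_nonneg j hy]))
        exact ⟨[], i, j, x.length, hij, by simpa using x1, by simpa [hl'] using y1⟩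

theorem IsFlip.map_eq {u : List (Fin 3)} {i j : Fin 3} {k : ℕ} :
    Word.map (u ++ i :: List.replicate k j : List (Fin 3)) (corner j) =
      Word.map (u ++ j :: List.replicate k i : List (Fin 3)) (corner i) := by
  rw [map_append, map_append, map_cons, map_cons, map_replicate_corner, map_replicate_corner,
    contr_corner_comm]

theorem horAdj_iff {x y : Word} : HorAdj x y ↔ IsFlip x y := by
  constructor
  · rintro ⟨_, h2, h3, h4⟩
    exact isFlip_of_inter x y h2 h3 h4
  · rintro ⟨u, i, j, k, hij, hx, hy⟩
    refine ⟨?_, ?_, ?_, ?_⟩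
    · rw [hx]; simp [Word.len]; omega
    · rw [hx, hy]; simp [Word.len]
    · intro h
      rw [hx, hy] at h
      have h' : u ++ i :: List.replicate k j = u ++ j :: List.replicate k i := h
      simp [hij] at h'
    · refine ⟨x.map (corner j), map_corner_mem_cell x j, ?_⟩
      rw [hx, IsFlip.map_eq, ← hy]
      exact map_corner_mem_cell y i

theorem HorAdj.symm {x y : Word} (h : HorAdj x y) : HorAdj y x :=
  ⟨h.2.1 ▸ h.1, h.2.1.symm, h.2.2.1.symm, Set.inter_comm _ _ ▸ h.2.2.2⟩

theorem VertAdj.symm {x y : Word} (h : VertAdj x y) : VertAdj y x := Or.symm h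

/-! ### Fathers, children, ancestors -/

/-- The father of a word (the root is its own father). -/
def Word.father (x : Word) : Word := List.dropLast x

/-- The ancestor of `x` on level `m` (`x` itself if `x` has length at most `m`). -/
def Word.anc (m : ℕ) (x : Word) : Word := List.take m x

@[simp] theorem len_root : Word.root.len = 0 := rfl

@[simp] theorem len_child (x : Word) (i : Fin 3) : (x.child i).len = x.len + 1 :=
  (List.length_append (as := x) (bs := [i]))

@[simp] theorem father_child (x : Word) (i : Fin 3) : (x.child i).father = x :=
  List.dropLast_concat

theorem child_inj {x y : Word} {i j : Fin 3} : x.child i = y.child j ↔ x = y ∧ i = j := by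
  constructor
  · intro h
    have h' := List.append_inj' (h : HAppend.hAppend (α := List (Fin 3)) x [i] =
      HAppend.hAppend (α := List (Fin 3)) y [j]) rfl
    exact ⟨h'.1, List.singleton_inj.mp h'.2⟩
  · rintro ⟨rfl, rfl⟩; rfl

theorem eq_root_of_len {x : Word} (h : x.len = 0) : x = Word.root :=
  List.length_eq_zero_iff.mp h

theorem exists_eq_child {x : Word} (h : 0 < x.len) : ∃ y i, x = Word.child y i := by
  rcases List.eq_nil_or_concat x with h0 | ⟨y, i, h1⟩
  · have : x.len = 0 := by rw [h0]; rfl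
    omega
  · exact ⟨y, i, h1.trans List.concat_eq_append⟩

theorem len_anc {m : ℕ} {x : Word} (h : m ≤ x.len) : (x.anc m).len = m :=
  (List.length_take (l := x)).trans (min_eq_left h)

theorem anc_anc {m n : ℕ} (h : m ≤ n) (x : Word) : (x.anc n).anc m = x.anc m :=
  (List.take_take (l := x)).trans (by rw [min_eq_left h]; rfl)

theorem anc_self {m : ℕ} {x : Word} (h : x.len ≤ m) : x.anc m = x := List.take_of_length_le h

theorem anc_child {m : ℕ} {x : Word} (h : m ≤ x.len) (i : Fin 3) : (x.child i).anc m = x.anc m :=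
  List.take_append_of_le_length h

theorem cell_subset_anc (m : ℕ) (x : Word) : x.cell ⊆ (x.anc m).cell := by
  have h : x = (x.take m ++ x.drop m : List (Fin 3)) := (List.take_append_drop m x).symm
  conv_lhs => rw [h]
  exact cell_append_subset _ _

/-- Equal or horizontally adjacent. -/
def Near (x y : Word) : Prop := x = y ∨ HorAdj x y

theorem Near.len_eq {x y : Word} (h : Near x y) : x.len = y.len :=
  h.elim (congrArg _) fun h => h.2.1

theorem near_of_inter {x y : Word} (hl : x.len = y.len) (h : (x.cell ∩ y.cell).Nonempty) :
    Near x y := by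
  by_cases hxy : x = y
  · exact Or.inl hxy
  · refine Or.inr ⟨?_, hl, hxy, h⟩
    by_contra h0
    exact hxy ((eq_root_of_len (by omega)).trans (eq_root_of_len (by omega)).symm)

/-- Cells lie in the cells of ancestors, so a common point stays common. -/
theorem Near.anc {x y : Word} (h : Near x y) {m : ℕ} (hm : m ≤ x.len) :
    Near (x.anc m) (y.anc m) := by
  rcases h with rfl | h
  · exact Or.inl rfl
  · obtain ⟨q, hx, hy⟩ := h.2.2.2
    exact near_of_inter (by rw [len_anc hm, len_anc (h.2.1 ▸ hm)])
      ⟨q, cell_subset_anc m x hx, cell_subset_anc m y hy⟩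

theorem horAdj_sibling (x : Word) {i j : Fin 3} (hij : i ≠ j) : HorAdj (x.child i) (x.child j) :=
  horAdj_iff.mpr ⟨x, i, j, 0, hij, rfl, rfl⟩

/-- Two adjacent words have adjacent children. -/
theorem exists_horAdj_child {x y : Word} (h : HorAdj x y) :
    ∃ i j, HorAdj (x.child i) (y.child j) := by
  obtain ⟨u, i, j, k, hij, hx, hy⟩ := horAdj_iff.mp h
  refine ⟨j, i, horAdj_iff.mpr ⟨u, i, j, k + 1, hij, ?_, ?_⟩⟩
  · rw [hx]
    change (u ++ i :: List.replicate k j) ++ [j] = _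
    rw [List.replicate_succ']; simp
  · rw [hy]
    change (u ++ j :: List.replicate k i) ++ [i] = _
    rw [List.replicate_succ']; simp

/-! ### Levels and neighbourhoods -/

open Classical in
/-- The words of length `n`. -/
noncomputable def level : ℕ → Finset Word
  | 0 => {Word.root}
  | n + 1 => (level n ×ˢ Finset.univ).image fun p => p.1.child p.2

theorem mem_level {n : ℕ} {x : Word} : x ∈ level n ↔ x.len = n := by
  classical
  induction n generalizing x with
  | zero =>
    rw [level, Finset.mem_singleton]
    exact ⟨fun h => h ▸ rfl, eq_root_of_len⟩
  | succ n ih =>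
    simp only [level, Finset.mem_image, Finset.mem_product, Finset.mem_univ, and_true, Prod.exists]
    constructor
    · rintro ⟨a, i, ha, rfl⟩
      rw [len_child, ih.mp ha]
    · intro h
      obtain ⟨y, i, rfl⟩ := exists_eq_child (x := x) (by omega)
      exact ⟨y, i, ih.mpr (by simpa using h), rfl⟩

theorem sum_level_succ {M : Type*} [AddCommMonoid M] (n : ℕ) (F : Word → M) :
    ∑ x ∈ level (n + 1), F x = ∑ x ∈ level n, ∑ i, F (x.child i) := by
  classical
  rw [level, Finset.sum_image, Finset.sum_product]
  rintro ⟨a, i⟩ _ ⟨b, j⟩ _ h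
  obtain ⟨h1, h2⟩ := child_inj.mp h
  exact Prod.ext h1 h2

open Classical in
/-- The horizontal neighbours of a word. -/
noncomputable def hor (x : Word) : Finset Word := (level x.len).filter (HorAdj x)

@[simp] theorem mem_hor {x y : Word} : y ∈ hor x ↔ HorAdj x y := by
  classical
  rw [hor, Finset.mem_filter, mem_level]
  exact ⟨fun h => h.2, fun h => ⟨h.2.1.symm, h⟩⟩

/-- Exchanges the letter `j` with the next different letter `i` in `j … j i r`. -/
def exchange (j : Fin 3) (r : List (Fin 3)) : List (Fin 3) :=
  match r.dropWhile (· = j) with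
  | [] => []
  | i :: u => u.reverse ++ j :: List.replicate (r.takeWhile (· = j)).length i

/-- The word obtained from `x = u i j … j` by the exchange `u j i … i`. -/
def flipTail (x : Word) : Word := exchange ((List.reverse x).headD 0) (List.reverse x)

theorem flipTail_eq {u : List (Fin 3)} {i j : Fin 3} {k : ℕ} (hij : i ≠ j) :
    flipTail (u ++ i :: List.replicate (k + 1) j : List (Fin 3)) =
      (u ++ j :: List.replicate (k + 1) i : List (Fin 3)) := by
  have h : (u ++ i :: List.replicate (k + 1) j).reverse =
      List.replicate (k + 1) j ++ i :: u.reverse := by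
    simp
  have h2 : (List.replicate (k + 1) j ++ i :: u.reverse).headD 0 = j := by
    simp [List.replicate_succ]
  have h3 : List.dropWhile (fun x => decide (x = j)) (List.replicate (k + 1) j ++ i :: u.reverse)
      = i :: u.reverse := by
    rw [List.dropWhile_append_of_pos (by intro a ha; simpa using (List.eq_of_mem_replicate ha)),
      List.dropWhile_cons_of_neg (by simpa using hij)]
  have h4 : List.takeWhile (fun x => decide (x = j)) (List.replicate (k + 1) j ++ i :: u.reverse)
      = List.replicate (k + 1) j := by
    rw [List.takeWhile_append_of_pos (by intro a ha; simpa using (List.eq_of_mem_replicate ha)),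
      List.takeWhile_cons_of_neg (by simpa using hij)]
    simp
  change exchange ((u ++ i :: List.replicate (k + 1) j).reverse.headD 0)
    (u ++ i :: List.replicate (k + 1) j).reverse = _
  rw [h, h2, exchange, h3, h4]
  simp

/-- In an exchange u i j…j ↔ u j i…i either the tail is empty and the neighbour has the same father,
or the tail is nonempty and x determines the neighbour, which is `flipTail x`. -/
theorem card_hor_le (x : Word) : (hor x).card ≤ 4 := by
  classical
  have hsub : hor x ⊆ insert (flipTail x) (Finset.univ.image fun i => x.father.child i) := by
    intro y hy
    obtain ⟨u, i, j, k, hij, hx, hy'⟩ := horAdj_iff.mp (mem_hor.mp hy)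
    cases k with
    | zero =>
      refine Finset.mem_insert_of_mem (Finset.mem_image.mpr ⟨j, Finset.mem_univ _, ?_⟩)
      subst hx hy'
      exact congrArg (fun z : Word => z.child j) (father_child u i)
    | succ k =>
      refine Finset.mem_insert.mpr (Or.inl ?_)
      rw [hy', hx, flipTail_eq hij]
  calc (hor x).card ≤ _ := Finset.card_le_card hsub
    _ ≤ (Finset.univ.image fun i => x.father.child i).card + 1 := Finset.card_insert_le _ _
    _ ≤ 3 + 1 := by gcongr; exact Finset.card_image_le.trans (by simp)

/-! ### Conductances -/

/-- The range of the parameters. -/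
structure Admissible (lam C₁ C₂ : ℝ) : Prop where
  lower : 1 / 5 < lam
  upper : lam < 1 / 3
  pos₁ : 0 < C₁
  pos₂ : 0 < C₂

theorem Admissible.pos {lam C₁ C₂ : ℝ} (H : Admissible lam C₁ C₂) : 0 < lam := by
  linarith [H.lower]

open Classical in
/-- The neighbours of a word in the Sierpiński graph. -/
noncomputable def nbr (x : Word) : Finset Word :=
  (if x.len = 0 then ∅ else {x.father}) ∪ (Finset.univ.image x.child ∪ hor x)

open Classical in
/-- The unnormalized conductance of a horizontal edge. -/
noncomputable def kap (C₁ C₂ : ℝ) (x y : Word) : ℝ := if x.vertex ≠ y.vertex then C₁ else C₂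

theorem kap_comm (C₁ C₂ : ℝ) (x y : Word) : kap C₁ C₂ x y = kap C₁ C₂ y x := by
  simp only [kap, ne_comm]

theorem len_father_add {x : Word} (h : 0 < x.len) : x.father.len + 1 = x.len := by
  obtain ⟨y, i, rfl⟩ := exists_eq_child h
  rw [father_child, len_child]

theorem child_father {x : Word} (h : 0 < x.len) : ∃ i, x.father.child i = x := by
  obtain ⟨y, i, rfl⟩ := exists_eq_child h
  exact ⟨i, by rw [father_child]⟩

theorem vertAdj_iff {x y : Word} :
    VertAdj x y ↔ (∃ i, y = x.child i) ∨ (0 < x.len ∧ y = x.father) := by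
  refine or_congr Iff.rfl ⟨?_, ?_⟩
  · rintro ⟨i, rfl⟩; simp
  · rintro ⟨h, rfl⟩
    obtain ⟨i, hi⟩ := child_father h
    exact ⟨i, hi.symm⟩

theorem mem_nbr {x y : Word} : y ∈ nbr x ↔ VertAdj x y ∨ HorAdj x y := by
  classical
  rw [vertAdj_iff, nbr]
  simp only [Finset.mem_union, Finset.mem_image, Finset.mem_univ, true_and, mem_hor]
  have h1 : (y ∈ if x.len = 0 then (∅ : Finset Word) else {x.father}) ↔
      0 < x.len ∧ y = x.father := by
    split_ifs with h
    · simp [h]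
    · simp [Nat.pos_of_ne_zero h]
  rw [h1]
  simp only [eq_comm (a := y) (b := Word.child x _)]
  tauto

theorem nbr_symm {x y : Word} (h : y ∈ nbr x) : x ∈ nbr y :=
  mem_nbr.mpr ((mem_nbr.mp h).imp VertAdj.symm HorAdj.symm)

theorem child_mem_nbr (x : Word) (i : Fin 3) : x.child i ∈ nbr x :=
  mem_nbr.mpr (Or.inl (Or.inl ⟨i, rfl⟩))

theorem father_mem_nbr {x : Word} (h : 0 < x.len) : x.father ∈ nbr x :=
  mem_nbr.mpr (Or.inl (vertAdj_iff.mpr (Or.inr ⟨h, rfl⟩)))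

theorem hor_mem_nbr {x y : Word} (h : HorAdj x y) : y ∈ nbr x := mem_nbr.mpr (Or.inr h)

theorem hor_root {x : Word} (h : x.len = 0) : hor x = ∅ := by
  refine Finset.eq_empty_of_forall_notMem fun y hy => ?_
  have := (mem_hor.mp hy).1
  omega

theorem sum_nbr_aux {M : Type*} [AddCommMonoid M] (x : Word) (F : Word → M) :
    ∑ y ∈ nbr x, F y =
      (if x.len = 0 then 0 else F x.father) + ((∑ i, F (x.child i)) + ∑ y ∈ hor x, F y) := by
  classical
  rw [nbr, Finset.sum_union, Finset.sum_union, Finset.sum_image]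
  · congr 1
    split_ifs <;> simp
  · intro i _ j _ h
    exact (child_inj.mp h).2
  · refine Finset.disjoint_left.mpr fun y hy hy' => ?_
    obtain ⟨i, -, rfl⟩ := Finset.mem_image.mp hy
    have := (mem_hor.mp hy').2.1
    rw [len_child] at this
    omega
  · refine Finset.disjoint_left.mpr fun y hy hy' => ?_
    split_ifs at hy with h
    · simp at hy
    · have h1 := len_father_add (Nat.pos_of_ne_zero h)
      rw [← Finset.mem_singleton.mp hy] at h1
      rcases Finset.mem_union.mp hy' with h2 | h2
      · obtain ⟨i, -, rfl⟩ := Finset.mem_image.mp h2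
        rw [len_child] at h1
        omega
      · have := (mem_hor.mp h2).2.1
        omega

theorem sum_nbr {M : Type*} [AddCommMonoid M] {x : Word} (h : 0 < x.len) (F : Word → M) :
    ∑ y ∈ nbr x, F y = F x.father + ((∑ i, F (x.child i)) + ∑ y ∈ hor x, F y) := by
  rw [sum_nbr_aux, if_neg (by omega)]

theorem sum_nbr_root {M : Type*} [AddCommMonoid M] {x : Word} (h : x.len = 0) (F : Word → M) :
    ∑ y ∈ nbr x, F y = ∑ i, F (x.child i) := by
  rw [sum_nbr_aux, if_pos h, hor_root h]; simp

section

variable {lam C₁ C₂ : ℝ}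

theorem kap_pos (H : Admissible lam C₁ C₂) (x y : Word) : 0 < kap C₁ C₂ x y := by
  unfold kap; split_ifs
  exacts [H.pos₁, H.pos₂]

theorem kap_le (H : Admissible lam C₁ C₂) (x y : Word) : kap C₁ C₂ x y ≤ C₁ + C₂ := by
  have := H.pos₁
  have := H.pos₂
  unfold kap; split_ifs <;> linarith

theorem min_le_kap (x y : Word) : min C₁ C₂ ≤ kap C₁ C₂ x y := by
  unfold kap; split_ifs
  exacts [min_le_left _ _, min_le_right _ _]

theorem VertAdj.len_ne {x y : Word} (h : VertAdj x y) : x.len ≠ y.len := by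
  rcases h with ⟨i, rfl⟩ | ⟨i, rfl⟩ <;> rw [len_child] <;> omega

theorem conductance_child (x : Word) (i : Fin 3) :
    conductance lam C₁ C₂ x (x.child i) = 1 / (3 * lam) ^ x.len := by
  rw [conductance, if_pos (show VertAdj _ _ from Or.inl ⟨i, rfl⟩), len_child,
    min_eq_left (Nat.le_succ _)]

theorem conductance_hor {x y : Word} (h : HorAdj x y) :
    conductance lam C₁ C₂ x y = kap C₁ C₂ x y / (3 * lam) ^ x.len := by
  rw [conductance, if_neg (fun hv => hv.len_ne h.2.1), if_pos h]
  rfl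

theorem conductance_eq_zero {x y : Word} (h : y ∉ nbr x) : conductance lam C₁ C₂ x y = 0 := by
  rw [mem_nbr, not_or] at h
  rw [conductance, if_neg h.1, if_neg h.2]

theorem conductance_comm (x y : Word) :
    conductance lam C₁ C₂ x y = conductance lam C₁ C₂ y x := by
  by_cases hv : VertAdj x y
  · rw [conductance, conductance, if_pos hv, if_pos hv.symm, min_comm]
  · by_cases hh : HorAdj x y
    · rw [conductance_hor hh, conductance_hor hh.symm, kap_comm, hh.2.1]
    · rw [conductance_eq_zero (by simp [mem_nbr, hv, hh]),
        conductance_eq_zero fun h => by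
          rw [mem_nbr] at h; exact h.elim (fun h => hv h.symm) fun h => hh h.symm]

theorem conductance_father {x : Word} (h : 0 < x.len) :
    conductance lam C₁ C₂ x x.father = 1 / (3 * lam) ^ x.father.len := by
  obtain ⟨i, hi⟩ := child_father h
  conv_lhs => rw [conductance_comm, ← hi, father_child]
  exact conductance_child _ _

theorem conductance_pos (H : Admissible lam C₁ C₂) {x y : Word} (h : y ∈ nbr x) :
    0 < conductance lam C₁ C₂ x y := by
  have := H.pos
  rw [conductance]
  split_ifs with h1 h2 h3
  · positivity
  · exact div_pos H.pos₁ (by positivity)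
  · exact div_pos H.pos₂ (by positivity)
  · exact absurd (mem_nbr.mp h) (by tauto)

theorem conductance_nonneg (H : Admissible lam C₁ C₂) (x y : Word) :
    0 ≤ conductance lam C₁ C₂ x y := by
  by_cases h : y ∈ nbr x
  · exact (conductance_pos H h).le
  · exact (conductance_eq_zero h).ge

theorem tsum_conductance_mul (x : Word) (F : Word → ℝ) :
    ∑' y, conductance lam C₁ C₂ x y * F y = ∑ y ∈ nbr x, conductance lam C₁ C₂ x y * F y :=
  tsum_eq_sum fun y hy => by rw [conductance_eq_zero hy, zero_mul]

theorem totalConductance_eq (x : Word) :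
    totalConductance lam C₁ C₂ x = ∑ y ∈ nbr x, conductance lam C₁ C₂ x y := by
  have h := tsum_conductance_mul (lam := lam) (C₁ := C₁) (C₂ := C₂) x fun _ => 1
  simp only [mul_one] at h
  exact h

theorem totalConductance_pos (H : Admissible lam C₁ C₂) (x : Word) :
    0 < totalConductance lam C₁ C₂ x := by
  rw [totalConductance_eq]
  exact Finset.sum_pos (fun y hy => conductance_pos H hy) ⟨_, child_mem_nbr x 0⟩

/-- The edge to the father belongs to the level above; as 3λ < 1, its conductance is still at most
that of the level of x. -/
theorem totalConductance_le (H : Admissible lam C₁ C₂) (x : Word) :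
    totalConductance lam C₁ C₂ x ≤ (4 + 4 * (C₁ + C₂)) / (3 * lam) ^ x.len := by
  have hl := H.pos
  have hl' := H.upper
  rw [totalConductance_eq, sum_nbr_aux]
  have h1 : (if x.len = 0 then 0 else conductance lam C₁ C₂ x x.father) ≤
      1 / (3 * lam) ^ x.len := by
    split_ifs with h
    · positivity
    · rw [conductance_father (by omega)]
      refine one_div_le_one_div_of_le (by positivity) ?_
      exact pow_le_pow_of_le_one (by positivity) (by linarith)
        (by have := len_father_add (x := x) (by omega); omega)
  have h2 : ∑ y ∈ hor x, conductance lam C₁ C₂ x y ≤ 4 * ((C₁ + C₂) / (3 * lam) ^ x.len) := by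
    have h3 : ∀ y ∈ hor x, conductance lam C₁ C₂ x y ≤ (C₁ + C₂) / (3 * lam) ^ x.len := by
      intro y hy
      rw [conductance_hor (mem_hor.mp hy)]
      gcongr
      exact kap_le H x y
    refine (Finset.sum_le_card_nsmul _ _ _ h3).trans ?_
    rw [nsmul_eq_mul]
    have := H.pos₁
    have := H.pos₂
    gcongr
    exact_mod_cast card_hor_le x
  simp only [conductance_child, Fin.sum_univ_three]
  calc _ ≤ 1 / (3 * lam) ^ x.len + ((1 / (3 * lam) ^ x.len + 1 / (3 * lam) ^ x.len +
        1 / (3 * lam) ^ x.len) + 4 * ((C₁ + C₂) / (3 * lam) ^ x.len)) := by gcongr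
    _ = _ := by field_simp; ring

/-! ### The generator of the transformed walk -/

variable (lam C₁ C₂)

/-- The generator of the walk conditioned to return to the root (away from the root). -/
noncomputable def gen (v : Word → ℝ) (x : Word) : ℝ :=
  3 * (v x.father - v x) + lam * ∑ i, (v (x.child i) - v x) +
    ∑ y ∈ hor x, kap C₁ C₂ x y * (v y - v x)

theorem gen_add (u v : Word → ℝ) (x : Word) :
    gen lam C₁ C₂ (fun y => u y + v y) x = gen lam C₁ C₂ u x + gen lam C₁ C₂ v x := by
  have : ∀ y, kap C₁ C₂ x y * (u y + v y - (u x + v x)) =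
      kap C₁ C₂ x y * (u y - u x) + kap C₁ C₂ x y * (v y - v x) := fun y => by ring
  simp only [gen, this, Finset.sum_add_distrib, Fin.sum_univ_three]
  ring

theorem gen_const_mul (a : ℝ) (v : Word → ℝ) (x : Word) :
    gen lam C₁ C₂ (fun y => a * v y) x = a * gen lam C₁ C₂ v x := by
  have : ∀ y, kap C₁ C₂ x y * (a * v y - a * v x) = a * (kap C₁ C₂ x y * (v y - v x)) :=
    fun y => by ring
  simp only [gen, this, ← Finset.mul_sum, Fin.sum_univ_three]
  ring

theorem gen_sub (u v : Word → ℝ) (x : Word) :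
    gen lam C₁ C₂ (fun y => u y - v y) x = gen lam C₁ C₂ u x - gen lam C₁ C₂ v x := by
  have h := gen_add lam C₁ C₂ u (fun y => (-1) * v y) x
  rw [gen_const_mul] at h
  simp only [neg_mul, one_mul, ← sub_eq_add_neg] at h
  exact h

theorem gen_const (a : ℝ) (x : Word) : gen lam C₁ C₂ (fun _ => a) x = 0 := by
  simp [gen]

theorem gen_level (a : ℕ → ℝ) {x : Word} {n : ℕ} (h : x.len = n + 1) :
    gen lam C₁ C₂ (fun y => a y.len) x =
      3 * (a n - a (n + 1)) + 3 * lam * (a (n + 2) - a (n + 1)) := by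
  have h1 : x.father.len = n := by have := len_father_add (x := x) (by omega); omega
  have h2 : ∑ y ∈ hor x, kap C₁ C₂ x y * (a y.len - a x.len) = 0 :=
    Finset.sum_eq_zero fun y hy => by rw [(mem_hor.mp hy).2.1]; ring
  simp only [gen, h2]
  simp only [len_child, h1, h, Fin.sum_univ_three]
  ring

variable {lam C₁ C₂}

/-- The `h`-transform with respect to `h(x) = λ^|x|`. -/
theorem sum_conductance_transform (H : Admissible lam C₁ C₂) (v : Word → ℝ) {x : Word}
    (hx : 0 < x.len) :
    ∑ y ∈ nbr x, conductance lam C₁ C₂ x y * (lam ^ y.len * v y - lam ^ x.len * v x) =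
      (1 / 3) ^ x.len * gen lam C₁ C₂ v x := by
  have hl := H.pos
  have hf := len_father_add hx
  rw [sum_nbr hx, conductance_father hx]
  simp only [conductance_child, len_child, gen, mul_add, Fin.sum_univ_three]
  have h1 : ∑ y ∈ hor x, conductance lam C₁ C₂ x y * (lam ^ y.len * v y - lam ^ x.len * v x) =
      (1 / 3) ^ x.len * ∑ y ∈ hor x, kap C₁ C₂ x y * (v y - v x) := by
    rw [Finset.mul_sum]
    refine Finset.sum_congr rfl fun y hy => ?_
    rw [conductance_hor (mem_hor.mp hy), ← (mem_hor.mp hy).2.1, mul_pow, one_div, inv_pow]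
    field_simp
  rw [h1, ← hf]
  -- The terms without increments cancel because λ^|x| is harmonic here: 3(1 - λ) from the father
  -- against 3(λ - 1) from the three children.
  simp only [mul_pow, one_div, inv_pow, pow_succ]
  field_simp
  ring

theorem sum_conductance_transform_root (v : Word → ℝ) {x : Word} (hx : x.len = 0) :
    ∑ y ∈ nbr x, conductance lam C₁ C₂ x y * (lam ^ y.len * v y - lam ^ x.len * v x) =
      ∑ i, (lam * v (x.child i) - v x) := by
  rw [sum_nbr_root hx]
  simp [conductance_child, hx]

/-- The weights of `gen` add up to at most 3 + 3λ + 4(C₁ + C₂), and λ < 1. -/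
theorem abs_gen_le (H : Admissible lam C₁ C₂) {v : Word → ℝ} {x : Word} (hx : 0 < x.len)
    {δ : ℝ} (hδ : ∀ y ∈ nbr x, |v y - v x| ≤ δ) :
    |gen lam C₁ C₂ v x| ≤ (6 + 4 * (C₁ + C₂)) * δ := by
  have hl := H.pos
  have hl' := H.upper
  have h0 : 0 ≤ δ := (abs_nonneg _).trans (hδ _ (child_mem_nbr x 0))
  have h1 := hδ _ (father_mem_nbr hx)
  have h2 : |∑ i, (v (x.child i) - v x)| ≤ 3 * δ := by
    refine (Finset.abs_sum_le_sum_abs _ _).trans ?_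
    refine (Finset.sum_le_card_nsmul _ _ δ fun i _ => hδ _ (child_mem_nbr x i)).trans ?_
    simp
  have h3 : |∑ y ∈ hor x, kap C₁ C₂ x y * (v y - v x)| ≤ 4 * ((C₁ + C₂) * δ) := by
    refine (Finset.abs_sum_le_sum_abs _ _).trans ?_
    refine (Finset.sum_le_card_nsmul _ _ ((C₁ + C₂) * δ) fun y hy => ?_).trans ?_
    · rw [abs_mul, abs_of_pos (kap_pos H x y)]
      have := H.pos₁
      have := H.pos₂
      gcongr
      · exact kap_le H x y
      · exact hδ _ (hor_mem_nbr (mem_hor.mp hy))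
    · rw [nsmul_eq_mul]
      have := H.pos₁
      have := H.pos₂
      gcongr
      exact_mod_cast card_hor_le x
  calc |gen lam C₁ C₂ v x| ≤ |3 * (v x.father - v x)| + |lam * ∑ i, (v (x.child i) - v x)| +
        |∑ y ∈ hor x, kap C₁ C₂ x y * (v y - v x)| := abs_add_three _ _ _
    _ ≤ 3 * δ + 1 * (3 * δ) + 4 * ((C₁ + C₂) * δ) := by
      rw [abs_mul, abs_mul, abs_of_pos hl, abs_of_pos (by norm_num : (0 : ℝ) < 3)]
      gcongr
      linarith
    _ = _ := by ring

/-! ### Maximum principle and barriers -/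

theorem finite_len_le (N : ℕ) : {x : Word | x.len ≤ N}.Finite := by
  classical
  refine ((Finset.range (N + 1)).biUnion level).finite_toSet.subset fun x hx => ?_
  have hx : x.len ≤ N := hx
  rw [Finset.mem_coe, Finset.mem_biUnion]
  exact ⟨x.len, Finset.mem_range.mpr (by omega), mem_level.mpr rfl⟩

/-- The maximum principle for `gen` on a set of words: no condition at infinity is needed besides
boundedness, as the conditioned walk drifts to the root. -/
theorem maxPrinciple (H : Admissible lam C₁ C₂) {f : Word → ℝ} {M : ℝ} (T : Set Word)
    (hM : ∀ x ∈ T, f x ≤ M) (h0 : ∀ x ∈ T, 0 < x.len) (hL : ∀ x ∈ T, 0 ≤ gen lam C₁ C₂ f x)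
    (hn : ∀ x ∈ T, ∀ y ∈ nbr x, y ∈ T ∨ f y ≤ 0) : ∀ x ∈ T, f x ≤ 0 := by
  by_contra! hcon
  obtain ⟨x₀, hx₀, hpos⟩ := hcon
  -- The penalty ε|x| forces a maximum to exist: since f is bounded above, only finitely many words
  -- of `T` compete with x₀. It is small enough to keep the value at x₀ positive, so neighbours
  -- outside `T` cannot exceed the maximum.
  obtain ⟨ε, hε, hε'⟩ : ∃ ε > 0, 0 < f x₀ - ε * x₀.len := by
    refine ⟨f x₀ / (2 * (x₀.len + 1)), by positivity, ?_⟩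
    rw [sub_pos, div_mul_eq_mul_div, div_lt_iff₀ (by positivity)]
    nlinarith [(Nat.cast_nonneg x₀.len : (0 : ℝ) ≤ x₀.len)]
  have hfin : {x ∈ T | f x₀ - ε * x₀.len ≤ f x - ε * x.len}.Finite := by
    refine (finite_len_le ⌈M / ε⌉₊).subset fun x hx => ?_
    have h1 : ε * x.len ≤ M := by linarith [hM x hx.1, hx.2]
    have h2 : (x.len : ℝ) ≤ M / ε := by rw [le_div_iff₀ hε]; linarith
    exact_mod_cast h2.trans (Nat.le_ceil _)
  obtain ⟨y, hy, hmax⟩ := Set.exists_max_image _ (fun x => f x - ε * x.len) hfin ⟨x₀, hx₀, le_rfl⟩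
  have hyT := hy.1
  have hmax' : ∀ z ∈ nbr y, (f z - ε * z.len) - (f y - ε * y.len) ≤ 0 := by
    intro z hz
    rcases hn y hyT z hz with h | h
    · by_cases hz' : f x₀ - ε * x₀.len ≤ f z - ε * z.len
      · linarith [hmax z ⟨h, hz'⟩]
      · linarith [hy.2]
    · have : 0 ≤ ε * z.len := by positivity
      linarith [hy.2]
  have hle : gen lam C₁ C₂ (fun x => f x - ε * x.len) y ≤ 0 := by
    have h1 := hmax' _ (father_mem_nbr (h0 y hyT))
    have h2 := Finset.sum_nonpos fun i (_ : i ∈ Finset.univ) => hmax' _ (child_mem_nbr y i)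
    have h3 : ∑ z ∈ hor y, kap C₁ C₂ y z * ((f z - ε * z.len) - (f y - ε * y.len)) ≤ 0 :=
      Finset.sum_nonpos fun z hz => mul_nonpos_of_nonneg_of_nonpos (kap_pos H y z).le
        (hmax' z (hor_mem_nbr (mem_hor.mp hz)))
    have h4 := mul_nonpos_of_nonneg_of_nonpos H.pos.le h2
    unfold gen
    linarith
  obtain ⟨n, hn'⟩ : ∃ n, y.len = n + 1 := ⟨y.len - 1, by have := h0 y hyT; omega⟩
  -- `gen` of the length is 3λ - 3 < 0, so the penalized function has strictly positive `gen`, which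
  -- is impossible at a maximum.
  rw [gen_sub, gen_const_mul, gen_level lam C₁ C₂ (fun n => (n : ℝ)) hn'] at hle
  have h5 := hL y hyT
  have h6 := H.upper
  push_cast at hle
  nlinarith

/-- The exact value at level n + 1 is 3θ^n(1 - θ)(1 - λθ); the bound replaces 1 - λθ by the smaller
(1 - λ)θ. -/
theorem gen_pow_ge (H : Admissible lam C₁ C₂) {θ : ℝ} (h0 : 0 < θ) (h1 : θ < 1) {x : Word}
    (hx : 0 < x.len) :
    3 * (1 - θ) * (1 - lam) * θ ^ x.len ≤ gen lam C₁ C₂ (fun y => θ ^ y.len) x := by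
  obtain ⟨n, hn⟩ : ∃ n, x.len = n + 1 := ⟨x.len - 1, by omega⟩
  have hl := H.pos
  have hl' := H.upper
  rw [gen_level lam C₁ C₂ (fun n => θ ^ n) hn, hn]
  have : 3 * (θ ^ n - θ ^ (n + 1)) + 3 * lam * (θ ^ (n + 2) - θ ^ (n + 1)) -
      3 * (1 - θ) * (1 - lam) * θ ^ (n + 1) =
        3 * θ ^ n * (1 - θ) * (1 - θ) := by ring
  have h2 : 0 ≤ 3 * θ ^ n * (1 - θ) * (1 - θ) := by
    have : 0 < 1 - θ := by linarith
    positivity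
  linarith

/-- With A = B / (3(1 - θ)(1 - λ)), the barrier Aθ^|x| has `gen` at least Bθ^|x| and compensates the
negative part of `gen f`. Subtracting the constant Aθ^j makes the sum nonpositive on level j, and
the maximum principle applies below it. -/
theorem sub_le_barrier (H : Admissible lam C₁ C₂) {θ B M : ℝ} (h0 : 0 < θ) (h1 : θ < 1)
    {f : Word → ℝ} (hf : ∀ x, f x ≤ M) {j : ℕ}
    (hL : ∀ x, j < x.len → -(B * θ ^ x.len) ≤ gen lam C₁ C₂ f x)
    (hj : ∀ x, x.len = j → f x ≤ 0) (hB : 0 ≤ B) (x : Word) (hx : j ≤ x.len) :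
    f x ≤ B / (3 * (1 - θ) * (1 - lam)) * θ ^ j := by
  have hl := H.pos
  have hl' := H.upper
  have hθ : 0 < 1 - θ := by linarith
  have hla : 0 < 1 - lam := by linarith
  set A := B / (3 * (1 - θ) * (1 - lam)) with hA
  have hA0 : 0 ≤ A := by positivity
  have hAB : A * (3 * (1 - θ) * (1 - lam)) = B := by rw [hA]; field_simp
  rcases hx.eq_or_lt with hx | hx
  · exact (hj x hx.symm).trans (by positivity)
  have key := maxPrinciple H (M := M + A) (f := fun x => f x - A * θ ^ j + A * θ ^ x.len)
    {x | j < x.len}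
    (fun x _ => by
      have : A * θ ^ x.len ≤ A * 1 := by gcongr; exact pow_le_one₀ h0.le h1.le
      have : 0 ≤ A * θ ^ j := by positivity
      linarith [hf x]) (fun x hx => by have : j < x.len := hx; omega)
    (fun x hx => by
      have hx : j < x.len := hx
      rw [gen_add, gen_sub, gen_const_mul, gen_const_mul, gen_const]
      have h2 := gen_pow_ge H h0 h1 (x := x) (by omega)
      have h3 := mul_le_mul_of_nonneg_left h2 hA0
      have h4 := hL x hx
      have h5 : A * (3 * (1 - θ) * (1 - lam) * θ ^ x.len) = B * θ ^ x.len := by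
        rw [← hAB]; ring
      linarith)
    (fun x hx y hy => by
      have hx : j < x.len := hx
      by_cases hy' : j < y.len
      · exact Or.inl hy'
      · right
        have hyj : y.len = j := by
          rcases mem_nbr.mp hy with (⟨i, rfl⟩ | ⟨i, rfl⟩) | h
          · rw [len_child] at hy'; omega
          · rw [len_child] at hx; omega
          · have := h.2.1; omega
        rw [hyj]
        linarith [hj y hyj]) x hx
  have : 0 ≤ A * θ ^ x.len := by positivity
  have key : f x - A * θ ^ j + A * θ ^ x.len ≤ 0 := key
  linarith

/-- A function with small `gen` is close to the harmonic function with the same values on a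
level. -/
theorem abs_sub_le_barrier (H : Admissible lam C₁ C₂) {θ B M : ℝ} (h0 : 0 < θ) (h1 : θ < 1)
    {u v : Word → ℝ} (hM : ∀ x, |v x - u x| ≤ M) {j : ℕ} (hB : 0 ≤ B)
    (hu : ∀ x, j < x.len → |gen lam C₁ C₂ u x| ≤ B * θ ^ x.len)
    (hv : ∀ x, j < x.len → gen lam C₁ C₂ v x = 0)
    (hj : ∀ x, x.len = j → v x = u x) (x : Word) (hx : j ≤ x.len) :
    |v x - u x| ≤ B / (3 * (1 - θ) * (1 - lam)) * θ ^ j := by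
  rw [abs_le']
  refine ⟨sub_le_barrier H h0 h1 (f := fun x => v x - u x) (fun x => (abs_le.mp (hM x)).2)
    (fun x hx => ?_) (fun x hx => by simp [hj x hx]) hB x hx, ?_⟩
  · rw [gen_sub, hv x hx]
    linarith [(abs_le.mp (hu x hx)).2]
  · rw [neg_sub]
    refine sub_le_barrier H h0 h1 (f := fun x => u x - v x)
      (M := M) (fun x => by linarith [(abs_le.mp (hM x)).1])
      (fun x hx => ?_) (fun x hx => by simp [hj x hx]) hB x hx
    rw [gen_sub, hv x hx]
    linarith [(abs_le.mp (hu x hx)).1]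

/-- Uniqueness of bounded harmonic functions with given values on a level. -/
theorem eq_of_harmonic (H : Admissible lam C₁ C₂) {M : ℝ} {u v : Word → ℝ}
    (hM : ∀ x, |v x - u x| ≤ M) {j : ℕ}
    (hu : ∀ x, j < x.len → gen lam C₁ C₂ u x = 0)
    (hv : ∀ x, j < x.len → gen lam C₁ C₂ v x = 0)
    (hj : ∀ x, x.len = j → v x = u x) (x : Word) (hx : j ≤ x.len) : v x = u x := by
  have h := abs_sub_le_barrier H (θ := 1 / 2) (B := 0) (by norm_num) (by norm_num) hM le_rfl
    (fun x hx => by simp [hu x hx]) hv hj x hx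
  simp only [zero_div, zero_mul] at h
  linarith [abs_nonpos_iff.mp h]

end

/-! ### The Green function and the Martin kernels -/

section

variable {lam C₁ C₂ : ℝ}

theorem tsum_transition_mul (x : Word) (F : Word → ℝ≥0∞) :
    ∑' y, transition lam C₁ C₂ x y * F y = ∑ y ∈ nbr x, transition lam C₁ C₂ x y * F y :=
  tsum_eq_sum fun y hy => by rw [transition, conductance_eq_zero hy, zero_div]; simp

theorem transitionPow_succ (n : ℕ) (x y : Word) :
    transitionPow lam C₁ C₂ (n + 1) x y =
      ∑ z ∈ nbr x, transition lam C₁ C₂ x z * transitionPow lam C₁ C₂ n z y := by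
  rw [transitionPow, tsum_transition_mul]

/-- The definition splits off the first step; the reversal of paths needs the last one. -/
theorem transitionPow_succ' (n : ℕ) (x y : Word) :
    transitionPow lam C₁ C₂ (n + 1) x y =
      ∑' z, transitionPow lam C₁ C₂ n x z * transition lam C₁ C₂ z y := by
  classical
  induction n generalizing x with
  | zero =>
    rw [transitionPow, tsum_eq_single y, tsum_eq_single x]
    · simp [transitionPow]
    · intro z hz; simp [transitionPow, Ne.symm hz]
    · intro z hz; simp [transitionPow, hz]
  | succ n ih =>
    rw [transitionPow, tsum_congr fun z => by rw [ih z]]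
    simp only [transitionPow, ← ENNReal.tsum_mul_left, ← ENNReal.tsum_mul_right, mul_assoc]
    rw [ENNReal.tsum_comm]

theorem totalConductance_mul_transition (H : Admissible lam C₁ C₂) (x y : Word) :
    ENNReal.ofReal (totalConductance lam C₁ C₂ x) * transition lam C₁ C₂ x y =
      ENNReal.ofReal (conductance lam C₁ C₂ x y) := by
  have h := totalConductance_pos H x
  rw [transition, ← ENNReal.ofReal_mul h.le, mul_div_cancel₀ _ h.ne']

theorem transitionPow_reversible (H : Admissible lam C₁ C₂) (n : ℕ) (x y : Word) :
    ENNReal.ofReal (totalConductance lam C₁ C₂ x) * transitionPow lam C₁ C₂ n x y =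
      ENNReal.ofReal (totalConductance lam C₁ C₂ y) * transitionPow lam C₁ C₂ n y x := by
  classical
  induction n generalizing x y with
  | zero =>
    by_cases h : x = y
    · rw [h]
    · simp [transitionPow, h, Ne.symm h]
  | succ n ih =>
    rw [transitionPow_succ', transitionPow, ← ENNReal.tsum_mul_left, ← ENNReal.tsum_mul_left]
    refine tsum_congr fun z => ?_
    rw [← mul_assoc, ih, ← mul_assoc, totalConductance_mul_transition H, conductance_comm,
      ← totalConductance_mul_transition H]
    ring

theorem green_reversible (H : Admissible lam C₁ C₂) (x y : Word) :
    ENNReal.ofReal (totalConductance lam C₁ C₂ x) * green lam C₁ C₂ x y =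
      ENNReal.ofReal (totalConductance lam C₁ C₂ y) * green lam C₁ C₂ y x := by
  simp only [green, ← ENNReal.tsum_mul_left, transitionPow_reversible H _ x y]

open Classical in
theorem green_eq (x y : Word) :
    green lam C₁ C₂ x y = (if x = y then 1 else 0) +
      ∑ z ∈ nbr x, transition lam C₁ C₂ x z * green lam C₁ C₂ z y := by
  rw [green, tsum_eq_zero_add' ENNReal.summable, ← tsum_transition_mul]
  congr 1
  simp only [transitionPow, green, ← ENNReal.tsum_mul_left]
  rw [ENNReal.tsum_comm]

-- G(·, y) is the smallest nonnegative supersolution: the partial sums of the Green series stay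
-- below s by induction on the number of steps.
open Classical in
theorem green_le {y : Word} {s : Word → ℝ≥0∞}
    (hs : ∀ x, (if x = y then 1 else 0) + ∑ z ∈ nbr x, transition lam C₁ C₂ x z * s z ≤ s x)
    (x : Word) : green lam C₁ C₂ x y ≤ s x := by
  rw [green, ENNReal.tsum_eq_iSup_nat]
  refine iSup_le fun N => ?_
  induction N generalizing x with
  | zero => simp
  | succ N ih =>
    rw [Finset.sum_range_succ']
    refine le_trans ?_ (hs x)
    rw [add_comm]
    refine add_le_add (by rw [transitionPow]) ?_
    simp only [transitionPow_succ]
    rw [Finset.sum_comm]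
    refine Finset.sum_le_sum fun z _ => ?_
    rw [← Finset.mul_sum]
    gcongr
    exact ih z

/-- A strictly superharmonic function comparable to `λ^|x|`. -/
theorem exists_superharmonic (H : Admissible lam C₁ C₂) (x : Word) :
    ∑ y ∈ nbr x, conductance lam C₁ C₂ x y *
      (lam ^ y.len * (2 - (1 / 2) ^ y.len) - lam ^ x.len * (2 - (1 / 2) ^ x.len)) < 0 := by
  have hl := H.pos
  have hl' := H.upper
  by_cases hx : x.len = 0
  · rw [sum_conductance_transform_root (fun y => 2 - (1 / 2) ^ y.len) hx]
    simp only [len_child, hx, Fin.sum_univ_three]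
    norm_num
    linarith
  · obtain ⟨n, hn⟩ : ∃ n, x.len = n + 1 := ⟨x.len - 1, by omega⟩
    rw [sum_conductance_transform H (fun y => 2 - (1 / 2) ^ y.len) (by omega),
      gen_level lam C₁ C₂ (fun n => 2 - (1 / 2) ^ n) hn]
    refine mul_neg_of_pos_of_neg (by positivity) ?_
    have : 3 * (2 - (1 / 2 : ℝ) ^ n - (2 - (1 / 2) ^ (n + 1))) +
        3 * lam * (2 - (1 / 2) ^ (n + 2) - (2 - (1 / 2) ^ (n + 1))) =
        - ((1 / 2) ^ n * (3 / 2 - 3 / 4 * lam)) := by ring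
    rw [this, neg_lt_zero]
    have : 0 < 3 / 2 - 3 / 4 * lam := by linarith
    positivity

theorem exists_green_le (H : Admissible lam C₁ C₂) (y : Word) :
    ∃ M : ℝ, 0 < M ∧ ∀ x, green lam C₁ C₂ x y ≤ ENNReal.ofReal (M * lam ^ x.len) := by
  classical
  have hl := H.pos
  have hneg := exists_superharmonic H
  set s : Word → ℝ := fun x => lam ^ x.len * (2 - (1 / 2) ^ x.len) with hs
  have hs1 : ∀ n : ℕ, (0 : ℝ) ≤ 2 - (1 / 2) ^ n := fun n => by
    have : ((1 : ℝ) / 2) ^ n ≤ 1 := pow_le_one₀ (by norm_num) (by norm_num)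
    linarith
  have hs0 : ∀ x, 0 ≤ s x := fun x => mul_nonneg (by positivity) (hs1 _)
  set d : Word → ℝ := fun x => ∑ z ∈ nbr x, conductance lam C₁ C₂ x z * (s z - s x) with hd
  -- With this factor one application of P lowers M s by exactly 1 at y and raises it nowhere, so M
  -- s is a supersolution for the unit mass at y.
  set M := totalConductance lam C₁ C₂ y / -d y with hM
  have hdy : 0 < -d y := neg_pos.mpr (hneg y)
  have hM0 : 0 < M := div_pos (totalConductance_pos H y) hdy
  have key : ∀ x, green lam C₁ C₂ x y ≤ ENNReal.ofReal (M * s x) := by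
    refine green_le fun x => ?_
    have hπ := totalConductance_pos H x
    have h1 : ∑ z ∈ nbr x, transition lam C₁ C₂ x z * ENNReal.ofReal (M * s z) =
        ENNReal.ofReal (∑ z ∈ nbr x,
          conductance lam C₁ C₂ x z / totalConductance lam C₁ C₂ x * (M * s z)) := by
      rw [ENNReal.ofReal_sum_of_nonneg]
      · refine Finset.sum_congr rfl fun z _ => ?_
        rw [transition, ← ENNReal.ofReal_mul (div_nonneg (conductance_nonneg H x z) hπ.le)]
      · intro z _
        exact mul_nonneg (div_nonneg (conductance_nonneg H x z) hπ.le)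
          (mul_nonneg hM0.le (hs0 z))
    have h2 : (∑ z ∈ nbr x,
        conductance lam C₁ C₂ x z / totalConductance lam C₁ C₂ x * (M * s z)) =
          M * s x + M * d x / totalConductance lam C₁ C₂ x := by
      have h3 : ∑ z ∈ nbr x, conductance lam C₁ C₂ x z * s z =
          d x + totalConductance lam C₁ C₂ x * s x := by
        rw [hd, totalConductance_eq, Finset.sum_mul, ← Finset.sum_add_distrib]
        exact Finset.sum_congr rfl fun z _ => by ring
      have h4 : ∀ z, conductance lam C₁ C₂ x z / totalConductance lam C₁ C₂ x * (M * s z) =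
          M / totalConductance lam C₁ C₂ x * (conductance lam C₁ C₂ x z * s z) := fun z => by ring
      simp only [h4, ← Finset.mul_sum, h3]
      field_simp
      ring
    have h5 : (if x = y then (1 : ℝ≥0∞) else 0) = ENNReal.ofReal (if x = y then 1 else 0) := by
      split_ifs <;> simp
    rw [h1, h2, h5, ← ENNReal.ofReal_add (by split_ifs <;> norm_num) ?_]
    · refine ENNReal.ofReal_le_ofReal ?_
      split_ifs with hxy
      · subst hxy
        have : M * d x / totalConductance lam C₁ C₂ x = -1 := by
          have := hdy.ne'
          have : d x ≠ 0 := by simpa using this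
          rw [hM]; field_simp
        linarith
      · have : M * d x / totalConductance lam C₁ C₂ x ≤ 0 :=
          div_nonpos_of_nonpos_of_nonneg (mul_nonpos_of_nonneg_of_nonpos hM0.le (hneg x).le) hπ.le
        linarith
    · rw [← h2]
      exact Finset.sum_nonneg fun z _ =>
        mul_nonneg (div_nonneg (conductance_nonneg H x z) hπ.le) (mul_nonneg hM0.le (hs0 z))
  refine ⟨2 * M, by positivity, fun x => (key x).trans (ENNReal.ofReal_le_ofReal ?_)⟩
  have : s x ≤ lam ^ x.len * 2 := by
    have : (0 : ℝ) ≤ (1 / 2) ^ x.len := by positivity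
    exact mul_le_mul_of_nonneg_left (by linarith) (by positivity)
  nlinarith

theorem green_ne_top (H : Admissible lam C₁ C₂) (x y : Word) : green lam C₁ C₂ x y ≠ ∞ := by
  obtain ⟨M, -, h⟩ := exists_green_le H y
  exact ne_top_of_le_ne_top ENNReal.ofReal_ne_top (h x)

theorem one_le_green (x : Word) : 1 ≤ green lam C₁ C₂ x x := by
  rw [green_eq, if_pos rfl]
  exact le_self_add

variable (lam C₁ C₂) in
/-- The Green potential of the point `x`, divided by `h(y) = λ^|y|`. -/
noncomputable def greenQuot (x y : Word) : ℝ := (green lam C₁ C₂ y x).toReal / lam ^ y.len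

theorem green_toReal (H : Admissible lam C₁ C₂) (x y : Word) :
    (green lam C₁ C₂ y x).toReal = lam ^ y.len * greenQuot lam C₁ C₂ x y := by
  have := H.pos
  rw [greenQuot]
  field_simp

theorem greenQuot_nonneg (H : Admissible lam C₁ C₂) (x y : Word) :
    0 ≤ greenQuot lam C₁ C₂ x y :=
  div_nonneg ENNReal.toReal_nonneg (pow_nonneg H.pos.le _)

theorem exists_greenQuot_le (H : Admissible lam C₁ C₂) (x : Word) :
    ∃ M, ∀ y, greenQuot lam C₁ C₂ x y ≤ M := by
  obtain ⟨M, hM, h⟩ := exists_green_le H x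
  have := H.pos
  refine ⟨M, fun y => ?_⟩
  rw [greenQuot, div_le_iff₀ (by positivity)]
  exact ENNReal.toReal_le_of_le_ofReal (by positivity) (h y)

-- This is the equation G = 1 + PG multiplied by π(y), written in the form to which the transform by
-- λ^|x| applies.
open Classical in
theorem sum_green (H : Admissible lam C₁ C₂) (x y : Word) :
    ∑ z ∈ nbr y, conductance lam C₁ C₂ y z *
      (lam ^ z.len * greenQuot lam C₁ C₂ x z - lam ^ y.len * greenQuot lam C₁ C₂ x y) =
      if y = x then -totalConductance lam C₁ C₂ y else 0 := by
  have hπ := totalConductance_pos H y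
  simp only [← green_toReal H]
  have h := congrArg ENNReal.toReal (green_eq (lam := lam) (C₁ := C₁) (C₂ := C₂) y x)
  rw [ENNReal.toReal_add (by split_ifs <;> simp), ENNReal.toReal_sum] at h
  · have h1 : ∀ z, (transition lam C₁ C₂ y z * green lam C₁ C₂ z x).toReal =
        conductance lam C₁ C₂ y z * (green lam C₁ C₂ z x).toReal /
          totalConductance lam C₁ C₂ y := fun z => by
      rw [ENNReal.toReal_mul, transition, ENNReal.toReal_ofReal
        (div_nonneg (conductance_nonneg H y z) hπ.le)]
      ring
    simp only [h1, ← Finset.sum_div] at h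
    simp only [mul_sub, Finset.sum_sub_distrib, ← Finset.sum_mul, ← totalConductance_eq]
    field_simp at h
    rw [apply_ite ENNReal.toReal] at h
    split_ifs with hy <;> simp only [hy, if_true, if_false, ENNReal.toReal_one,
      ENNReal.toReal_zero] at h ⊢ <;> linarith
  · intro z _
    exact ENNReal.mul_ne_top ENNReal.ofReal_ne_top (green_ne_top H z x)
  · refine (ENNReal.sum_lt_top.mpr fun z _ => ?_).ne
    exact (ENNReal.mul_ne_top ENNReal.ofReal_ne_top (green_ne_top H z x)).lt_top

theorem gen_greenQuot (H : Admissible lam C₁ C₂) {x y : Word} (hy : 0 < y.len) (hxy : y ≠ x) :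
    gen lam C₁ C₂ (greenQuot lam C₁ C₂ x) y = 0 := by
  have h := sum_green H x y
  rw [sum_conductance_transform H _ hy, if_neg hxy] at h
  exact (mul_eq_zero.mp h).resolve_left (by positivity)

theorem abs_greenQuot_sub_le (H : Admissible lam C₁ C₂) (x : Word) (a : ℝ) :
    ∃ M, ∀ y, |greenQuot lam C₁ C₂ x y - a| ≤ M := by
  obtain ⟨M, hM⟩ := exists_greenQuot_le H x
  refine ⟨M + |a|, fun y => (abs_sub _ _).trans ?_⟩
  rw [abs_of_nonneg (greenQuot_nonneg H x y)]
  linarith [hM y]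

/-- The quotient is bounded and harmonic off the root, like the constant with the same value at the
root. Hence G(·, o) is proportional to λ^|y|, which is what normalizes the Martin kernels. -/
theorem greenQuot_root (H : Admissible lam C₁ C₂) (y : Word) :
    greenQuot lam C₁ C₂ Word.root y = greenQuot lam C₁ C₂ Word.root Word.root := by
  obtain ⟨M, hM⟩ := abs_greenQuot_sub_le H Word.root (greenQuot lam C₁ C₂ Word.root Word.root)
  refine eq_of_harmonic H (j := 0) hM (fun x _ => gen_const _ _ _ _ _) (fun x hx => ?_)
    (fun x hx => by rw [eq_root_of_len hx]) y (Nat.zero_le _)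
  exact gen_greenQuot H hx (fun h => by rw [h] at hx; simp at hx)

theorem greenQuot_self_pos (H : Admissible lam C₁ C₂) (x : Word) :
    0 < greenQuot lam C₁ C₂ x x := by
  have := H.pos
  refine div_pos (ENNReal.toReal_pos ?_ (green_ne_top H x x)) (by positivity)
  exact (zero_lt_one.trans_le (one_le_green x)).ne'

/-- The Martin kernels are the normalized Green quotients. -/
theorem martinKernel_eq (H : Admissible lam C₁ C₂) (x : Word) :
    ∃ κ : ℝ, 0 < κ ∧ ∀ y, martinKernel lam C₁ C₂ x y =
      ENNReal.ofReal (κ * greenQuot lam C₁ C₂ x y) := by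
  have hl := H.pos
  have ho := greenQuot_self_pos H Word.root
  have hπo := totalConductance_pos H Word.root
  have hπx := totalConductance_pos H x
  refine ⟨totalConductance lam C₁ C₂ Word.root / totalConductance lam C₁ C₂ x /
    greenQuot lam C₁ C₂ Word.root Word.root, by positivity, fun y => ?_⟩
  have hπy := totalConductance_pos H y
  -- Reversibility moves the variable y into the first argument. In the ratio for z = x and z = o
  -- the factors π(y) and λ^|y| cancel, and the quotient for o does not depend on y.
  have h1 : ∀ z, (green lam C₁ C₂ z y).toReal = totalConductance lam C₁ C₂ y /
      totalConductance lam C₁ C₂ z * (lam ^ y.len * greenQuot lam C₁ C₂ z y) := by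
    intro z
    have hπz := totalConductance_pos H z
    have h := congrArg ENNReal.toReal (green_reversible H z y)
    rw [ENNReal.toReal_mul, ENNReal.toReal_mul, ENNReal.toReal_ofReal hπz.le,
      ENNReal.toReal_ofReal hπy.le, green_toReal H z y] at h
    field_simp
    linarith
  have h2 : (green lam C₁ C₂ Word.root y).toReal ≠ 0 := by
    rw [h1, greenQuot_root H]
    positivity
  have h3 : green lam C₁ C₂ Word.root y ≠ 0 := fun h => h2 (by rw [h]; rfl)
  rw [martinKernel, ← ENNReal.ofReal_toReal (ENNReal.div_ne_top (green_ne_top H x y) h3),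
    ENNReal.toReal_div, h1 x, h1 Word.root, greenQuot_root H y]
  congr 1
  field_simp

end

/-! ### Continuous extension of functions of finite energy -/

section

variable {lam C₁ C₂ : ℝ}

theorem conductance_mul_sq_le (H : Admissible lam C₁ C₂) {u : Word → ℝ}
    (hu : energy lam C₁ C₂ u < ∞) (x y : Word) :
    conductance lam C₁ C₂ x y * (u x - u y) ^ 2 ≤ 2 * (energy lam C₁ C₂ u).toReal := by
  have h1 : ENNReal.ofReal (conductance lam C₁ C₂ x y * (u x - u y) ^ 2) ≤
      2 * energy lam C₁ C₂ u := by
    rw [energy, ← mul_assoc, one_div, ENNReal.mul_inv_cancel (by norm_num) (by norm_num), one_mul]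
    exact (ENNReal.le_tsum y).trans
      (ENNReal.le_tsum (f := fun x => ∑' y,
        ENNReal.ofReal (conductance lam C₁ C₂ x y * (u x - u y) ^ 2)) x)
  have h2 := ENNReal.toReal_mono (ENNReal.mul_ne_top (by norm_num) hu.ne) h1
  rwa [ENNReal.toReal_ofReal (mul_nonneg (conductance_nonneg H x y) (sq_nonneg _)),
    ENNReal.toReal_mul] at h2

/-- The 3/5 comes from the edge to the father, of conductance 3λ / (3λ)^|x| with 3λ > 3/5. -/
theorem exists_le_conductance (H : Admissible lam C₁ C₂) :
    ∃ k > 0, ∀ x, ∀ y ∈ nbr x, k / (3 * lam) ^ x.len ≤ conductance lam C₁ C₂ x y := by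
  have hl := H.pos
  have hl' := H.lower
  refine ⟨min (3 / 5) (min C₁ C₂), lt_min (by norm_num) (lt_min H.pos₁ H.pos₂), fun x y hy => ?_⟩
  rcases mem_nbr.mp hy with h | h
  · refine (div_le_div_of_nonneg_right (min_le_left _ _) (by positivity)).trans ?_
    rcases vertAdj_iff.mp h with ⟨i, rfl⟩ | ⟨h0, rfl⟩
    · rw [conductance_child]; gcongr; norm_num
    · rw [conductance_father h0, ← len_father_add h0, pow_succ, div_le_div_iff₀ (by positivity)
        (by positivity)]
      have : 0 < (3 * lam) ^ x.father.len := by positivity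
      nlinarith
  · rw [conductance_hor h]
    gcongr
    exact (min_le_right _ _).trans (min_le_kap x y)

/-- Functions of finite energy have geometrically decreasing increments. -/
theorem exists_increment_le (H : Admissible lam C₁ C₂) {u : Word → ℝ}
    (hu : energy lam C₁ C₂ u < ∞) :
    ∃ B ≥ 0, ∀ x, ∀ y ∈ nbr x, |u y - u x| ≤ B * √(3 * lam) ^ x.len := by
  have hl := H.pos
  obtain ⟨k, hk, hc⟩ := exists_le_conductance H
  refine ⟨√(2 * (energy lam C₁ C₂ u).toReal / k), Real.sqrt_nonneg _, fun x y hy => ?_⟩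
  refine abs_le_of_sq_le_sq ?_ (mul_nonneg (Real.sqrt_nonneg _) (pow_nonneg (Real.sqrt_nonneg _) _))
  have h1 := conductance_mul_sq_le H hu x y
  have h2 := mul_le_mul_of_nonneg_right (hc x y hy) (sq_nonneg (u x - u y))
  rw [mul_pow, Real.sq_sqrt (by positivity), ← pow_mul, mul_comm x.len, pow_mul,
    Real.sq_sqrt (by positivity)]
  have h3 := h2.trans h1
  rw [div_mul_eq_mul_div, div_le_iff₀ (by positivity)] at h3
  rw [div_mul_eq_mul_div, le_div_iff₀ hk]
  linarith [sub_sq_comm (u x) (u y)]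

theorem sqrt_lt_one (H : Admissible lam C₁ C₂) : √(3 * lam) < 1 := by
  rw [Real.sqrt_lt' one_pos]
  linarith [H.upper]

theorem sqrt_pos (H : Admissible lam C₁ C₂) : 0 < √(3 * lam) :=
  Real.sqrt_pos.mpr (by linarith [H.pos])

/-- The increments along the path of ancestors are dominated by a geometric series of ratio √(3λ) <
1. -/
theorem exists_abs_le_of_energy (H : Admissible lam C₁ C₂) {u : Word → ℝ}
    (hu : energy lam C₁ C₂ u < ∞) : ∃ M, ∀ x, |u x| ≤ M := by
  obtain ⟨B, hB, h⟩ := exists_increment_le H hu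
  have hθ := sqrt_lt_one H
  have hθ0 := sqrt_pos H
  set θ := √(3 * lam)
  have key : ∀ n, ∀ x : Word, x.len = n → |u x - u Word.root| ≤ B * ∑ i ∈ Finset.range n, θ ^ i := by
    intro n
    induction n with
    | zero => intro x hx; rw [eq_root_of_len hx]; simp
    | succ n ih =>
      intro x hx
      obtain ⟨y, i, rfl⟩ := exists_eq_child (x := x) (by omega)
      rw [len_child] at hx
      have hy : y.len = n := by omega
      have h1 := h y _ (child_mem_nbr y i)
      rw [hy] at h1
      rw [Finset.sum_range_succ, mul_add]
      calc _ ≤ |u (y.child i) - u y| + |u y - u Word.root| := abs_sub_le _ _ _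
        _ ≤ _ := by linarith [ih y hy]
  refine ⟨|u Word.root| + B * (1 - θ)⁻¹, fun x => ?_⟩
  have h1 := key _ x rfl
  have h2 : ∑ i ∈ Finset.range x.len, θ ^ i ≤ (1 - θ)⁻¹ := by
    rw [← tsum_geometric_of_lt_one hθ0.le hθ]
    exact (summable_geometric_of_lt_one hθ0.le hθ).sum_le_tsum _ fun i _ => by positivity
  have h3 := mul_le_mul_of_nonneg_left h2 hB
  have h4 := abs_sub_abs_le_abs_sub (u x) (u Word.root)
  linarith

/-! ### Interpolation by Green potentials -/

theorem gen_sum (s : Finset Word) (α : Word → ℝ) (F : Word → Word → ℝ) (y : Word) :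
    gen lam C₁ C₂ (fun z => ∑ x ∈ s, α x * F x z) y =
      ∑ x ∈ s, α x * gen lam C₁ C₂ (F x) y := by
  classical
  induction s using Finset.induction_on with
  | empty => simpa using gen_const lam C₁ C₂ 0 y
  | insert a s ha ih =>
    simp only [Finset.sum_insert ha]
    rw [gen_add, gen_const_mul, ih]

open Classical in
/-- The words of length at most `j`. -/
noncomputable def ball (j : ℕ) : Finset Word := (finite_len_le j).toFinset

theorem mem_ball {j : ℕ} {x : Word} : x ∈ ball j ↔ x.len ≤ j := by
  simp [ball]

theorem gen_potential (H : Admissible lam C₁ C₂) (j : ℕ) (α : Word → ℝ) {y : Word}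
    (hy : j < y.len) :
    gen lam C₁ C₂ (fun z => ∑ x ∈ ball j, α x * greenQuot lam C₁ C₂ x z) y = 0 := by
  rw [gen_sum]
  refine Finset.sum_eq_zero fun x hx => ?_
  rw [gen_greenQuot H (by omega) (by rintro rfl; rw [mem_ball] at hx; omega), mul_zero]

theorem exists_abs_potential_le (H : Admissible lam C₁ C₂) (j : ℕ) (α : Word → ℝ) :
    ∃ M, ∀ z, |∑ x ∈ ball j, α x * greenQuot lam C₁ C₂ x z| ≤ M := by
  choose M hM using exists_greenQuot_le H
  refine ⟨∑ x ∈ ball j, |α x| * M x, fun z => (Finset.abs_sum_le_sum_abs _ _).trans ?_⟩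
  refine Finset.sum_le_sum fun x _ => ?_
  rw [abs_mul, abs_of_nonneg (greenQuot_nonneg H x z)]
  gcongr
  exact hM x z

/-- A potential that vanishes on the ball vanishes everywhere, by uniqueness of bounded harmonic
functions below level j. Its conductance Laplacian at y, which is -α(y)π(y), then vanishes too. -/
theorem potential_injective (H : Admissible lam C₁ C₂) (j : ℕ) {α : Word → ℝ}
    (hα : ∀ y ∈ ball j, ∑ x ∈ ball j, α x * greenQuot lam C₁ C₂ x y = 0) :
    ∀ y ∈ ball j, α y = 0 := by
  classical
  obtain ⟨M, hM⟩ := exists_abs_potential_le H j α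
  have hzero : ∀ y, ∑ x ∈ ball j, α x * greenQuot lam C₁ C₂ x y = 0 := by
    intro y
    rcases le_total y.len j with h | h
    · exact hα y (mem_ball.mpr h)
    · exact eq_of_harmonic H (u := fun _ => 0)
        (v := fun z => ∑ x ∈ ball j, α x * greenQuot lam C₁ C₂ x z)
        (fun x => by simpa using hM x) (fun x _ => gen_const _ _ _ _ _)
        (fun x hx => gen_potential H j α hx) (fun x hx => hα x (mem_ball.mpr hx.le)) y h
  intro y hy
  have h1 : ∑ x ∈ ball j, α x * ∑ z ∈ nbr y, conductance lam C₁ C₂ y z *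
      (lam ^ z.len * greenQuot lam C₁ C₂ x z - lam ^ y.len * greenQuot lam C₁ C₂ x y) = 0 := by
    simp only [Finset.mul_sum]
    rw [Finset.sum_comm]
    refine Finset.sum_eq_zero fun z _ => ?_
    have : ∀ x, α x * (conductance lam C₁ C₂ y z * (lam ^ z.len * greenQuot lam C₁ C₂ x z -
        lam ^ y.len * greenQuot lam C₁ C₂ x y)) = conductance lam C₁ C₂ y z *
        (lam ^ z.len * (α x * greenQuot lam C₁ C₂ x z) -
          lam ^ y.len * (α x * greenQuot lam C₁ C₂ x y)) := fun x => by ring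
    simp only [this]
    rw [← Finset.mul_sum, Finset.sum_sub_distrib, ← Finset.mul_sum, ← Finset.mul_sum, hzero, hzero]
    simp
  simp only [sum_green H] at h1
  have h2 := totalConductance_pos H y
  simp only [mul_ite, mul_zero, Finset.sum_ite_eq, hy, if_true] at h1
  have h3 : α y * totalConductance lam C₁ C₂ y = 0 := by linarith
  exact (mul_eq_zero.mp h3).resolve_right h2.ne'

/-- Interpolation by Green potentials on a ball. -/
theorem exists_interpolation (H : Admissible lam C₁ C₂) (j : ℕ) (u : Word → ℝ) :
    ∃ α : Word → ℝ, ∀ y ∈ ball j, ∑ x ∈ ball j, α x * greenQuot lam C₁ C₂ x y = u y := by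
  classical
  let A : (ball j → ℝ) →ₗ[ℝ] (ball j → ℝ) :=
    { toFun := fun a y => ∑ x : ball j, a x * greenQuot lam C₁ C₂ x y
      map_add' := fun a b => by
        funext y; simp [add_mul, Finset.sum_add_distrib]
      map_smul' := fun r a => by
        funext y; simp [mul_assoc, Finset.mul_sum] }
  have hA : ∀ (a : ball j → ℝ) (y : ball j), A a y =
      ∑ x ∈ ball j, (if h : x ∈ ball j then a ⟨x, h⟩ else 0) * greenQuot lam C₁ C₂ x y := by
    intro a y
    rw [← Finset.sum_coe_sort (ball j)]
    exact Finset.sum_congr rfl fun x _ => by simp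
  have hinj : Function.Injective A := by
    refine (injective_iff_map_eq_zero A).mpr fun a ha => ?_
    have h := potential_injective H j (α := fun x => if h : x ∈ ball j then a ⟨x, h⟩ else 0)
      fun y hy => by rw [← hA a ⟨y, hy⟩, ha]; rfl
    funext y
    simpa using h y y.2
  obtain ⟨a, ha⟩ := LinearMap.injective_iff_surjective.mp hinj fun y => u y
  exact ⟨_, fun y hy => (hA a ⟨y, hy⟩).symm.trans (congrFun ha ⟨y, hy⟩)⟩

/-- Functions of finite energy are uniform limits of Green potentials divided by `λ^|x|`. -/
theorem exists_potential_near (H : Admissible lam C₁ C₂) {u : Word → ℝ}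
    (hu : energy lam C₁ C₂ u < ∞) {ε : ℝ} (hε : 0 < ε) :
    ∃ (j : ℕ) (α : Word → ℝ), ∀ y,
      |∑ x ∈ ball j, α x * greenQuot lam C₁ C₂ x y - u y| ≤ ε := by
  obtain ⟨B, hB, h⟩ := exists_increment_le H hu
  obtain ⟨Mu, hMu⟩ := exists_abs_le_of_energy H hu
  have hθ := sqrt_lt_one H
  have hθ0 := sqrt_pos H
  set θ := √(3 * lam)
  have h1 := H.pos₁
  have h2 := H.pos₂
  set B' := (6 + 4 * (C₁ + C₂)) * B
  -- The left side is the barrier bound for the distance of u to the harmonic function with the same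
  -- values on level j; `B'` comes from `abs_gen_le` applied to the increments of u.
  obtain ⟨j, hj⟩ : ∃ j, B' / (3 * (1 - θ) * (1 - lam)) * θ ^ j ≤ ε := by
    have := (tendsto_pow_atTop_nhds_zero_of_lt_one hθ0.le hθ).const_mul
      (B' / (3 * (1 - θ) * (1 - lam)))
    rw [mul_zero] at this
    exact ((this.eventually (ge_mem_nhds hε))).exists
  obtain ⟨α, hα⟩ := exists_interpolation H j u
  obtain ⟨M, hM⟩ := exists_abs_potential_le H j α
  refine ⟨j, α, fun y => ?_⟩
  rcases le_total y.len j with hy | hy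
  · rw [hα y (mem_ball.mpr hy), sub_self, abs_zero]
    exact hε.le
  · refine le_trans ?_ hj
    refine abs_sub_le_barrier H hθ0 hθ (M := M + Mu)
      (v := fun z => ∑ x ∈ ball j, α x * greenQuot lam C₁ C₂ x z)
      (fun x => (abs_sub _ _).trans (add_le_add (hM x) (hMu x))) (by positivity) (fun x hx => ?_)
      (fun x hx => gen_potential H j α hx) (fun x hx => hα x (mem_ball.mpr hx.le)) y hy
    refine (abs_gen_le H (by omega) (h x)).trans (le_of_eq ?_)
    ring

/-! ### Uniform limits and extension to the compactification -/

variable (lam C₁ C₂) in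
/-- Restriction of continuous functions on the Martin compactification to the nodes. -/
noncomputable def restrictNodes (f : C(MartinCompactification lam C₁ C₂, ℝ)) :
    BoundedContinuousFunction Word ℝ :=
  (BoundedContinuousFunction.mkOfCompact f).compContinuous
    ⟨incl lam C₁ C₂, continuous_of_discreteTopology⟩

theorem dist_le_of_nodes {f g : C(MartinCompactification lam C₁ C₂, ℝ)} {r : ℝ}
    (h : ∀ x, |f (incl lam C₁ C₂ x) - g (incl lam C₁ C₂ x)| ≤ r)
    (p : MartinCompactification lam C₁ C₂) : |f p - g p| ≤ r :=
  (denseRange_incl lam C₁ C₂).induction_on (p := fun p => |f p - g p| ≤ r) p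
    (isClosed_le (by fun_prop) continuous_const) h

/-- The nodes are dense, so restriction to them is isometric, and C(X̄) is complete. -/
theorem isClosed_range_restrictNodes : IsClosed (Set.range (restrictNodes lam C₁ C₂)) := by
  have hiso : Isometry (restrictNodes lam C₁ C₂) := by
    refine Isometry.of_dist_eq fun f g => le_antisymm ?_ ?_
    · refine (BoundedContinuousFunction.dist_le dist_nonneg).mpr fun x => ?_
      exact ContinuousMap.dist_apply_le_dist (f := f) (g := g) (incl lam C₁ C₂ x)
    · refine (ContinuousMap.dist_le dist_nonneg).mpr fun p => ?_
      refine dist_le_of_nodes (fun x => ?_) p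
      exact BoundedContinuousFunction.dist_coe_le_dist
        (f := restrictNodes lam C₁ C₂ f) (g := restrictNodes lam C₁ C₂ g) x
  exact hiso.isClosedEmbedding.isClosed_range

/-- A uniform limit of functions that extend continuously extends continuously. -/
theorem exists_extension_of_approx {u : Word → ℝ}
    (h : ∀ ε > 0, ∃ f : C(MartinCompactification lam C₁ C₂, ℝ),
      ∀ x, |f (incl lam C₁ C₂ x) - u x| ≤ ε) :
    ∃ f : C(MartinCompactification lam C₁ C₂, ℝ), ∀ x, f (incl lam C₁ C₂ x) = u x := by
  obtain ⟨f₁, hf₁⟩ := h 1 one_pos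
  let U : BoundedContinuousFunction Word ℝ :=
    BoundedContinuousFunction.ofNormedAddCommGroup u continuous_of_discreteTopology
      (‖restrictNodes lam C₁ C₂ f₁‖ + 1) fun x => by
        have h1 := hf₁ x
        have h2 := (restrictNodes lam C₁ C₂ f₁).norm_coe_le_norm x
        have h3 : restrictNodes lam C₁ C₂ f₁ x = f₁ (incl lam C₁ C₂ x) := rfl
        rw [h3, Real.norm_eq_abs] at h2
        rw [Real.norm_eq_abs]
        have := abs_sub_abs_le_abs_sub (u x) (f₁ (incl lam C₁ C₂ x))
        rw [abs_sub_comm] at this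
        linarith
  have hU : U ∈ closure (Set.range (restrictNodes lam C₁ C₂)) := by
    refine Metric.mem_closure_iff.mpr fun ε hε => ?_
    obtain ⟨f, hf⟩ := h (ε / 2) (half_pos hε)
    refine ⟨_, ⟨f, rfl⟩, ?_⟩
    refine ((BoundedContinuousFunction.dist_le (half_pos hε).le).mpr fun x => ?_).trans_lt
      (half_lt_self hε)
    rw [dist_comm]
    exact hf x
  rw [isClosed_range_restrictNodes.closure_eq] at hU
  obtain ⟨f, hf⟩ := hU
  exact ⟨f, fun x => DFunLike.congr_fun hf x⟩

/-- The bound on the nodes passes to the closure. Coordinates then avoid ∞, where `ENNReal.toReal`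
is discontinuous. -/
theorem exists_coord_le (H : Admissible lam C₁ C₂) (x : Word) :
    ∃ M : ℝ, ∀ p : MartinCompactification lam C₁ C₂, p.1.2 x ≤ ENNReal.ofReal M := by
  obtain ⟨κ, hκ, h⟩ := martinKernel_eq H x
  obtain ⟨M, hM⟩ := exists_greenQuot_le H x
  refine ⟨κ * M, fun p => ?_⟩
  refine (denseRange_incl lam C₁ C₂).induction_on (p := fun p => p.1.2 x ≤ ENNReal.ofReal (κ * M))
    p (isClosed_le ?_ continuous_const) fun y => ?_
  · exact (continuous_apply x).comp (continuous_snd.comp continuous_subtype_val)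
  · change martinKernel lam C₁ C₂ x y ≤ _
    rw [h y]
    exact ENNReal.ofReal_le_ofReal (by gcongr; exact hM y)

/-- The extension of a Martin kernel as a real continuous function. -/
noncomputable def martinCoord (H : Admissible lam C₁ C₂) (x : Word) :
    C(MartinCompactification lam C₁ C₂, ℝ) where
  toFun p := (p.1.2 x).toReal
  continuous_toFun := by
    obtain ⟨M, hM⟩ := exists_coord_le H x
    refine ENNReal.continuousOn_toReal.comp_continuous
      ((continuous_apply x).comp (continuous_snd.comp continuous_subtype_val)) fun p => ?_
    exact ne_top_of_le_ne_top ENNReal.ofReal_ne_top (hM p)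

theorem martinCoord_incl (H : Admissible lam C₁ C₂) (x : Word) :
    ∃ κ : ℝ, 0 < κ ∧ ∀ y, martinCoord H x (incl lam C₁ C₂ y) = κ * greenQuot lam C₁ C₂ x y := by
  obtain ⟨κ, hκ, h⟩ := martinKernel_eq H x
  refine ⟨κ, hκ, fun y => ?_⟩
  change (martinKernel lam C₁ C₂ x y).toReal = _
  rw [h y, ENNReal.toReal_ofReal (mul_nonneg hκ.le (greenQuot_nonneg H x y))]

/-- Functions of finite energy extend continuously to the Martin compactification. -/
theorem exists_extension_of_energy (H : Admissible lam C₁ C₂) {u : Word → ℝ}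
    (hu : energy lam C₁ C₂ u < ∞) :
    ∃ f : C(MartinCompactification lam C₁ C₂, ℝ), ∀ x, f (incl lam C₁ C₂ x) = u x := by
  choose κ hκ hk using martinCoord_incl H
  refine exists_extension_of_approx fun ε hε => ?_
  obtain ⟨j, α, h⟩ := exists_potential_near H hu hε
  refine ⟨∑ x ∈ ball j, (α x / κ x) • martinCoord H x, fun y => ?_⟩
  convert h y using 3
  rw [ContinuousMap.sum_apply]
  refine Finset.sum_congr rfl fun x _ => ?_
  rw [ContinuousMap.smul_apply, hk, smul_eq_mul]
  have := (hκ x).ne'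
  field_simp

end

/-! ### Harmonic splines on the gasket -/

/-- The values at the corners of the `i`-th subtriangle of the harmonic function on the gasket with
boundary values `a` (the `2/5`-`2/5`-`1/5` rule). -/
noncomputable def harmStep (i : Fin 3) (a : Fin 3 → ℝ) (j : Fin 3) : ℝ :=
  if j = i then a i else (a i + a j + ∑ k, a k) / 5

/-- `∑_{i<j} (a_i - a_j)²`. -/
def triEnergy (a : Fin 3 → ℝ) : ℝ := (a 0 - a 1) ^ 2 + (a 1 - a 2) ^ 2 + (a 0 - a 2) ^ 2

theorem triEnergy_nonneg (a : Fin 3 → ℝ) : 0 ≤ triEnergy a := by unfold triEnergy; positivity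

/-- 3/5 is the energy renormalization factor of the gasket; compared with the growth 1/(3λ) of the
conductances, it is what makes λ = 1/5 the threshold. -/
theorem sum_triEnergy_harmStep (a : Fin 3 → ℝ) :
    ∑ i, triEnergy (harmStep i a) = 3 / 5 * triEnergy a := by
  simp [Fin.sum_univ_three, triEnergy, harmStep]
  ring

theorem harmStep_self (i : Fin 3) (a : Fin 3 → ℝ) : harmStep i a i = a i := if_pos rfl

/-- The midpoint of the corners i and j lies in two subtriangles, which must assign it the same
value. -/
theorem harmStep_comm {i j : Fin 3} (h : i ≠ j) (a : Fin 3 → ℝ) :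
    harmStep i a j = harmStep j a i := by
  rw [harmStep, harmStep, if_neg h.symm, if_neg h]
  ring

/-- The new values are averages with weights 2/5, 2/5 and 1/5. -/
theorem harmStep_mem {s t : ℝ} {a : Fin 3 → ℝ} (h : ∀ j, a j ∈ Set.Icc s t) (i j : Fin 3) :
    harmStep i a j ∈ Set.Icc s t := by
  have h1 := h i
  have h2 := h j
  have h3 := h 0
  have h4 := h 1
  have h5 := h 2
  simp only [Set.mem_Icc] at *
  rw [harmStep]
  split_ifs
  · exact h1
  · rw [Fin.sum_univ_three]
    constructor <;> linarith [h1.1, h1.2, h2.1, h2.2, h3.1, h3.2, h4.1, h4.2, h5.1, h5.2]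

theorem abs_harmStep_sub_le {δ : ℝ} {a : Fin 3 → ℝ} (h : ∀ i j, |a i - a j| ≤ δ) (i j k : Fin 3) :
    |harmStep i a j - a k| ≤ δ := by
  have := harmStep_mem (s := a k - δ) (t := a k + δ) (a := a)
    (fun j => ⟨by linarith [(abs_le.mp (h j k)).1], by linarith [(abs_le.mp (h j k)).2]⟩) i j
  exact abs_le.mpr ⟨by linarith [this.1], by linarith [this.2]⟩

/-- Inside the i-th subtriangle the differences are (2(a i - a j) + (a i - a k)) / 5 or (a j - a k)
/ 5, up to sign. -/
theorem osc_harmStep {δ : ℝ} {a : Fin 3 → ℝ} (h : ∀ i j, |a i - a j| ≤ δ) (i j k : Fin 3) :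
    |harmStep i a j - harmStep i a k| ≤ 3 / 5 * δ := by
  have h0 := fun i j => (abs_le.mp (h i j)).2
  have h1 := h0 0 1
  have h2 := h0 1 0
  have h3 := h0 0 2
  have h4 := h0 2 0
  have h5 := h0 1 2
  have h6 := h0 2 1
  rw [abs_le]
  fin_cases i <;> fin_cases j <;> fin_cases k <;> simp [harmStep, Fin.sum_univ_three] <;>
    (try constructor) <;> linarith

theorem abs_sub_le_sqrt_triEnergy (a : Fin 3 → ℝ) (i j : Fin 3) :
    |a i - a j| ≤ √(triEnergy a) := by
  refine Real.abs_le_sqrt ?_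
  unfold triEnergy
  fin_cases i <;> fin_cases j <;> simp <;>
    nlinarith [sq_nonneg (a 0 - a 1), sq_nonneg (a 1 - a 2), sq_nonneg (a 0 - a 2)]

theorem sq_sub_le_triEnergy (a : Fin 3 → ℝ) (i j : Fin 3) : (a i - a j) ^ 2 ≤ triEnergy a := by
  have := pow_le_pow_left₀ (abs_nonneg _) (abs_sub_le_sqrt_triEnergy a i j) 2
  rwa [sq_abs, Real.sq_sqrt (triEnergy_nonneg a)] at this

theorem sq_harmStep_sub_le (a : Fin 3 → ℝ) (i j k : Fin 3) :
    (harmStep i a j - a k) ^ 2 ≤ triEnergy a := by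
  have := pow_le_pow_left₀ (abs_nonneg _)
    (abs_harmStep_sub_le (abs_sub_le_sqrt_triEnergy a) i j k) 2
  rwa [sq_abs, Real.sq_sqrt (triEnergy_nonneg a)] at this

/-- The values at the three vertices of the cell of `x` of the harmonic spline with values `φ` at
the vertices of level `m`. -/
noncomputable def spline (m : ℕ) (φ : EuclideanSpace ℝ (Fin 2) → ℝ) (x : Word) : Fin 3 → ℝ :=
  List.foldl (fun a i => harmStep i a) (fun i => φ ((x.anc m).map (corner i))) (List.drop m x)

section

variable {m : ℕ} {φ : EuclideanSpace ℝ (Fin 2) → ℝ}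

theorem spline_of_len {x : Word} (h : x.len ≤ m) : spline m φ x = fun i => φ (x.map (corner i)) := by
  have h1 : List.drop m x = [] := List.drop_of_length_le h
  rw [spline, h1, anc_self h]
  rfl

theorem spline_child {x : Word} (h : m ≤ x.len) (i : Fin 3) :
    spline m φ (x.child i) = harmStep i (spline m φ x) := by
  have h1 : List.drop m (x.child i) = List.drop m x ++ [i] :=
    List.drop_append_of_le_length h
  rw [spline, h1, anc_child h, List.foldl_append]
  rfl

/-- Induction along the descendants of level `m`. -/
theorem word_induction {p : Word → Prop} (h0 : ∀ x : Word, x.len = m → p x)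
    (hs : ∀ x : Word, m ≤ x.len → p x → ∀ i, p (x.child i)) (x : Word) (hx : m ≤ x.len) : p x := by
  induction hn : x.len generalizing x with
  | zero => exact h0 x (by omega)
  | succ n ih =>
    rcases hx.eq_or_lt with h | h
    · exact h0 x h.symm
    · obtain ⟨y, i, rfl⟩ := exists_eq_child (x := x) (by omega)
      rw [len_child] at hn h
      exact hs y (by omega) (ih y (by omega) (by omega)) i

/-- The spline is single-valued at the vertex shared by two adjacent cells. If that vertex is
already present at level m, both values are φ there. Otherwise it arises as a midpoint in the cell
of u, where `harmStep_comm` applies, and later steps keep the value at the corner they contract to.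
-/
theorem spline_flip {u : List (Fin 3)} {i j : Fin 3} (hij : i ≠ j) (k : ℕ) {x y : Word}
    (hx : x = (u ++ i :: List.replicate k j : List (Fin 3)))
    (hy : y = (u ++ j :: List.replicate k i : List (Fin 3))) (hm : m ≤ x.len) :
    spline m φ x j = spline m φ y i := by
  have hl : ∀ (a b : Fin 3) (k : ℕ), Word.len (u ++ a :: List.replicate k b : List (Fin 3)) =
      List.length u + 1 + k := fun a b k => by simp [Word.len]; omega
  have hxl : x.len = List.length u + 1 + k := by rw [hx]; exact hl i j k
  have hyl : y.len = List.length u + 1 + k := by rw [hy]; exact hl j i k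
  rcases hm.eq_or_lt with h | h
  · rw [spline_of_len h.ge, spline_of_len (by omega)]
    subst hx hy
    exact congrArg φ IsFlip.map_eq
  · induction k generalizing x y with
    | zero =>
      have h1 := spline_child (φ := φ) (x := u) (m := m) (by simp only [Word.len]; omega) i
      have h2 := spline_child (φ := φ) (x := u) (m := m) (by simp only [Word.len]; omega) j
      subst hx hy
      exact (congrFun h1 j).trans ((harmStep_comm hij _).trans (congrFun h2 i).symm)
    | succ k ih =>
      have e : ∀ a b : Fin 3, (u ++ a :: List.replicate (k + 1) b : List (Fin 3)) =
          Word.child (u ++ a :: List.replicate k b : List (Fin 3)) b := fun a b => by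
        change _ = (u ++ a :: List.replicate k b) ++ [b]
        rw [List.replicate_succ']; simp
      obtain ⟨x', hx'⟩ : ∃ x' : Word, x' = (u ++ i :: List.replicate k j : List (Fin 3)) := ⟨_, rfl⟩
      obtain ⟨y', hy'⟩ : ∃ y' : Word, y' = (u ++ j :: List.replicate k i : List (Fin 3)) := ⟨_, rfl⟩
      have hxl' : x'.len = List.length u + 1 + k := by rw [hx']; exact hl i j k
      have hyl' : y'.len = List.length u + 1 + k := by rw [hy']; exact hl j i k
      rw [e, ← hx'] at hx
      rw [e, ← hy'] at hy
      rw [hx, hy, spline_child (by omega), spline_child (by omega), harmStep_self, harmStep_self]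
      rcases (show m ≤ x'.len by omega).eq_or_lt with h' | h'
      · rw [spline_of_len h'.ge, spline_of_len (by omega)]
        subst hx' hy'
        exact congrArg φ IsFlip.map_eq
      · exact ih hx' hy' h'.le hxl' hyl' h'

theorem exists_spline_eq {x y : Word} (h : HorAdj x y) (hm : m ≤ x.len) :
    ∃ a b, spline m φ x a = spline m φ y b := by
  obtain ⟨u, i, j, k, hij, hx, hy⟩ := horAdj_iff.mp h
  refine ⟨j, i, ?_⟩
  exact spline_flip hij k hx hy hm

theorem spline_mem {s t : ℝ} {x : Word} (hx : m ≤ x.len)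
    (h : ∀ i, φ ((x.anc m).map (corner i)) ∈ Set.Icc s t) (i : Fin 3) :
    spline m φ x i ∈ Set.Icc s t := by
  refine word_induction (m := m) (p := fun x => (∀ i, φ ((x.anc m).map (corner i)) ∈ Set.Icc s t) →
    ∀ i, spline m φ x i ∈ Set.Icc s t) ?_ ?_ x hx h i
  · intro x hx h
    rw [anc_self hx.le] at h
    rw [spline_of_len hx.le]
    exact h
  · intro x hx ih i h
    rw [anc_child hx] at h
    rw [spline_child hx]
    exact harmStep_mem (ih h) i

theorem spline_osc {δ : ℝ} (h : ∀ p q, |φ p - φ q| ≤ δ) {x : Word} (hx : m ≤ x.len) (i j : Fin 3) :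
    |spline m φ x i - spline m φ x j| ≤ (3 / 5) ^ (x.len - m) * δ := by
  refine word_induction (m := m) (p := fun x => ∀ i j,
    |spline m φ x i - spline m φ x j| ≤ (3 / 5) ^ (x.len - m) * δ) ?_ ?_ x hx i j
  · intro x hx i j
    rw [spline_of_len hx.le, hx]
    simpa using h _ _
  · intro x hx ih k i j
    rw [spline_child hx, len_child, Nat.succ_sub hx, pow_succ, mul_comm (_ ^ _), mul_assoc]
    exact osc_harmStep ih k i j

theorem sum_triEnergy_spline (k : ℕ) :
    ∑ x ∈ level (m + k), triEnergy (spline m φ x) =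
      (3 / 5) ^ k * ∑ x ∈ level m, triEnergy (spline m φ x) := by
  induction k with
  | zero => simp
  | succ k ih =>
    rw [← add_assoc, sum_level_succ, pow_succ, mul_comm (_ ^ _), mul_assoc, ← ih, Finset.mul_sum]
    refine Finset.sum_congr rfl fun x hx => ?_
    rw [← sum_triEnergy_harmStep]
    refine Finset.sum_congr rfl fun i _ => ?_
    rw [spline_child (by rw [mem_level.mp hx]; omega)]

/-- A horizontal edge is crossed through the vertex common to both cells; along a vertical edge the
values of the child are averages of those of the father. -/
theorem sq_spline_sub_le {x y : Word} (hxy : y ∈ nbr x) (hx : m ≤ x.len) (hy : m ≤ y.len) :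
    (spline m φ x 0 - spline m φ y 0) ^ 2 ≤
      2 * triEnergy (spline m φ x) + 2 * triEnergy (spline m φ y) := by
  have h1 := triEnergy_nonneg (spline m φ x)
  have h2 := triEnergy_nonneg (spline m φ y)
  rcases mem_nbr.mp hxy with (⟨i, rfl⟩ | ⟨i, rfl⟩) | h
  · have := sq_harmStep_sub_le (spline m φ x) i 0 0
    rw [← spline_child hx, sub_sq_comm] at this
    linarith
  · have := sq_harmStep_sub_le (spline m φ y) i 0 0
    rw [← spline_child hy] at this
    linarith
  · obtain ⟨a, b, hab⟩ := exists_spline_eq (φ := φ) h hx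
    have h3 := sq_sub_le_triEnergy (spline m φ x) 0 a
    have h4 := sq_sub_le_triEnergy (spline m φ y) b 0
    rw [hab] at h3
    nlinarith [sq_nonneg ((spline m φ x 0 - spline m φ y b) - (spline m φ y b - spline m φ y 0))]

/-- The factor 2 covers the two cells of a horizontal edge, and also the 5/3 lost when y is the
father and its cell is one level coarser. -/
theorem abs_spline_sub_le {δ : ℝ} (h : ∀ p q, |φ p - φ q| ≤ δ) {x y : Word} (hxy : y ∈ nbr x)
    (hx : m < x.len) : |spline m φ y 0 - spline m φ x 0| ≤ 2 * δ * (3 / 5) ^ (x.len - m) := by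
  have hδ : 0 ≤ δ := (abs_nonneg _).trans (h 0 0)
  have hp : 0 ≤ (3 / 5 : ℝ) ^ (x.len - m) * δ := by positivity
  rcases mem_nbr.mp hxy with (⟨i, rfl⟩ | ⟨i, rfl⟩) | hh
  · have := abs_harmStep_sub_le (spline_osc h hx.le) i 0 0
    rw [← spline_child hx.le] at this
    linarith
  · rw [len_child] at hx
    have := abs_harmStep_sub_le (spline_osc h (show m ≤ y.len by omega)) i 0 0
    rw [← spline_child (by omega), abs_sub_comm] at this
    have hp : 0 ≤ (3 / 5 : ℝ) ^ (y.len - m) * δ := by positivity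
    rw [len_child, Nat.succ_sub (by omega), pow_succ]
    linarith
  · obtain ⟨a, b, hab⟩ := exists_spline_eq (φ := φ) hh hx.le
    have h3 := spline_osc h hx.le a 0
    have h4 := spline_osc h (hh.2.1 ▸ hx.le : m ≤ y.len) 0 b
    rw [← hh.2.1, ← hab] at h4
    have := abs_sub_le (spline m φ y 0) (spline m φ x a) (spline m φ x 0)
    linarith

end

/-! ### Sums over words and finiteness of the energy -/

theorem tsum_word (F : Word → ℝ≥0∞) : ∑' x, F x = ∑' n, ∑ x ∈ level n, F x := by
  rw [← (Equiv.sigmaFiberEquiv Word.len).tsum_eq, ENNReal.tsum_sigma']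
  refine tsum_congr fun n => ?_
  have h : ∑' x : {x : Word // x.len = n}, F x = ∑' x, Set.indicator {x | x.len = n} F x :=
    tsum_subtype {x : Word | x.len = n} F
  refine h.trans ?_
  rw [tsum_eq_sum (s := level n)]
  · exact Finset.sum_congr rfl fun x hx => Set.indicator_of_mem
      (show x ∈ {x : Word | x.len = n} from mem_level.mp hx) F
  · intro x hx
    exact Set.indicator_of_notMem
      (show x ∉ {x : Word | x.len = n} from fun h => hx (mem_level.mpr h)) F

theorem tsum_word_lt_top {F : Word → ℝ} (h0 : ∀ x, 0 ≤ F x)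
    (h : Summable fun n => ∑ x ∈ level n, F x) : ∑' x, ENNReal.ofReal (F x) < ∞ := by
  rw [tsum_word]
  simp only [← ENNReal.ofReal_sum_of_nonneg fun x _ => h0 x]
  exact h.tsum_ofReal_lt_top

section

variable {lam C₁ C₂ : ℝ}

theorem tsum_ofReal_conductance (H : Admissible lam C₁ C₂) (x : Word) :
    ∑' y, ENNReal.ofReal (conductance lam C₁ C₂ x y) =
      ENNReal.ofReal (totalConductance lam C₁ C₂ x) := by
  rw [totalConductance_eq, ENNReal.ofReal_sum_of_nonneg fun y _ => conductance_nonneg H x y]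
  exact tsum_eq_sum fun y hy => by rw [conductance_eq_zero hy, ENNReal.ofReal_zero]

/-- By symmetry of the conductances, the terms in e(x) and in e(y) both sum to the total of e
weighted by π. -/
theorem energy_lt_top_of_le (H : Admissible lam C₁ C₂) {u e : Word → ℝ} (he : ∀ x, 0 ≤ e x)
    (h : ∀ x, ∀ y ∈ nbr x, (u x - u y) ^ 2 ≤ 2 * e x + 2 * e y)
    (hs : ∑' x, ENNReal.ofReal (e x * totalConductance lam C₁ C₂ x) < ∞) :
    energy lam C₁ C₂ u < ∞ := by
  have h1 : ∀ x y, ENNReal.ofReal (conductance lam C₁ C₂ x y * (u x - u y) ^ 2) ≤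
      2 * (ENNReal.ofReal (e x) * ENNReal.ofReal (conductance lam C₁ C₂ x y)) +
      2 * (ENNReal.ofReal (e y) * ENNReal.ofReal (conductance lam C₁ C₂ y x)) := by
    intro x y
    have hc := conductance_nonneg H x y
    have h2 : ∀ z, 2 * (ENNReal.ofReal (e z) * ENNReal.ofReal (conductance lam C₁ C₂ x y)) =
        ENNReal.ofReal (2 * (e z * conductance lam C₁ C₂ x y)) := fun z => by
      rw [ENNReal.ofReal_mul (by norm_num), ENNReal.ofReal_mul (he z), ENNReal.ofReal_ofNat]
    rw [conductance_comm y x, h2, h2, ← ENNReal.ofReal_add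
      (mul_nonneg zero_le_two (mul_nonneg (he x) hc))
      (mul_nonneg zero_le_two (mul_nonneg (he y) hc))]
    refine ENNReal.ofReal_le_ofReal ?_
    by_cases hy : y ∈ nbr x
    · nlinarith [h x y hy]
    · rw [conductance_eq_zero hy]; simp
  have h2 : ∑' x, ∑' y, ENNReal.ofReal (e x) * ENNReal.ofReal (conductance lam C₁ C₂ x y) < ∞ := by
    refine lt_of_eq_of_lt (tsum_congr fun x => ?_) hs
    rw [ENNReal.tsum_mul_left, tsum_ofReal_conductance H, ENNReal.ofReal_mul (he x)]
  have h3 : ∑' x, ∑' y, ENNReal.ofReal (e y) * ENNReal.ofReal (conductance lam C₁ C₂ y x) < ∞ := by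
    rw [ENNReal.tsum_comm]; exact h2
  refine ENNReal.mul_lt_top (by norm_num) ?_
  refine (ENNReal.tsum_le_tsum fun x => ENNReal.tsum_le_tsum fun y => h1 x y).trans_lt ?_
  simp only [ENNReal.tsum_add, ENNReal.tsum_mul_left]
  simp only [ENNReal.tsum_mul_left] at h2 h3
  exact ENNReal.add_lt_top.mpr
    ⟨ENNReal.mul_lt_top (by norm_num) h2, ENNReal.mul_lt_top (by norm_num) h3⟩

/-- Splines have finite energy, whatever the values on the first levels. -/
theorem energy_spline_lt_top (H : Admissible lam C₁ C₂) (m : ℕ)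
    (φ : EuclideanSpace ℝ (Fin 2) → ℝ) (v : Word → ℝ) :
    energy lam C₁ C₂ (fun x => if x.len < m then v x else spline m φ x 0) < ∞ := by
  set f : Word → ℝ := fun x => if x.len < m then v x else spline m φ x 0 with hf
  have hl := H.pos
  refine energy_lt_top_of_le H
    -- The extra term pays for the edges that touch the first levels, where the values are
    -- arbitrary; level m is included because of the edges from level m - 1 to m.
    (e := fun x => triEnergy (spline m φ x) + if x.len ≤ m then f x ^ 2 else 0) (fun x => ?_)
    (fun x y hxy => ?_) (tsum_word_lt_top (fun x => ?_) ?_)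
  · have := triEnergy_nonneg (spline m φ x)
    split_ifs <;> positivity
  · have h1 := triEnergy_nonneg (spline m φ x)
    have h2 := triEnergy_nonneg (spline m φ y)
    by_cases hm : m ≤ x.len ∧ m ≤ y.len
    · have h3 := sq_spline_sub_le (φ := φ) hxy hm.1 hm.2
      have h4 : f x = spline m φ x 0 := if_neg (by omega)
      have h5 : f y = spline m φ y 0 := if_neg (by omega)
      have h6 : 0 ≤ if x.len ≤ m then f x ^ 2 else 0 := by split_ifs <;> positivity
      have h7 : 0 ≤ if y.len ≤ m then f y ^ 2 else 0 := by split_ifs <;> positivity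
      rw [← h4, ← h5] at h3
      linarith
    · have h3 : x.len ≤ m ∧ y.len ≤ m := by
        rcases mem_nbr.mp hxy with (⟨i, rfl⟩ | ⟨i, rfl⟩) | h
        · rw [len_child] at *; omega
        · rw [len_child] at *; omega
        · have := h.2.1; omega
      simp only [h3.1, h3.2, if_true]
      nlinarith [sq_nonneg (f x + f y)]
  · have := triEnergy_nonneg (spline m φ x)
    have := totalConductance_pos H x
    split_ifs <;> positivity
  · rw [← summable_nat_add_iff (m + 1)]
    set Em := ∑ x ∈ level m, triEnergy (spline m φ x)
    set Q := 4 + 4 * (C₁ + C₂)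
    have hE : 0 ≤ Em := Finset.sum_nonneg fun x _ => triEnergy_nonneg _
    have hl' := H.lower
    -- The ratio is (3/5) / (3λ) = 1 / (5λ), which is less than 1 because λ > 1/5. Only the levels
    -- beyond m are summed, so the extra term is absent.
    refine Summable.of_nonneg_of_le (f := fun n => Q / (3 * lam) ^ (m + 1) * (3 / 5) * Em *
      (1 / (5 * lam)) ^ n) (fun n => ?_) (fun n => ?_) ((summable_geometric_of_lt_one
        (by positivity) ((div_lt_one (by positivity)).mpr (by linarith))).mul_left _)
    · refine Finset.sum_nonneg fun x _ => mul_nonneg ?_ (totalConductance_pos H x).le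
      have := triEnergy_nonneg (spline m φ x)
      split_ifs <;> positivity
    · calc _ ≤ ∑ x ∈ level (m + (n + 1)), triEnergy (spline m φ x) *
            (Q / (3 * lam) ^ (m + (n + 1))) := by
            rw [show n + (m + 1) = m + (n + 1) by ring]
            refine Finset.sum_le_sum fun x hx => ?_
            have hx' := mem_level.mp hx
            rw [if_neg (by omega), add_zero, ← hx']
            exact mul_le_mul_of_nonneg_left (totalConductance_le H x) (triEnergy_nonneg _)
        _ = _ := by
            rw [← Finset.sum_mul, sum_triEnergy_spline]
            simp only [pow_add, mul_pow, div_pow, one_pow, pow_one]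
            field_simp
            exact mul_comm _ _

end

/-! ### Decay of oscillation of harmonic functions -/

/-- The descendants of the words equal or adjacent to `w`. -/
def star1 (w : Word) : Set Word := {y | w.len ≤ y.len ∧ Near w (y.anc w.len)}

/-- The descendants of the words at horizontal distance at most two from `w`. -/
def star2 (w : Word) : Set Word := {y | w.len ≤ y.len ∧ ∃ z, Near w z ∧ Near z (y.anc w.len)}

theorem star1_subset_star2 (w : Word) : star1 w ⊆ star2 w :=
  fun _ hy => ⟨hy.1, w, Or.inl rfl, hy.2⟩

/-- Positivity on the larger star is thus available at all neighbours of the smaller one, as the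
Harnack inequality requires. -/
theorem nbr_mem_star2 {w y z : Word} (hy : y ∈ star1 w) (hl : w.len < y.len) (hz : z ∈ nbr y) :
    z ∈ star2 w := by
  rcases mem_nbr.mp hz with (⟨i, rfl⟩ | ⟨i, rfl⟩) | h
  · refine star1_subset_star2 w ⟨by rw [len_child]; omega, ?_⟩
    rw [anc_child hl.le]
    exact hy.2
  · rw [len_child] at hl
    refine star1_subset_star2 w ⟨by omega, ?_⟩
    have := hy.2
    rwa [anc_child (by omega)] at this
  · exact ⟨h.2.1 ▸ hl.le, _, hy.2, Near.anc (Or.inr h) hl.le⟩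

theorem star2_anc {w : Word} {m : ℕ} (hm : m ≤ w.len) : star2 w ⊆ star2 (w.anc m) := by
  rintro y ⟨h1, z, h2, h3⟩
  rw [star2, Set.mem_ofPred_eq, len_anc hm]
  refine ⟨by omega, z.anc m, h2.anc hm, ?_⟩
  have := h3.anc (m := m) (by rw [← h2.len_eq]; exact hm)
  rwa [anc_anc hm] at this

theorem child_mem_star2 (w : Word) (i : Fin 3) : w.child i ∈ star2 w := by
  refine star1_subset_star2 w ⟨by rw [len_child]; omega, ?_⟩
  rw [anc_child le_rfl, anc_self le_rfl]
  exact Or.inl rfl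

section

variable {lam C₁ C₂ : ℝ}

/-- The Harnack inequality for neighbours. -/
theorem exists_harnack (H : Admissible lam C₁ C₂) :
    ∃ p > 0, p ≤ 1 ∧ ∀ (v : Word → ℝ) (y : Word), 0 < y.len → gen lam C₁ C₂ v y = 0 → 0 ≤ v y →
      (∀ z ∈ nbr y, 0 ≤ v z) → ∀ z ∈ nbr y, p * v z ≤ v y := by
  have hl := H.pos
  have hl' := H.upper
  have h1 := H.pos₁
  have h2 := H.pos₂
  set Q := 6 + 4 * (C₁ + C₂)
  have hQ : 0 < Q := by positivity
  set q := min lam (min C₁ C₂)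
  have hq : 0 < q := lt_min hl (lt_min h1 h2)
  have hq1 : q ≤ lam := min_le_left _ _
  -- Q bounds the total weight of `gen` at a node, and q is at most the weight of any single
  -- neighbour.
  refine ⟨q / Q, by positivity, ?_, fun v y hy hv h0 hn z hz => ?_⟩
  · rw [div_le_one hQ]
    have : 6 ≤ Q := by simp only [Q]; linarith
    linarith
  have hκ : ∑ x ∈ hor y, kap C₁ C₂ y x ≤ 4 * (C₁ + C₂) := by
    refine (Finset.sum_le_card_nsmul _ _ _ fun x _ => kap_le H y x).trans ?_
    rw [nsmul_eq_mul]
    gcongr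
    exact_mod_cast card_hor_le y
  have hf := hn _ (father_mem_nbr hy)
  have hc : ∀ i, 0 ≤ v (y.child i) := fun i => hn _ (child_mem_nbr y i)
  have hh : ∀ x ∈ hor y, 0 ≤ kap C₁ C₂ y x * v x := fun x hx =>
    mul_nonneg (kap_pos H y x).le (hn _ (hor_mem_nbr (mem_hor.mp hx)))
  have key : 3 * v y.father + lam * ∑ i, v (y.child i) + ∑ x ∈ hor y, kap C₁ C₂ y x * v x ≤
      Q * v y := by
    -- Harmonicity: the weighted sum over the neighbours is the total weight times the value at y.
    have e : 3 * v y.father + lam * ∑ i, v (y.child i) + ∑ x ∈ hor y, kap C₁ C₂ y x * v x =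
        (3 + 3 * lam + ∑ x ∈ hor y, kap C₁ C₂ y x) * v y := by
      simp only [gen, mul_sub, Finset.sum_sub_distrib, ← Finset.sum_mul, Finset.sum_const,
        Finset.card_univ, Fintype.card_fin, nsmul_eq_mul] at hv
      push_cast at hv
      linarith
    rw [e]
    refine mul_le_mul_of_nonneg_right ?_ h0
    simp only [Q]
    linarith
  have hs0 : 0 ≤ lam * ∑ i, v (y.child i) := mul_nonneg hl.le (Finset.sum_nonneg fun i _ => hc i)
  have hs1 := Finset.sum_nonneg hh
  rw [div_mul_eq_mul_div, div_le_iff₀ hQ]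
  have hzv := hn z hz
  have hqz : q * v z ≤ lam * v z := mul_le_mul_of_nonneg_right hq1 hzv
  rcases mem_nbr.mp hz with h | h
  · rcases vertAdj_iff.mp h with ⟨i, rfl⟩ | ⟨_, rfl⟩
    · have := mul_le_mul_of_nonneg_left (Finset.single_le_sum (f := fun i => v (y.child i))
        (fun i _ => hc i) (Finset.mem_univ i)) hl.le
      linarith
    · have : lam * v y.father ≤ 3 * v y.father := by gcongr; linarith
      linarith
  · have := Finset.single_le_sum hh (mem_hor.mpr h)
    have : q * v z ≤ kap C₁ C₂ y z * v z :=
      mul_le_mul_of_nonneg_right ((min_le_right _ _).trans (min_le_kap y z)) hzv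
    linarith

/-- A lower bound near a word by iteration of the Harnack inequality. -/
theorem harnack_chain {p : ℝ} (hp : 0 < p) (hp1 : p ≤ 1) {v : Word → ℝ} {w : Word}
    (hH : ∀ y ∈ star1 w, w.len < y.len → ∀ z ∈ nbr y, p * v z ≤ v y) {s : ℝ} (hs : 0 ≤ s)
    (hw : s ≤ v (w.child 0)) (k : ℕ) :
    ∀ z ∈ star1 w, z.len = w.len + 1 + k → p ^ (k + 3) * s ≤ v z := by
  induction k with
  | zero =>
    intro z hz hl
    obtain ⟨x, i, rfl⟩ := exists_eq_child (x := z) (by omega)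
    rw [len_child] at hl
    have hzx := hz.2
    rw [anc_child (by omega), anc_self (by omega)] at hzx
    have hp2 : p ^ 2 ≤ 1 := pow_le_one₀ hp.le hp1
    have hps : p ^ 3 * s ≤ s := mul_le_of_le_one_left hs (pow_le_one₀ hp.le hp1)
    have hwc : ∀ j : Fin 3, w.child j ∈ star1 w := fun j =>
      ⟨by rw [len_child]; omega, by rw [anc_child le_rfl, anc_self le_rfl]; exact Or.inl rfl⟩
    have hxc : ∀ j : Fin 3, x.child j ∈ star1 w := fun j =>
      ⟨by rw [len_child]; omega, by rw [anc_child (by omega), anc_self (by omega)]; exact hzx⟩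
    have hsib : ∀ (a : Word), (∀ j, a.child j ∈ star1 w) → a.len = w.len → ∀ i j : Fin 3,
        p * v (a.child j) ≤ v (a.child i) ∨ v (a.child j) = v (a.child i) := by
      intro a ha hal i j
      by_cases hij : i = j
      · right; rw [hij]
      · left
        exact hH _ (ha i) (by rw [len_child]; omega) _ (hor_mem_nbr (horAdj_sibling a hij))
    have hsib' : ∀ (a : Word), (∀ j, a.child j ∈ star1 w) → a.len = w.len → ∀ (i j : Fin 3) (t : ℝ),
        0 ≤ t → t ≤ v (a.child j) → p * t ≤ v (a.child i) := by
      intro a ha hal i j t ht htv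
      rcases hsib a ha hal i j with h | h
      · nlinarith
      · nlinarith
    rw [zero_add]
    -- Three edges suffice, hence the exponent 3: to a sibling below w, across a horizontal edge to
    -- a child of the adjacent word x, and to a sibling below x.
    rcases hzx with rfl | hadj
    · have := hsib' w hwc rfl i 0 s hs hw
      nlinarith [mul_nonneg hp.le hs]
    · obtain ⟨a, b, hab⟩ := exists_horAdj_child hadj
      have h1 := hsib' w hwc rfl a 0 s hs hw
      have h2 := hH _ (hxc b) (by rw [len_child]; omega) _ (hor_mem_nbr hab.symm)
      have h3 : p * (p * s) ≤ v (x.child b) := by nlinarith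
      have h4 := hsib' x hxc (by omega) i b _ (by positivity) h3
      nlinarith
  | succ k ih =>
    intro z hz hl
    obtain ⟨x, i, rfl⟩ := exists_eq_child (x := z) (by omega)
    rw [len_child] at hl
    have hx : x ∈ star1 w := ⟨by omega, by have := hz.2; rwa [anc_child (by omega)] at this⟩
    have h1 := ih x hx (by omega)
    have h2 := hH _ hz (by rw [len_child]; omega) x (nbr_symm (child_mem_nbr x i))
    calc p ^ (k + 1 + 3) * s = p * (p ^ (k + 3) * s) := by ring
      _ ≤ p * v x := by gcongr
      _ ≤ _ := h2

/-! ### Cutoff functions and the lower bound in the depth -/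

open Classical in
/-- The indicator function of the vertices of the cell of `w`. -/
noncomputable def vertexIndicator (w : Word) (q : EuclideanSpace ℝ (Fin 2)) : ℝ :=
  if ∃ i, q = w.map (corner i) then 1 else 0

theorem vertexIndicator_mem (w : Word) (q : EuclideanSpace ℝ (Fin 2)) :
    vertexIndicator w q ∈ Set.Icc (0 : ℝ) 1 := by
  unfold vertexIndicator; split_ifs <;> simp

theorem abs_vertexIndicator_sub (w : Word) (p q : EuclideanSpace ℝ (Fin 2)) :
    |vertexIndicator w p - vertexIndicator w q| ≤ 1 := by
  have h1 := vertexIndicator_mem w p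
  have h2 := vertexIndicator_mem w q
  rw [Set.mem_Icc] at h1 h2
  exact abs_le.mpr ⟨by linarith, by linarith⟩

/-- If the ancestor of x on the level of w is not near w, the two cells share no vertex, so the
spline starts from zero values and vanishes at x. -/
theorem mem_star1_of_cutoff {w x : Word} (hx : w.len ≤ x.len)
    (h : 0 < spline w.len (vertexIndicator w) x 0) : x ∈ star1 w := by
  refine ⟨hx, ?_⟩
  by_contra hn
  have h0 := (spline_mem (φ := vertexIndicator w) (s := 0) (t := 0) hx (fun i => ?_) 0).2
  · linarith
  · have : vertexIndicator w ((x.anc w.len).map (corner i)) = 0 := by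
      rw [vertexIndicator, if_neg]
      rintro ⟨j, hj⟩
      refine hn (near_of_inter (len_anc hx).symm ⟨w.map (corner j), map_corner_mem_cell w j, ?_⟩)
      rw [← hj]
      exact map_corner_mem_cell _ _
    rw [this]
    simp

theorem spline_mem_of_anc {m n : ℕ} {φ : EuclideanSpace ℝ (Fin 2) → ℝ} (hmn : m ≤ n) {s t : ℝ}
    {x : Word} (hx : n ≤ x.len) (h : ∀ i, spline m φ (x.anc n) i ∈ Set.Icc s t) (i : Fin 3) :
    spline m φ x i ∈ Set.Icc s t := by
  refine word_induction (m := n) (p := fun x => (∀ i, spline m φ (x.anc n) i ∈ Set.Icc s t) →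
    ∀ i, spline m φ x i ∈ Set.Icc s t) ?_ ?_ x hx h i
  · intro x hx h
    rwa [anc_self hx.le] at h
  · intro x hx ih i h
    rw [anc_child hx] at h
    rw [spline_child (hmn.trans hx)]
    exact harmStep_mem (ih h) i

/-- The cutoff function of `w` is close to `1` near the descendants of `w`. -/
theorem cutoff_ge {w w' : Word} {k : ℕ} (hk : 0 < k) (hl : w'.len = w.len + k)
    (ha : w'.anc w.len = w) {y : Word} (hy : y ∈ star2 w') :
    1 - 5 * (3 / 5) ^ k ≤ spline w.len (vertexIndicator w) y 0 := by
  set g := spline w.len (vertexIndicator w)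
  have hosc := abs_vertexIndicator_sub w
  obtain ⟨hyl, z, h1, h2⟩ := hy
  set y' := y.anc w'.len
  have hy'l : y'.len = w'.len := len_anc hyl
  have hzl := h1.len_eq
  have hw1 : g w' 0 = 1 := by
    have := spline_mem (φ := vertexIndicator w) (s := 1) (t := 1) (m := w.len) (x := w') (by omega)
      (fun i => by
        rw [ha, vertexIndicator, if_pos ⟨i, rfl⟩]; simp) 0
    exact le_antisymm this.2 this.1
  -- The cutoff is 1 on the cell of w'. Two steps to near words cost at most 2(3/5)^k each, and the
  -- oscillation below the ancestor of y adds (3/5)^k: this gives the 5.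
  have hstep : ∀ a b : Word, Near a b → a.len = w'.len →
      g a 0 - 2 * (3 / 5) ^ k ≤ g b 0 := by
    intro a b hab hal
    rcases hab with rfl | hab
    · have : (0 : ℝ) < (3 / 5) ^ k := by positivity
      linarith
    · have := abs_spline_sub_le hosc (hor_mem_nbr hab) (show w.len < a.len by omega)
      rw [show a.len - w.len = k by omega] at this
      linarith [(abs_le.mp this).1]
  have h3 := hstep _ _ h1 rfl
  have h4 := hstep _ _ h2 (by omega)
  have h5 := spline_mem_of_anc (φ := vertexIndicator w) (show w.len ≤ w'.len by omega) hyl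
    (s := g y' 0 - (3 / 5) ^ k) (t := g y' 0 + (3 / 5) ^ k) (fun i => by
      have := spline_osc hosc (show w.len ≤ y'.len by omega) i 0
      rw [show y'.len - w.len = k by omega, mul_one, abs_le] at this
      exact ⟨by linarith, by linarith⟩) 0
  linarith [h5.1]

/-- A nonnegative harmonic function that is large at one child of `w` is large deep inside. -/
theorem exists_lower_bound (H : Admissible lam C₁ C₂) :
    ∃ k > 0, ∃ η : ℝ, 0 < η ∧ η ≤ 1 ∧ ∀ (w : Word) (v : Word → ℝ) (s : ℝ),
      (∀ x, w.len < x.len → gen lam C₁ C₂ v x = 0) → (∀ x ∈ star2 w, 0 ≤ v x) → 0 ≤ s →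
      s ≤ v (w.child 0) → ∀ w' : Word, w'.len = w.len + k → w'.anc w.len = w →
      ∀ y ∈ star2 w', η * s ≤ v y := by
  obtain ⟨p, hp, hp1, hharn⟩ := exists_harnack H
  have hl := H.pos
  have hl' := H.upper
  have hC1 := H.pos₁
  have hC2 := H.pos₂
  set B := (6 + 4 * (C₁ + C₂)) * 2 with hB
  have hla : 0 < 1 - lam := by linarith
  set A := B / (3 * (1 - 3 / 5) * (1 - lam)) with hA
  have hA0 : 0 < A := by positivity
  have hAB : A * (3 * (1 - 3 / 5) * (1 - lam)) = B := by rw [hA]; field_simp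
  have htend := tendsto_pow_atTop_nhds_zero_of_lt_one (r := (3 / 5 : ℝ)) (by norm_num) (by norm_num)
  -- k₀ makes the barrier correction at most 1/4. Then k makes the cutoff at least 3/4 on the star
  -- of w', and k ≥ k₀ + 2 places that star strictly below level m + 1 + k₀.
  obtain ⟨k₀, hk₀⟩ : ∃ k₀, A * (3 / 5) ^ (k₀ + 1) ≤ 1 / 4 := by
    have := ((htend.comp (tendsto_add_atTop_nat 1)).const_mul A)
    rw [mul_zero] at this
    exact (this.eventually (ge_mem_nhds (by norm_num : (0 : ℝ) < 1 / 4))).exists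
  obtain ⟨k, hk, hk'⟩ : ∃ k, 5 * (3 / 5 : ℝ) ^ k ≤ 1 / 4 ∧ k₀ + 2 ≤ k := by
    have := htend.const_mul 5
    rw [mul_zero] at this
    exact ((this.eventually (ge_mem_nhds (by norm_num : (0 : ℝ) < 1 / 4))).and
      (eventually_ge_atTop (k₀ + 2))).exists
  refine ⟨k, by omega, p ^ (k₀ + 3) / 2, by positivity, ?_, ?_⟩
  · have : p ^ (k₀ + 3) ≤ 1 := pow_le_one₀ hp.le hp1
    linarith
  intro w v s hv hpos hs hvs w' hwl hwa y hy
  set m := w.len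
  set g : Word → ℝ := fun x => spline m (vertexIndicator w) x 0 with hg
  set e := p ^ (k₀ + 3) * s with he
  have he0 : 0 ≤ e := by positivity
  -- The cutoff g is not subharmonic, but its `gen` is at least -B(3/5)^(|x| - m); the barrier makes
  -- φ subharmonic, and the subtracted constant keeps φ ≤ g from level m + 1 + k₀ on.
  set φ : Word → ℝ := fun x => g x - A * (3 / 5) ^ (k₀ + 1) + A / (3 / 5) ^ m * (3 / 5) ^ x.len
    with hφ
  have hpow : ∀ n, m ≤ n → A / (3 / 5) ^ m * (3 / 5 : ℝ) ^ n = A * (3 / 5) ^ (n - m) := by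
    intro n hn
    rw [pow_sub₀ _ (by norm_num) hn]
    field_simp
  have hφg : ∀ x : Word, m + 1 + k₀ ≤ x.len → φ x ≤ g x := by
    intro x hx
    have h1 : (3 / 5 : ℝ) ^ (x.len - m) ≤ (3 / 5) ^ (k₀ + 1) :=
      pow_le_pow_of_le_one (by norm_num) (by norm_num) (by omega)
    have := mul_le_mul_of_nonneg_left h1 hA0.le
    simp only [hφ]
    rw [hpow _ (by omega)]
    linarith
  have hg1 : ∀ x : Word, m ≤ x.len → g x ≤ 1 := fun x hx =>
    (spline_mem hx (fun i => vertexIndicator_mem w _) 0).2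
  have hharn' : ∀ y ∈ star1 w, w.len < y.len → ∀ z ∈ nbr y, p * v z ≤ v y := fun y hy hyl =>
    hharn v y (by omega) (hv y hyl) (hpos y (star1_subset_star2 w hy))
      fun z hz => hpos z (nbr_mem_star2 hy hyl hz)
  have hchain := harnack_chain hp hp1 hharn' hs hvs k₀
  have hstar : ∀ x : Word, m + 1 + k₀ ≤ x.len → 0 < φ x → x ∈ star1 w := fun x hx hφx =>
    mem_star1_of_cutoff (show m ≤ x.len by omega) (hφx.trans_le (hφg x hx))
  -- Comparison of e φ with v where φ > 0 below level m + 1 + k₀. On that level the Harnack chain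
  -- gives v ≥ e ≥ e φ; where φ ≤ 0, nonnegativity of v suffices.
  have key := maxPrinciple H (f := fun x => e * φ x - v x) (M := e)
    {x | m + 1 + k₀ < x.len ∧ 0 < φ x} ?_ ?_ ?_ ?_
  · have hyl := hy.1
    have hφy : 1 / 2 ≤ φ y := by
      have h1 := cutoff_ge (by omega) hwl hwa hy
      have h2 : 0 ≤ A / (3 / 5) ^ m * (3 / 5 : ℝ) ^ y.len := by positivity
      simp only [hφ, hg]
      linarith
    have h3 : e * φ y - v y ≤ 0 := key y ⟨by omega, by linarith⟩
    have h4 := mul_le_mul_of_nonneg_left hφy he0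
    calc p ^ (k₀ + 3) / 2 * s = e * (1 / 2) := by rw [he]; ring
      _ ≤ _ := by linarith
  · rintro x ⟨hx, hφx⟩
    have h1 := hpos x (star1_subset_star2 w (hstar x hx.le hφx))
    have h2 := (hφg x hx.le).trans (hg1 x (by omega))
    have h3 := mul_le_mul_of_nonneg_left h2 he0
    linarith
  · rintro x ⟨hx, -⟩
    omega
  · rintro x ⟨hx, -⟩
    rw [gen_sub, gen_const_mul, hv x (show m < x.len by omega), sub_zero]
    refine mul_nonneg he0 ?_
    simp only [hφ]
    rw [gen_add, gen_sub, gen_const_mul, gen_const_mul, gen_const]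
    have h1 := abs_gen_le H (v := g) (x := x) (by omega) fun y hy =>
      abs_spline_sub_le (abs_vertexIndicator_sub w) hy (show m < x.len by omega)
    have h2 := mul_le_mul_of_nonneg_left (gen_pow_ge H (θ := 3 / 5) (by norm_num) (by norm_num)
      (show 0 < x.len by omega)) (show 0 ≤ A / (3 / 5) ^ m by positivity)
    have h3 : A / (3 / 5) ^ m * (3 * (1 - 3 / 5) * (1 - lam) * (3 / 5) ^ x.len) =
        B * (3 / 5) ^ (x.len - m) := by
      rw [← hAB, ← mul_assoc, mul_right_comm, hpow _ (by omega)]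
      ring
    rw [h3] at h2
    have h4 := (abs_le.mp h1).1
    have h5 : (6 + 4 * (C₁ + C₂)) * (2 * 1 * (3 / 5 : ℝ) ^ (x.len - m)) =
        B * (3 / 5) ^ (x.len - m) := by rw [hB]; ring
    rw [h5] at h4
    linarith
  · rintro x ⟨hx, hφx⟩ z hz
    by_cases hφz : 0 < φ z
    · by_cases hzl : m + 1 + k₀ < z.len
      · exact Or.inl ⟨hzl, hφz⟩
      · right
        have hzl' : z.len = m + 1 + k₀ := by
          rcases mem_nbr.mp hz with (⟨i, rfl⟩ | ⟨i, rfl⟩) | h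
          · rw [len_child] at hzl; omega
          · rw [len_child] at hx; omega
          · have := h.2.1; omega
        have h1 := hchain z (hstar z hzl'.ge hφz) hzl'
        have h2 := (hφg z hzl'.ge).trans (hg1 z (by omega))
        have h3 := mul_le_mul_of_nonneg_left h2 he0
        linarith
    · right
      have h1 := hpos z (nbr_mem_star2 (hstar x hx.le hφx) (show m < x.len by omega) hz)
      have h2 := mul_nonpos_of_nonneg_of_nonpos he0 (not_lt.mp hφz)
      linarith

/-! ### Oscillation decay and approximation of the Martin kernels -/

/-- On every star of level `m` the oscillation of `v` is at most `ω`. -/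
def OscLe (v : Word → ℝ) (m : ℕ) (ω : ℝ) : Prop :=
  ∀ w : Word, w.len = m → ∃ a, ∀ x ∈ star2 w, v x ∈ Set.Icc a (a + ω)

/-- With values in [a, a + ω], one of v - a and a + ω - v is at least ω/2 at the first child of w.
The lower bound for that function cuts ηω/2 off one end of the interval. -/
theorem exists_osc_step (H : Admissible lam C₁ C₂) :
    ∃ k > 0, ∃ η : ℝ, 0 < η ∧ η ≤ 1 ∧ ∀ (v : Word → ℝ) (m : ℕ) (ω : ℝ),
      (∀ x, m < x.len → gen lam C₁ C₂ v x = 0) → 0 ≤ ω → OscLe v m ω →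
      OscLe v (m + k) ((1 - η / 2) * ω) := by
  obtain ⟨k, hk, η, hη, hη1, h⟩ := exists_lower_bound H
  refine ⟨k, hk, η, hη, hη1, fun v m ω hv hω ho w' hw' => ?_⟩
  have hwl : (w'.anc m).len = m := len_anc (by omega)
  obtain ⟨a, ha⟩ := ho _ hwl
  have hsub := star2_anc (w := w') (m := m) (by omega)
  set w := w'.anc m
  have hw0 := ha _ (child_mem_star2 w 0)
  by_cases hcase : a + ω / 2 ≤ v (w.child 0)
  · refine ⟨a + η * (ω / 2), fun y hy => ?_⟩
    have := h w (fun x => v x - a) (ω / 2) (fun x hx => by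
        rw [gen_sub, gen_const, hv x (by omega), sub_zero])
      (fun x hx => sub_nonneg.mpr (ha x hx).1) (by positivity)
      (show ω / 2 ≤ v (w.child 0) - a by linarith) w' (by omega) (by rw [hwl]) y hy
    have h2 := (ha y (hsub hy)).2
    exact ⟨by linarith, by linarith⟩
  · refine ⟨a, fun y hy => ?_⟩
    have := h w (fun x => (a + ω) - v x) (ω / 2) (fun x hx => by
        rw [gen_sub, gen_const, hv x (by omega), sub_zero])
      (fun x hx => sub_nonneg.mpr (ha x hx).2) (by positivity)
      (show ω / 2 ≤ a + ω - v (w.child 0) by linarith) w' (by omega) (by rw [hwl]) y hy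
    have h2 := (ha y (hsub hy)).1
    exact ⟨h2, by linarith⟩

/-- The iteration starts at level |x|, below which the quotient is harmonic, with its range in [0,
M] as the initial interval. -/
theorem exists_oscLe_greenQuot (H : Admissible lam C₁ C₂) (x : Word) {ε : ℝ} (hε : 0 < ε) :
    ∃ m, OscLe (greenQuot lam C₁ C₂ x) m ε := by
  obtain ⟨k, hk, η, hη, hη1, h⟩ := exists_osc_step H
  obtain ⟨M, hM⟩ := exists_greenQuot_le H x
  have hM0 : 0 ≤ M := (greenQuot_nonneg H x x).trans (hM x)
  have key : ∀ i : ℕ, OscLe (greenQuot lam C₁ C₂ x) (x.len + i * k) ((1 - η / 2) ^ i * M) := by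
    intro i
    induction i with
    | zero =>
      intro w _
      exact ⟨0, fun y _ => ⟨greenQuot_nonneg H x y, by simpa using hM y⟩⟩
    | succ i ih =>
      have h1 : 0 ≤ (1 - η / 2) ^ i * M := mul_nonneg (pow_nonneg (by linarith) _) hM0
      have := h _ _ _ (fun y hy => gen_greenQuot H (by omega) (by rintro rfl; omega)) h1 ih
      convert this using 1 <;> ring
  have htend := (tendsto_pow_atTop_nhds_zero_of_lt_one (r := 1 - η / 2) (by linarith)
    (by linarith)).mul_const M
  rw [zero_mul] at htend
  obtain ⟨i, hi⟩ := (htend.eventually (ge_mem_nhds hε)).exists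
  refine ⟨x.len + i * k, fun w hw => ?_⟩
  obtain ⟨a, ha⟩ := key i w hw
  exact ⟨a, fun y hy => ⟨(ha y hy).1, (ha y hy).2.trans (by linarith)⟩⟩

open Classical in
/-- Green potentials divided by `λ^|x|` are uniform limits of functions of finite energy. -/
theorem exists_energy_near (H : Admissible lam C₁ C₂) (x : Word) {ε : ℝ} (hε : 0 < ε) :
    ∃ f : Word → ℝ, energy lam C₁ C₂ f < ∞ ∧ ∀ y, |f y - greenQuot lam C₁ C₂ x y| ≤ ε := by
  obtain ⟨m, hm⟩ := exists_oscLe_greenQuot H x hε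
  set v := greenQuot lam C₁ C₂ x
  -- At a vertex of level m any word whose cell has this vertex as a corner may be chosen. All such
  -- words are near each other, so the chosen value stays in the interval of oscillation.
  let φ : EuclideanSpace ℝ (Fin 2) → ℝ := fun q =>
    if h : ∃ z : Word, z.len = m ∧ ∃ i, z.map (corner i) = q then v h.choose else 0
  refine ⟨_, energy_spline_lt_top H m φ v, fun y => ?_⟩
  split_ifs with hy
  · rw [sub_self, abs_zero]
    exact hε.le
  · have hy : m ≤ y.len := not_lt.mp hy
    have hal : (y.anc m).len = m := len_anc hy
    obtain ⟨a, ha⟩ := hm _ hal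
    have h1 := spline_mem (φ := φ) (s := a) (t := a + ε) hy (fun i => ?_) 0
    · have h2 := ha y (star1_subset_star2 _ ⟨by omega, Or.inl (by rw [hal])⟩)
      rw [Set.mem_Icc] at h1 h2
      exact abs_le.mpr ⟨by linarith, by linarith⟩
    · have hex : ∃ z : Word, z.len = m ∧ ∃ j, z.map (corner j) = (y.anc m).map (corner i) :=
        ⟨_, hal, i, rfl⟩
      have h3 : φ ((y.anc m).map (corner i)) = v hex.choose := dif_pos hex
      rw [h3]
      obtain ⟨hz, j, hj⟩ := hex.choose_spec
      refine ha _ (star1_subset_star2 _ ⟨by omega, ?_⟩)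
      rw [hal, anc_self hz.le]
      refine near_of_inter (by omega) ⟨_, map_corner_mem_cell _ i, ?_⟩
      have h4 := map_corner_mem_cell hex.choose j
      rwa [hj] at h4

end

/-! ### The energy as a bilinear form -/

section

variable {lam C₁ C₂ : ℝ}

variable (lam C₁ C₂) in
/-- The product of increments along an edge, weighted by the conductance. -/
noncomputable def edgeProd (f g : Word → ℝ) (p : Word × Word) : ℝ :=
  conductance lam C₁ C₂ p.1 p.2 * ((f p.1 - f p.2) * (g p.1 - g p.2))

variable (lam C₁ C₂) in
/-- The bilinear form of the energy. -/
noncomputable def bilForm (f g : Word → ℝ) : ℝ := 1 / 2 * ∑' p, edgeProd lam C₁ C₂ f g p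

theorem edgeProd_self_nonneg (H : Admissible lam C₁ C₂) (f : Word → ℝ) (p : Word × Word) :
    0 ≤ edgeProd lam C₁ C₂ f f p :=
  mul_nonneg (conductance_nonneg H _ _) (mul_self_nonneg _)

theorem energy_eq_tsum (f : Word → ℝ) :
    energy lam C₁ C₂ f = 1 / 2 * ∑' p, ENNReal.ofReal (edgeProd lam C₁ C₂ f f p) := by
  rw [energy, ENNReal.tsum_prod']
  simp only [edgeProd, sq]

theorem energy_lt_top_iff (H : Admissible lam C₁ C₂) {f : Word → ℝ} :
    energy lam C₁ C₂ f < ∞ ↔ Summable (edgeProd lam C₁ C₂ f f) := by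
  rw [energy_eq_tsum]
  constructor
  · intro h
    have h1 : ∑' p, ENNReal.ofReal (edgeProd lam C₁ C₂ f f p) ≠ ∞ := fun h1 => by
      rw [h1, ENNReal.mul_top (by norm_num)] at h
      exact lt_irrefl _ h
    exact (ENNReal.summable_toReal h1).congr fun p =>
      ENNReal.toReal_ofReal (edgeProd_self_nonneg H f p)
  · intro h
    exact ENNReal.mul_lt_top (by norm_num) h.tsum_ofReal_lt_top

theorem bilForm_self (H : Admissible lam C₁ C₂) {f : Word → ℝ} (hf : energy lam C₁ C₂ f < ∞) :
    bilForm lam C₁ C₂ f f = (energy lam C₁ C₂ f).toReal := by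
  have hs := (energy_lt_top_iff H).mp hf
  rw [energy_eq_tsum, ← ENNReal.ofReal_tsum_of_nonneg (edgeProd_self_nonneg H f) hs,
    ENNReal.toReal_mul, ENNReal.toReal_ofReal (tsum_nonneg (edgeProd_self_nonneg H f)), bilForm]
  simp

theorem energy_lt_top_of_edge (H : Admissible lam C₁ C₂) {f g h : Word → ℝ} {M N : ℝ}
    (hf : energy lam C₁ C₂ f < ∞) (hg : energy lam C₁ C₂ g < ∞)
    (hh : ∀ x y, (h x - h y) ^ 2 ≤ M * (f x - f y) ^ 2 + N * (g x - g y) ^ 2) :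
    energy lam C₁ C₂ h < ∞ := by
  rw [energy_lt_top_iff H] at *
  refine Summable.of_nonneg_of_le (edgeProd_self_nonneg H h) (fun p => ?_)
    ((hf.mul_left M).add (hg.mul_left N))
  have h1 := mul_le_mul_of_nonneg_left (hh p.1 p.2) (conductance_nonneg H p.1 p.2)
  simp only [edgeProd]
  linarith

theorem energy_add_lt_top (H : Admissible lam C₁ C₂) {f g : Word → ℝ}
    (hf : energy lam C₁ C₂ f < ∞) (hg : energy lam C₁ C₂ g < ∞) :
    energy lam C₁ C₂ (f + g) < ∞ :=
  energy_lt_top_of_edge H (M := 2) (N := 2) hf hg fun x y => by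
    simp only [Pi.add_apply]
    nlinarith [sq_nonneg ((f x - f y) - (g x - g y))]

theorem energy_sub_lt_top (H : Admissible lam C₁ C₂) {f g : Word → ℝ}
    (hf : energy lam C₁ C₂ f < ∞) (hg : energy lam C₁ C₂ g < ∞) :
    energy lam C₁ C₂ (f - g) < ∞ :=
  energy_lt_top_of_edge H (M := 2) (N := 2) hf hg fun x y => by
    simp only [Pi.sub_apply]
    nlinarith [sq_nonneg ((f x - f y) + (g x - g y))]

theorem energy_smul_lt_top (H : Admissible lam C₁ C₂) (a : ℝ) {f : Word → ℝ}
    (hf : energy lam C₁ C₂ f < ∞) : energy lam C₁ C₂ (a • f) < ∞ :=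
  energy_lt_top_of_edge H (M := a ^ 2) (N := 0) hf hf fun x y => by
    simp only [Pi.smul_apply, smul_eq_mul]
    nlinarith

/-- The product rule along edges; both factors are bounded because their energies are finite. -/
theorem energy_mul_lt_top (H : Admissible lam C₁ C₂) {f g : Word → ℝ}
    (hf : energy lam C₁ C₂ f < ∞) (hg : energy lam C₁ C₂ g < ∞) :
    energy lam C₁ C₂ (f * g) < ∞ := by
  obtain ⟨M, hM⟩ := exists_abs_le_of_energy H hf
  obtain ⟨N, hN⟩ := exists_abs_le_of_energy H hg
  refine energy_lt_top_of_edge H (M := 2 * N ^ 2) (N := 2 * M ^ 2) hf hg fun x y => ?_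
  have h1 : f x ^ 2 ≤ M ^ 2 := sq_le_sq' (abs_le.mp (hM x)).1 (abs_le.mp (hM x)).2
  have h2 : g y ^ 2 ≤ N ^ 2 := sq_le_sq' (abs_le.mp (hN y)).1 (abs_le.mp (hN y)).2
  have h3 := mul_le_mul_of_nonneg_right h1 (sq_nonneg (g x - g y))
  have h4 := mul_le_mul_of_nonneg_right h2 (sq_nonneg (f x - f y))
  have h5 : (f * g) x - (f * g) y = f x * (g x - g y) + g y * (f x - f y) := by
    simp only [Pi.mul_apply]; ring
  rw [h5]
  nlinarith [sq_nonneg (f x * (g x - g y) - g y * (f x - f y))]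

theorem energy_mono {f g : Word → ℝ} (H : Admissible lam C₁ C₂)
    (h : ∀ x y, |f x - f y| ≤ |g x - g y|) : energy lam C₁ C₂ f ≤ energy lam C₁ C₂ g := by
  exact mul_le_mul' le_rfl (ENNReal.tsum_le_tsum fun x => ENNReal.tsum_le_tsum fun y =>
    ENNReal.ofReal_le_ofReal (mul_le_mul_of_nonneg_left (sq_le_sq.mpr (h x y))
      (conductance_nonneg H x y)))

theorem energy_zero : energy lam C₁ C₂ 0 = 0 := by simp [energy]

theorem energy_lt_top_of_finite (H : Admissible lam C₁ C₂) {f : Word → ℝ}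
    (hf : f.support.Finite) : energy lam C₁ C₂ f < ∞ := by
  refine energy_lt_top_of_le H (e := fun x => f x ^ 2) (fun x => sq_nonneg _)
    (fun x y _ => by nlinarith [sq_nonneg (f x + f y)]) ?_
  rw [tsum_eq_sum (s := hf.toFinset)]
  · exact ENNReal.sum_lt_top.mpr fun x _ => ENNReal.ofReal_lt_top
  · intro x hx
    have : f x = 0 := by simpa using hx
    simp [this]

/-- Lower semicontinuity of the energy with respect to pointwise convergence. -/
theorem energy_le_of_tendsto {ι : Type*} {l : Filter ι} [l.NeBot] {F : ι → Word → ℝ} {f : Word → ℝ}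
    (hF : ∀ x, Tendsto (fun n => F n x) l (𝓝 (f x))) {K : ℝ≥0∞}
    (hK : ∀ᶠ n in l, energy lam C₁ C₂ (F n) ≤ K) : energy lam C₁ C₂ f ≤ K := by
  rw [energy_eq_tsum, ENNReal.tsum_eq_iSup_sum, ENNReal.mul_iSup]
  refine iSup_le fun s => ?_
  have h1 : Tendsto (fun n => 1 / 2 * ∑ p ∈ s, ENNReal.ofReal (edgeProd lam C₁ C₂ (F n) (F n) p)) l
      (𝓝 (1 / 2 * ∑ p ∈ s, ENNReal.ofReal (edgeProd lam C₁ C₂ f f p))) := by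
    refine ENNReal.Tendsto.const_mul (tendsto_finsetSum _ fun p _ => ?_) (Or.inr (by norm_num))
    refine ENNReal.tendsto_ofReal (Tendsto.const_mul _ ?_)
    exact ((hF _).sub (hF _)).mul ((hF _).sub (hF _))
  refine le_of_tendsto h1 (hK.mono fun n hn => le_trans ?_ hn)
  rw [energy_eq_tsum]
  gcongr
  exact ENNReal.sum_le_tsum s

theorem summable_edgeProd (H : Admissible lam C₁ C₂) {f g : Word → ℝ}
    (hf : energy lam C₁ C₂ f < ∞) (hg : energy lam C₁ C₂ g < ∞) :
    Summable (edgeProd lam C₁ C₂ f g) := by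
  have h1 := (energy_lt_top_iff H).mp (energy_add_lt_top H hf hg)
  have h2 := (energy_lt_top_iff H).mp (energy_sub_lt_top H hf hg)
  refine ((h1.sub h2).mul_left (1 / 4)).congr fun p => ?_
  simp only [edgeProd, Pi.add_apply, Pi.sub_apply]
  ring

/-- Finiteness of the energies matters: `toReal` would turn an infinite energy into 0. -/
theorem polar_energy (H : Admissible lam C₁ C₂) {f g : Word → ℝ}
    (hf : energy lam C₁ C₂ f < ∞) (hg : energy lam C₁ C₂ g < ∞) :
    ((energy lam C₁ C₂ (f + g)).toReal - (energy lam C₁ C₂ (f - g)).toReal) / 4 =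
      bilForm lam C₁ C₂ f g := by
  have h1 := energy_add_lt_top H hf hg
  have h2 := energy_sub_lt_top H hf hg
  rw [← bilForm_self H h1, ← bilForm_self H h2, bilForm, bilForm, ← mul_sub,
    ← ((energy_lt_top_iff H).mp h1).tsum_sub ((energy_lt_top_iff H).mp h2), bilForm, mul_div_assoc,
    ← tsum_div_const]
  congr 1
  refine tsum_congr fun p => ?_
  simp only [edgeProd, Pi.add_apply, Pi.sub_apply]
  ring

theorem bilForm_comm (f g : Word → ℝ) : bilForm lam C₁ C₂ f g = bilForm lam C₁ C₂ g f := by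
  simp only [bilForm, edgeProd, mul_comm (f _ - f _)]

theorem bilForm_add (H : Admissible lam C₁ C₂) {f g h : Word → ℝ}
    (hf : energy lam C₁ C₂ f < ∞) (hg : energy lam C₁ C₂ g < ∞) (hh : energy lam C₁ C₂ h < ∞) :
    bilForm lam C₁ C₂ (f + g) h = bilForm lam C₁ C₂ f h + bilForm lam C₁ C₂ g h := by
  rw [bilForm, bilForm, bilForm, ← mul_add,
    ← (summable_edgeProd H hf hh).tsum_add (summable_edgeProd H hg hh)]
  congr 1
  refine tsum_congr fun p => ?_
  simp only [edgeProd, Pi.add_apply]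
  ring

theorem bilForm_smul (a : ℝ) (f g : Word → ℝ) :
    bilForm lam C₁ C₂ (a • f) g = a * bilForm lam C₁ C₂ f g := by
  rw [bilForm, bilForm, mul_left_comm, ← tsum_mul_left (a := a)]
  congr 1
  refine tsum_congr fun p => ?_
  simp only [edgeProd, Pi.smul_apply, smul_eq_mul]
  ring

end

/-! ### Dirichlet forms carried by the nodes -/

/-- A finite measure carried by an injective image of the nodes, with atoms at all nodes. -/
structure Carries {β : Type*} [MeasurableSpace β] (ν : Measure β) (e : Word → β) : Prop where
  finite : IsFiniteMeasure ν
  measurableSet : ∀ x, MeasurableSet {e x}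
  injective : Function.Injective e
  pos : ∀ x, ν {e x} ≠ 0
  null : ν (Set.range e)ᶜ = 0

section

variable {β : Type*} [MeasurableSpace β] {ν : Measure β} {e : Word → β}

/-- Every node is an atom and the remaining points form a null set. -/
theorem Carries.ae_iff (hν : Carries ν e) {p : β → Prop} : (∀ᵐ b ∂ν, p b) ↔ ∀ x, p (e x) := by
  constructor
  · intro h x
    by_contra hx
    refine hν.pos x (measure_mono_null ?_ (MeasureTheory.ae_iff.mp h))
    rintro _ rfl
    exact hx
  · intro h
    refine MeasureTheory.ae_iff.mpr (measure_mono_null ?_ hν.null)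
    rintro b hb ⟨x, rfl⟩
    exact hb (h x)

theorem Carries.ext (hν : Carries ν e) {u v : Lp ℝ 2 ν} (h : ∀ x, u (e x) = v (e x)) : u = v :=
  Lp.ext (hν.ae_iff.mpr h)

theorem Carries.coe_add (hν : Carries ν e) (u v : Lp ℝ 2 ν) :
    ⇑(u + v) ∘ e = ⇑u ∘ e + ⇑v ∘ e :=
  funext (hν.ae_iff.mp (Lp.coeFn_add u v))

theorem Carries.coe_sub (hν : Carries ν e) (u v : Lp ℝ 2 ν) :
    ⇑(u - v) ∘ e = ⇑u ∘ e - ⇑v ∘ e :=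
  funext (hν.ae_iff.mp (Lp.coeFn_sub u v))

theorem Carries.coe_smul (hν : Carries ν e) (a : ℝ) (u : Lp ℝ 2 ν) :
    ⇑(a • u) ∘ e = a • (⇑u ∘ e) :=
  funext (hν.ae_iff.mp (Lp.coeFn_smul a u))

theorem Carries.coe_zero (hν : Carries ν e) : ⇑(0 : Lp ℝ 2 ν) ∘ e = 0 :=
  funext (hν.ae_iff.mp (Lp.coeFn_zero ℝ 2 ν))

theorem Carries.inner_indicator (hν : Carries ν e) [IsFiniteMeasure ν] (x : Word) (u : Lp ℝ 2 ν) :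
    inner ℝ (indicatorConstLp 2 (hν.measurableSet x) (measure_ne_top ν _) (1 : ℝ)) u =
      (ν {e x}).toReal * u (e x) := by
  rw [L2.inner_indicatorConstLp_one]
  have h : ∀ᵐ b ∂ν.restrict {e x}, u b = u (e x) :=
    (ae_restrict_iff' (hν.measurableSet x)).mpr (Eventually.of_forall fun b hb => by
      rw [Set.mem_singleton_iff.mp hb])
  rw [integral_congr_ae h]
  simp [Measure.real]

/-- Evaluation at a node is, up to a factor, the inner product with the indicator of its atom. -/
theorem Carries.tendsto_apply (hν : Carries ν e) {ι : Type*} {l : Filter ι} {u : ι → Lp ℝ 2 ν}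
    {v : Lp ℝ 2 ν} (h : Tendsto u l (𝓝 v)) (x : Word) :
    Tendsto (fun n => u n (e x)) l (𝓝 (v (e x))) := by
  have := hν.finite
  have h0 : (ν {e x}).toReal ≠ 0 :=
    ENNReal.toReal_ne_zero.mpr ⟨hν.pos x, measure_ne_top ν _⟩
  have h1 : ∀ w : Lp ℝ 2 ν, w (e x) = (ν {e x}).toReal⁻¹ *
      inner ℝ (indicatorConstLp 2 (hν.measurableSet x) (measure_ne_top ν _) (1 : ℝ)) w := by
    intro w
    rw [hν.inner_indicator, inv_mul_cancel_left₀ h0]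
  simp only [h1]
  exact (Tendsto.inner tendsto_const_nhds h).const_mul _

variable {lam C₁ C₂ : ℝ}

/-- The functions of finite energy form a Dirichlet form. -/
theorem Carries.isDirichletForm (hν : Carries ν e) (H : Admissible lam C₁ C₂)
    {E : Lp ℝ 2 ν → Lp ℝ 2 ν → ℝ} (hE : ∀ u v : Lp ℝ 2 ν, energy lam C₁ C₂ (⇑u ∘ e) < ∞ →
      energy lam C₁ C₂ (⇑v ∘ e) < ∞ → E u v = bilForm lam C₁ C₂ (⇑u ∘ e) (⇑v ∘ e)) :
    IsDirichletForm ν {u | energy lam C₁ C₂ (⇑u ∘ e) < ∞} E := by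
  have := hν.finite
  have hzero : energy lam C₁ C₂ (⇑(0 : Lp ℝ 2 ν) ∘ e) < ∞ := by
    rw [hν.coe_zero, energy_zero]; simp
  have hadd : ∀ u v : Lp ℝ 2 ν, energy lam C₁ C₂ (⇑u ∘ e) < ∞ → energy lam C₁ C₂ (⇑v ∘ e) < ∞ →
      energy lam C₁ C₂ (⇑(u + v) ∘ e) < ∞ := fun u v hu hv => by
    rw [hν.coe_add]; exact energy_add_lt_top H hu hv
  have hsub : ∀ u v : Lp ℝ 2 ν, energy lam C₁ C₂ (⇑u ∘ e) < ∞ → energy lam C₁ C₂ (⇑v ∘ e) < ∞ →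
      energy lam C₁ C₂ (⇑(u - v) ∘ e) < ∞ := fun u v hu hv => by
    rw [hν.coe_sub]; exact energy_sub_lt_top H hu hv
  have hsmul : ∀ (a : ℝ) (u : Lp ℝ 2 ν), energy lam C₁ C₂ (⇑u ∘ e) < ∞ →
      energy lam C₁ C₂ (⇑(a • u) ∘ e) < ∞ := fun a u hu => by
    rw [hν.coe_smul]; exact energy_smul_lt_top H a hu
  have hself : ∀ u : Lp ℝ 2 ν, energy lam C₁ C₂ (⇑u ∘ e) < ∞ →
      E u u = (energy lam C₁ C₂ (⇑u ∘ e)).toReal := fun u hu => by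
    rw [hE u u hu hu, bilForm_self H hu]
  refine ⟨inferInstance, hzero, fun u hu v hv => hadd u v hu hv, fun a u hu => hsmul a u hu, ?_,
    ?_, ?_, ?_, ?_, ?_, ?_⟩
  · let K : Submodule ℝ (Lp ℝ 2 ν) :=
      { carrier := {u | energy lam C₁ C₂ (⇑u ∘ e) < ∞}
        add_mem' := fun {u v} hu hv => hadd u v hu hv
        zero_mem' := hzero
        smul_mem' := fun a u hu => hsmul a u hu }
    -- Indicators of single nodes have finite energy, and a vector orthogonal to all of them
    -- vanishes at every node.
    have hK : K.topologicalClosure = ⊤ := by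
      rw [Submodule.topologicalClosure_eq_top_iff, Submodule.eq_bot_iff]
      intro w hw
      refine hν.ext fun x => ?_
      have h0 : (ν {e x}).toReal ≠ 0 :=
        ENNReal.toReal_ne_zero.mpr ⟨hν.pos x, measure_ne_top ν _⟩
      have h1 := (Submodule.mem_orthogonal K w).mp hw
        (indicatorConstLp 2 (hν.measurableSet x) (measure_ne_top ν _) (1 : ℝ)) (by
          refine energy_lt_top_of_finite H ((Set.finite_singleton x).subset fun y hy => ?_)
          by_contra hyx
          refine hy ?_
          have h2 := hν.ae_iff.mp (indicatorConstLp_coeFn (p := 2) (hs := hν.measurableSet x)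
            (hμs := measure_ne_top ν _) (c := (1 : ℝ))) y
          refine h2.trans (Set.indicator_of_notMem ?_ _)
          exact fun h3 => hyx (hν.injective h3))
      rw [hν.inner_indicator] at h1
      rw [(mul_eq_zero.mp h1).resolve_left h0]
      exact (congrFun hν.coe_zero x).symm
    exact (Submodule.dense_iff_topologicalClosure_eq_top (s := K)).mpr hK
  · intro u hu v hv
    rw [hE u v hu hv, hE v u hv hu, bilForm_comm]
  · intro u hu v hv w hw
    rw [hE _ _ (hadd u v hu hv) hw, hE _ _ hu hw, hE _ _ hv hw, hν.coe_add, bilForm_add H hu hv hw]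
  · intro a u hu v hv
    rw [hE _ _ (hsmul a u hu) hv, hE _ _ hu hv, hν.coe_smul, bilForm_smul]
  · intro u hu
    rw [hself u hu]
    exact ENNReal.toReal_nonneg
  · intro u hu hcau
    have hone : ∀ w : Lp ℝ 2 ν, energy lam C₁ C₂ (⇑w ∘ e) < ∞ →
        formOne E w = (energy lam C₁ C₂ (⇑w ∘ e)).toReal + ‖w‖ ^ 2 := fun w hw => by
      rw [formOne, hself w hw, real_inner_self_eq_norm_sq]
    have hc : CauchySeq u := by
      refine Metric.cauchySeq_iff.mpr fun ε hε => ?_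
      obtain ⟨N, hN⟩ := hcau (ε ^ 2) (by positivity)
      refine ⟨N, fun k hk l hl => ?_⟩
      have h1 := hN k hk l hl
      rw [hone _ (hsub _ _ (hu k) (hu l))] at h1
      have h2 : (0 : ℝ) ≤ (energy lam C₁ C₂ (⇑(u k - u l) ∘ e)).toReal := ENNReal.toReal_nonneg
      rw [dist_eq_norm]
      exact lt_of_pow_lt_pow_left₀ 2 hε.le (by linarith)
    obtain ⟨v, hv⟩ := cauchySeq_tendsto_of_complete hc
    have hen : ∀ ε > 0, ∃ N, ∀ k ≥ N, energy lam C₁ C₂ (⇑(u k - v) ∘ e) ≤ ENNReal.ofReal ε := by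
      intro ε hε
      obtain ⟨N, hN⟩ := hcau ε hε
      refine ⟨N, fun k hk => ?_⟩
      -- Fatou: with k fixed and l → ∞ the Cauchy bound passes to u k - v, since L²-convergence
      -- implies convergence at every node.
      refine energy_le_of_tendsto (l := atTop) (F := fun l => ⇑(u k - u l) ∘ e) (fun x => ?_) ?_
      · exact hν.tendsto_apply (tendsto_const_nhds.sub hv) x
      · filter_upwards [eventually_ge_atTop N] with l hl
        have hkl := hsub _ _ (hu k) (hu l)
        have h1 := hN k hk l hl
        rw [hone _ hkl] at h1
        rw [← ENNReal.ofReal_toReal hkl.ne]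
        exact ENNReal.ofReal_le_ofReal (by nlinarith [sq_nonneg ‖u k - u l‖])
    have hvF : energy lam C₁ C₂ (⇑v ∘ e) < ∞ := by
      obtain ⟨N, hN⟩ := hen 1 one_pos
      have h1 := hsub _ _ (hu N) ((hN N le_rfl).trans_lt ENNReal.ofReal_lt_top : _ < ∞)
      rwa [sub_sub_cancel] at h1
    refine ⟨v, hvF, ?_⟩
    have h1 : Tendsto (fun n => ‖u n - v‖ ^ 2) atTop (𝓝 0) := by
      have := (tendsto_iff_norm_sub_tendsto_zero.mp hv).pow 2
      simpa using this
    have h2 : Tendsto (fun n => (energy lam C₁ C₂ (⇑(u n - v) ∘ e)).toReal) atTop (𝓝 0) := by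
      refine Metric.tendsto_atTop.mpr fun ε hε => ?_
      obtain ⟨N, hN⟩ := hen (ε / 2) (half_pos hε)
      refine ⟨N, fun n hn => ?_⟩
      rw [Real.dist_eq, sub_zero, abs_of_nonneg ENNReal.toReal_nonneg]
      exact (ENNReal.toReal_le_of_le_ofReal (half_pos hε).le (hN n hn)).trans_lt (half_lt_self hε)
    have h3 := h2.add h1
    rw [add_zero] at h3
    exact h3.congr fun n => (hone _ (hsub _ _ (hu n) hvF)).symm
  · intro u hu
    have hmem : MemLp (fun x => min (max (u x) 0) 1) 2 ν := by
      refine (Lp.memLp u).mono ?_ (Eventually.of_forall fun x => ?_)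
      · exact ((Lp.aestronglyMeasurable u).sup aestronglyMeasurable_const).inf
          aestronglyMeasurable_const
      · rw [Real.norm_eq_abs, Real.norm_eq_abs, abs_of_nonneg (le_min (le_max_right _ _) zero_le_one)]
        exact (min_le_left _ _).trans (max_le (le_abs_self _) (abs_nonneg _))
    have hle : energy lam C₁ C₂ (⇑(hmem.toLp _) ∘ e) ≤ energy lam C₁ C₂ (⇑u ∘ e) := by
      refine energy_mono H fun x y => ?_
      have h1 := hν.ae_iff.mp hmem.coeFn_toLp
      simp only [Function.comp_apply, h1]
      refine (abs_inf_sub_inf_le_abs _ _ _).trans ?_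
      exact abs_sup_sub_sup_le_abs _ _ _
    have hF := hle.trans_lt hu
    refine ⟨hmem.toLp _, hF, hmem.coeFn_toLp, ?_⟩
    rw [hself u hu, hself _ hF]
    exact ENNReal.toReal_mono hu.ne hle

end

section

variable {lam C₁ C₂ c : ℝ}

/-! ### The measures -/

theorem card_level (n : ℕ) : (level n).card = 3 ^ n := by
  induction n with
  | zero => simp [level]
  | succ n ih =>
    have h := sum_level_succ n fun _ => (1 : ℕ)
    simp only [Finset.sum_const, Finset.card_univ, Fintype.card_fin, smul_eq_mul, mul_one, ih] at h
    rw [h, pow_succ]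

theorem nodeMeasure_apply (s : Set Word) : nodeMeasure lam c s =
    ∑' x, ENNReal.ofReal ((c / (3 * lam)) ^ x.len) * s.indicator 1 x := by
  rw [nodeMeasure, Measure.sum_apply _ (MeasurableSet.of_discrete)]
  refine tsum_congr fun x => ?_
  rw [Measure.smul_apply, Measure.dirac_apply, smul_eq_mul]

theorem carries_nodeMeasure (hl : 0 < lam) (hc : 0 < c) (hc' : c < lam) :
    Carries (nodeMeasure lam c) id where
  finite := by
    refine ⟨?_⟩
    rw [nodeMeasure_apply]
    simp only [Set.indicator_univ, Pi.one_apply, mul_one]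
    refine tsum_word_lt_top (F := fun x => (c / (3 * lam)) ^ x.len) (fun x => by positivity) ?_
    -- Level n has 3^n words, so its mass is (c/λ)^n; finiteness of the measure uses c < λ.
    have h1 : ∀ n, ∑ x ∈ level n, (c / (3 * lam)) ^ x.len = (c / lam) ^ n := fun n => by
      rw [Finset.sum_congr rfl fun x hx => by rw [mem_level.mp hx], Finset.sum_const, card_level,
        nsmul_eq_mul]
      push_cast
      rw [← mul_pow]
      congr 1
      field_simp
    simp only [h1]
    exact summable_geometric_of_lt_one (by positivity) ((div_lt_one hl).mpr hc')
  measurableSet _ := MeasurableSet.of_discrete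
  injective := Function.injective_id
  pos x := by
    rw [nodeMeasure_apply]
    refine (lt_of_lt_of_le ?_ (ENNReal.le_tsum x)).ne'
    have : 0 < (c / (3 * lam)) ^ x.len := by positivity
    simpa using this
  null := by simp

theorem measurableEmbedding_incl : MeasurableEmbedding (incl lam C₁ C₂) where
  injective := (isEmbedding_incl lam C₁ C₂).injective
  measurable := Measurable.of_discrete
  measurableSet_image' := fun s _ => ((Set.to_countable s).image _).measurableSet

theorem carries_martinMeasure (hl : 0 < lam) (hc : 0 < c) (hc' : c < lam) :
    Carries (martinMeasure lam C₁ C₂ c) (incl lam C₁ C₂) := by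
  have h := carries_nodeMeasure hl hc hc'
  have hfin := h.finite
  have hme := measurableEmbedding_incl (lam := lam) (C₁ := C₁) (C₂ := C₂)
  refine ⟨?_, fun x => (Set.to_countable _).measurableSet, hme.injective, fun x => ?_, ?_⟩
  · exact Measure.isFiniteMeasure_map _ _
  · rw [martinMeasure, hme.map_apply, ← Set.image_singleton, Set.preimage_image_eq _ hme.injective]
    exact h.pos x
  · rw [martinMeasure, hme.map_apply]
    simp

/-! ### The active reflected Dirichlet form -/

theorem coe_eq_of_ae (hν : Carries (nodeMeasure lam c) id) {f g : Word → ℝ}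
    (h : f =ᵐ[nodeMeasure lam c] g) : f = g := funext (hν.ae_iff.mp h)

/-- Relatively compact sets of nodes are finite, so the restriction to such a set is itself finitely
supported and the locality condition is void. -/
theorem mem_localDomain (hν : Carries (nodeMeasure lam c) id) (f : Word → ℝ) :
    f ∈ localDomain lam C₁ C₂ c := by
  classical
  intro G _ hG
  have hfin : G.Finite := (hG.finite_of_discrete).subset subset_closure
  have := hν.finite
  have hsup : (G.indicator f).support ⊆ G := Set.support_indicator_subset
  have hmem : MemLp (G.indicator f) 2 (nodeMeasure lam c) := by
    refine MemLp.of_bound (Measurable.of_discrete.aestronglyMeasurable)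
      (∑ x ∈ hfin.toFinset, |f x|) (Eventually.of_forall fun x => ?_)
    by_cases hx : x ∈ G
    · rw [Set.indicator_of_mem hx]
      exact Finset.single_le_sum (f := fun x => |f x|) (fun _ _ => abs_nonneg _)
        (hfin.mem_toFinset.mpr hx)
    · rw [Set.indicator_of_notMem hx, norm_zero]
      exact Finset.sum_nonneg fun _ _ => abs_nonneg _
  have hcoe := coe_eq_of_ae hν hmem.coeFn_toLp
  refine ⟨hmem.toLp _, fun ε hε => ⟨G.indicator f, hfin.subset hsup, ?_⟩, ?_⟩
  · rw [hcoe, sub_self, energy_zero]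
    simpa using hε
  · refine Eventually.of_forall fun x hx => ?_
    rw [hcoe, Set.indicator_of_mem hx]

theorem truncation_sub_le (k : ℕ) (u : Word → ℝ) (x y : Word) :
    |truncation k u x - truncation k u y| ≤ |u x - u y| := by
  refine (abs_inf_sub_inf_le_abs _ _ _).trans ?_
  rw [max_comm (-(k : ℝ)), max_comm (-(k : ℝ))]
  exact abs_sup_sub_sup_le_abs _ _ _

theorem truncation_eq {k : ℕ} {u : Word → ℝ} {x : Word} (h : |u x| ≤ k) :
    truncation k u x = u x := by
  have := abs_le.mp h
  rw [truncation, max_eq_right this.1, min_eq_left this.2]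

/-- Truncation does not increase energy; conversely, the truncations converge pointwise and the
energy is lower semicontinuous. -/
theorem activeReflectedDomain_eq (H : Admissible lam C₁ C₂)
    (hν : Carries (nodeMeasure lam c) id) :
    activeReflectedDomain lam C₁ C₂ c =
      {u : Lp ℝ 2 (nodeMeasure lam c) | energy lam C₁ C₂ (⇑u ∘ id) < ∞} := by
  ext u
  constructor
  · rintro ⟨_, h⟩
    refine lt_of_le_of_lt ?_ h
    refine energy_le_of_tendsto (l := atTop) (F := fun k : ℕ => truncation k u) (fun x => ?_) ?_
    · refine tendsto_const_nhds.congr' ?_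
      filter_upwards [eventually_ge_atTop ⌈|u x|⌉₊] with k hk
      exact (truncation_eq ((Nat.le_ceil _).trans (by exact_mod_cast hk))).symm
    · filter_upwards [eventually_ge_atTop 1] with k hk
      exact le_iSup₂ (f := fun k _ => energy lam C₁ C₂ (truncation k ⇑u)) k hk
  · intro h
    refine ⟨fun k _ => mem_localDomain hν _, lt_of_le_of_lt ?_ h⟩
    exact iSup₂_le fun k _ => energy_mono H fun x y => truncation_sub_le k _ x y

/-- A function of finite energy is bounded, so its truncations are eventually the function itself.
-/
theorem reflectedEnergy_eq (H : Admissible lam C₁ C₂) {u : Word → ℝ}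
    (hu : energy lam C₁ C₂ u < ∞) : reflectedEnergy lam C₁ C₂ u = energy lam C₁ C₂ u := by
  obtain ⟨M, hM⟩ := exists_abs_le_of_energy H hu
  refine Tendsto.limUnder_eq (tendsto_const_nhds.congr' ?_)
  filter_upwards [eventually_ge_atTop ⌈M⌉₊] with k hk
  congr 1
  funext x
  exact (truncation_eq ((hM x).trans ((Nat.le_ceil _).trans (by exact_mod_cast hk)))).symm

theorem reflectedForm_eq (H : Admissible lam C₁ C₂) (hν : Carries (nodeMeasure lam c) id)
    (u v : Lp ℝ 2 (nodeMeasure lam c)) (hu : energy lam C₁ C₂ (⇑u ∘ id) < ∞)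
    (hv : energy lam C₁ C₂ (⇑v ∘ id) < ∞) :
    reflectedForm lam C₁ C₂ c u v = bilForm lam C₁ C₂ (⇑u ∘ id) (⇑v ∘ id) := by
  rw [← polar_energy H hu hv, ← reflectedEnergy_eq H (energy_add_lt_top H hu hv),
    ← reflectedEnergy_eq H (energy_sub_lt_top H hu hv), ← hν.coe_add, ← hν.coe_sub]
  rfl

/-! ### The form on the Martin compactification -/

theorem martinForm_eq (H : Admissible lam C₁ C₂)
    (hν : Carries (martinMeasure lam C₁ C₂ c) (incl lam C₁ C₂))
    (u v : Lp ℝ 2 (martinMeasure lam C₁ C₂ c)) (hu : energy lam C₁ C₂ (⇑u ∘ incl lam C₁ C₂) < ∞)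
    (hv : energy lam C₁ C₂ (⇑v ∘ incl lam C₁ C₂) < ∞) :
    martinForm lam C₁ C₂ c u v =
      bilForm lam C₁ C₂ (⇑u ∘ incl lam C₁ C₂) (⇑v ∘ incl lam C₁ C₂) := by
  rw [← polar_energy H hu hv, ← hν.coe_add, ← hν.coe_sub]
  rfl

theorem martinDomain_eq (H : Admissible lam C₁ C₂)
    (hν : Carries (martinMeasure lam C₁ C₂ c) (incl lam C₁ C₂)) :
    martinDomain lam C₁ C₂ c = {u : Lp ℝ 2 (martinMeasure lam C₁ C₂ c) |
      energy lam C₁ C₂ (⇑u ∘ incl lam C₁ C₂) < ∞} := by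
  ext u
  constructor
  · rintro ⟨f, hf, h⟩
    have : ⇑u ∘ incl lam C₁ C₂ = f ∘ incl lam C₁ C₂ := funext (hν.ae_iff.mp hf)
    rw [Set.mem_ofPred_eq, this]
    exact h
  · intro h
    obtain ⟨f, hf⟩ := exists_extension_of_energy H h
    refine ⟨f, hν.ae_iff.mpr fun x => (hf x).symm, ?_⟩
    have : f ∘ incl lam C₁ C₂ = ⇑u ∘ incl lam C₁ C₂ := funext hf
    rw [this]
    exact h

variable (lam C₁ C₂) in
/-- The continuous functions of finite energy. -/
noncomputable def energyAlgebra (H : Admissible lam C₁ C₂) :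
    Subalgebra ℝ C(MartinCompactification lam C₁ C₂, ℝ) where
  carrier := {f | energy lam C₁ C₂ (f ∘ incl lam C₁ C₂) < ∞}
  mul_mem' hf hg := energy_mul_lt_top H hf hg
  add_mem' hf hg := energy_add_lt_top H hf hg
  algebraMap_mem' a := by
    have : energy lam C₁ C₂ (fun _ => a) = 0 := by simp [energy]
    exact this.trans_lt ENNReal.zero_lt_top

/-- The approximants of the Green quotient extend continuously, and closeness on the dense set of
nodes is closeness on X̄. -/
theorem martinCoord_mem_closure (H : Admissible lam C₁ C₂) (x : Word) :
    martinCoord H x ∈ (energyAlgebra lam C₁ C₂ H).topologicalClosure := by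
  obtain ⟨κ, hκ, h⟩ := martinCoord_incl H x
  refine Metric.mem_closure_iff.mpr fun ε hε => ?_
  obtain ⟨f, hf, hfg⟩ := exists_energy_near H x (ε := ε / 2 / κ) (by positivity)
  have hf' := energy_smul_lt_top H κ hf
  obtain ⟨F, hF⟩ := exists_extension_of_energy H hf'
  refine ⟨F, ?_, ?_⟩
  · have : F ∘ incl lam C₁ C₂ = κ • f := funext hF
    change energy lam C₁ C₂ (F ∘ incl lam C₁ C₂) < ∞
    rw [this]
    exact hf'
  · refine lt_of_le_of_lt ?_ (half_lt_self hε)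
    refine (ContinuousMap.dist_le (half_pos hε).le).mpr fun p => ?_
    rw [Real.dist_eq]
    refine dist_le_of_nodes (fun y => ?_) p
    rw [h, hF, Pi.smul_apply, smul_eq_mul, ← mul_sub, abs_mul, abs_of_pos hκ, abs_sub_comm]
    have := mul_le_mul_of_nonneg_left (hfg y) hκ.le
    rwa [mul_div_cancel₀ _ hκ.ne'] at this

open Classical in
/-- Density of the continuous functions of finite energy. -/
theorem energyAlgebra_closure (H : Admissible lam C₁ C₂) :
    (energyAlgebra lam C₁ C₂ H).topologicalClosure = ⊤ := by
  have hsep : (energyAlgebra lam C₁ C₂ H).topologicalClosure.SeparatesPoints := by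
    intro p q hpq
    -- Points of X̄ are told apart by a Martin kernel or by the indicator of a node; the latter has
    -- finite energy itself.
    by_cases h1 : p.1.1 = q.1.1
    · have h2 : p.1.2 ≠ q.1.2 := fun h2 => hpq (Subtype.ext (Prod.ext h1 h2))
      obtain ⟨x, hx⟩ := Function.ne_iff.mp h2
      obtain ⟨M, hM⟩ := exists_coord_le H x
      refine ⟨_, ⟨martinCoord H x, martinCoord_mem_closure H x, rfl⟩, fun h => hx ?_⟩
      exact (ENNReal.toReal_eq_toReal_iff' (ne_top_of_le_ne_top ENNReal.ofReal_ne_top (hM p))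
        (ne_top_of_le_ne_top ENNReal.ofReal_ne_top (hM q))).mp h
    · obtain ⟨x, hx⟩ := Function.ne_iff.mp h1
      let F : C(MartinCompactification lam C₁ C₂, ℝ) :=
        ⟨fun p => if p.1.1 x then 1 else 0, (continuous_of_discreteTopology
          (f := fun b : Bool => if b then (1 : ℝ) else 0)).comp
            ((continuous_apply x).comp (continuous_fst.comp continuous_subtype_val))⟩
      have hFv : ∀ p, F p = if p.1.1 x then 1 else 0 := fun _ => rfl
      refine ⟨_, ⟨F, Subalgebra.le_topologicalClosure _ ?_, rfl⟩, fun h => hx ?_⟩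
      · refine energy_lt_top_of_finite H ((Set.finite_singleton x).subset fun y hy => ?_)
        by_contra hyx
        refine hy ?_
        change (if decide (x = y) = true then (1 : ℝ) else 0) = 0
        rw [if_neg (by simpa using fun h => hyx h.symm)]
      · change F p = F q at h
        rw [hFv, hFv] at h
        cases hp : p.1.1 x <;> cases hq : q.1.1 x <;> simp_all
  -- Martin kernels are only known to lie in the closure, so Stone–Weierstrass is applied to the
  -- closed algebra, whose closure is itself.
  have h := ContinuousMap.subalgebra_topologicalClosure_eq_top_of_separatesPoints _ hsep
  rw [← h]
  exact le_antisymm (Subalgebra.le_topologicalClosure _)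
    (Subalgebra.topologicalClosure_minimal le_rfl (Subalgebra.isClosed_topologicalClosure _))

theorem memLp_continuous [IsFiniteMeasure (martinMeasure lam C₁ C₂ c)]
    (f : C(MartinCompactification lam C₁ C₂, ℝ)) : MemLp f 2 (martinMeasure lam C₁ C₂ c) :=
  MemLp.of_bound (f.continuous.measurable.aestronglyMeasurable) ‖f‖
    (Eventually.of_forall f.norm_coe_le_norm)

theorem isRegularDirichletForm (H : Admissible lam C₁ C₂)
    (hν : Carries (martinMeasure lam C₁ C₂ c) (incl lam C₁ C₂)) :
    IsRegularDirichletForm (martinMeasure lam C₁ C₂ c) (martinDomain lam C₁ C₂ c)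
      (martinForm lam C₁ C₂ c) := by
  have hfin := hν.finite
  have hD : IsDirichletForm (martinMeasure lam C₁ C₂ c) (martinDomain lam C₁ C₂ c)
      (martinForm lam C₁ C₂ c) := by
    rw [martinDomain_eq H hν]
    exact hν.isDirichletForm H (martinForm_eq H hν)
  -- There are countably many nodes, so X̄ lies in a countable product; with compactness this gives
  -- metrizability and separability.
  have hsc : SecondCountableTopology (MartinCompactification lam C₁ C₂) :=
    inferInstanceAs (SecondCountableTopology ↥(closure (Set.range (martinMap lam C₁ C₂))))
  refine ⟨hD, inferInstance, inferInstance, inferInstance, inferInstance, ⟨?_⟩, ?_, ?_⟩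
  · intro U hU hne h0
    obtain ⟨x, hx⟩ := (denseRange_incl lam C₁ C₂).exists_mem_open hU hne
    exact hν.pos x (measure_mono_null (Set.singleton_subset_iff.mpr hx) h0)
  · intro u hu ε hε
    obtain ⟨f, hf, -⟩ := id hu
    -- Every element of the domain is already continuous, so it serves as its own approximant.
    refine ⟨u, hu, ⟨f, f.continuous, HasCompactSupport.of_compactSpace _, hf⟩, ?_⟩
    have h1 := hD.form_smul 0 0 hD.zero_mem 0 hD.zero_mem
    rw [zero_smul, zero_mul] at h1
    rw [sub_self, formOne, h1, inner_zero_left, add_zero]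
    exact hε
  · intro f hf _ ε hε
    have hmem : (⟨f, hf⟩ : C(MartinCompactification lam C₁ C₂, ℝ)) ∈
        (energyAlgebra lam C₁ C₂ H).topologicalClosure := by
      rw [energyAlgebra_closure H]; trivial
    obtain ⟨g, hg, hfg⟩ := Metric.mem_closure_iff.mp hmem ε hε
    have hgL := memLp_continuous (c := c) g
    refine ⟨g, g.continuous, HasCompactSupport.of_compactSpace _,
      ⟨hgL.toLp _, ⟨g, hgL.coeFn_toLp, hg⟩, hgL.coeFn_toLp⟩, fun x => ?_⟩
    exact (ContinuousMap.dist_apply_le_dist (f := (⟨f, hf⟩ : C(_, ℝ))) (g := g) x).trans_lt hfg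

/-! ### The isomorphism -/

/-- The value 0 off the nodes is immaterial, as these points form a null set. -/
theorem memLp_extend (u : Lp ℝ 2 (nodeMeasure lam c)) :
    MemLp (Function.extend (incl lam C₁ C₂) u 0) 2 (martinMeasure lam C₁ C₂ c) := by
  rw [martinMeasure, measurableEmbedding_incl.memLp_map_measure_iff,
    Function.extend_comp measurableEmbedding_incl.injective]
  exact Lp.memLp u

variable (lam C₁ C₂ c) in
/-- A function on the nodes as a function on the Martin compactification. -/
noncomputable def extendLp (u : Lp ℝ 2 (nodeMeasure lam c)) :
    Lp ℝ 2 (martinMeasure lam C₁ C₂ c) :=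
  (memLp_extend u).toLp _

theorem extendLp_incl (hν : Carries (martinMeasure lam C₁ C₂ c) (incl lam C₁ C₂))
    (u : Lp ℝ 2 (nodeMeasure lam c)) (x : Word) :
    extendLp lam C₁ C₂ c u (incl lam C₁ C₂ x) = u x :=
  (hν.ae_iff.mp (memLp_extend u).coeFn_toLp x).trans
    (measurableEmbedding_incl.injective.extend_apply _ _ _)

theorem extendLp_comp (hν : Carries (martinMeasure lam C₁ C₂ c) (incl lam C₁ C₂))
    (u : Lp ℝ 2 (nodeMeasure lam c)) :
    ⇑(extendLp lam C₁ C₂ c u) ∘ incl lam C₁ C₂ = ⇑u ∘ id :=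
  funext (extendLp_incl hν u)

theorem eLpNorm_extendLp (hν : Carries (martinMeasure lam C₁ C₂ c) (incl lam C₁ C₂))
    (u : Lp ℝ 2 (nodeMeasure lam c)) :
    eLpNorm (extendLp lam C₁ C₂ c u) ∞ (martinMeasure lam C₁ C₂ c) =
      eLpNorm u ∞ (nodeMeasure lam c) := by
  have h := measurableEmbedding_incl.eLpNorm_map_measure (μ := nodeMeasure lam c) (p := ∞)
    (f := incl lam C₁ C₂) (g := extendLp lam C₁ C₂ c u)
  rw [extendLp_comp hν] at h
  exact h

theorem isFormIsomorphism (H : Admissible lam C₁ C₂)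
    (hμ : Carries (nodeMeasure lam c) id)
    (hν : Carries (martinMeasure lam C₁ C₂ c) (incl lam C₁ C₂)) :
    IsFormIsomorphism (nodeMeasure lam c) (activeReflectedDomain lam C₁ C₂ c)
      (reflectedForm lam C₁ C₂ c) (martinMeasure lam C₁ C₂ c) (martinDomain lam C₁ C₂ c)
      (martinForm lam C₁ C₂ c) (extendLp lam C₁ C₂ c) := by
  have hfin := hμ.finite
  rw [activeReflectedDomain_eq H hμ, martinDomain_eq H hν]
  have hcomp := extendLp_comp hν
  have hmap : ∀ u ∈ boundedPart {u : Lp ℝ 2 (nodeMeasure lam c) |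
      energy lam C₁ C₂ (⇑u ∘ id) < ∞}, extendLp lam C₁ C₂ c u ∈ boundedPart
        {u : Lp ℝ 2 (martinMeasure lam C₁ C₂ c) |
          energy lam C₁ C₂ (⇑u ∘ incl lam C₁ C₂) < ∞} := by
    rintro u ⟨hu, hb⟩
    refine ⟨?_, by rwa [eLpNorm_extendLp hν]⟩
    rw [Set.mem_ofPred_eq, hcomp]
    exact hu
  refine ⟨⟨hmap, ?_, ?_⟩, ?_, ?_, ?_, fun u _ => eLpNorm_extendLp hν u, ?_, ?_⟩
  · intro u _ v _ huv
    refine hμ.ext fun x => ?_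
    rw [id, ← extendLp_incl hν, ← extendLp_incl hν, huv]
  · rintro w ⟨hw, hb⟩
    have hmem : MemLp (⇑w ∘ incl lam C₁ C₂) 2 (nodeMeasure lam c) :=
      measurableEmbedding_incl.memLp_map_measure_iff.mp (Lp.memLp w)
    have hcoe := coe_eq_of_ae hμ hmem.coeFn_toLp
    have hext : extendLp lam C₁ C₂ c (hmem.toLp _) = w := hν.ext fun x => by
      rw [extendLp_incl hν, hcoe]; rfl
    refine ⟨hmem.toLp _, ⟨?_, ?_⟩, hext⟩
    · rw [Set.mem_ofPred_eq, ← hcomp, hext]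
      exact hw
    · rw [← eLpNorm_extendLp hν, hext]
      exact hb
  · intro u _ v _
    refine hν.ext fun x => ?_
    have h1 := congrFun (hν.coe_add (extendLp lam C₁ C₂ c u) (extendLp lam C₁ C₂ c v)) x
    have h2 := congrFun (hμ.coe_add u v) x
    rw [extendLp_incl hν]
    refine h2.trans (Eq.trans ?_ h1.symm)
    simp only [Pi.add_apply, hcomp]
  · intro a u _
    refine hν.ext fun x => ?_
    have h1 := congrFun (hν.coe_smul a (extendLp lam C₁ C₂ c u)) x
    have h2 := congrFun (hμ.coe_smul a u) x
    rw [extendLp_incl hν]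
    refine h2.trans (Eq.trans ?_ h1.symm)
    simp only [Pi.smul_apply, hcomp]
  · rintro u ⟨hu, hub⟩ v ⟨hv, hvb⟩
    -- The product has finite energy and is therefore bounded, which puts it in L² and in L^∞ at
    -- once.
    obtain ⟨M, hM⟩ := exists_abs_le_of_energy H (energy_mul_lt_top H hu hv)
    have hmem : ∀ p, MemLp ((⇑u ∘ id) * (⇑v ∘ id)) p (nodeMeasure lam c) := fun p =>
      MemLp.of_bound Measurable.of_discrete.aestronglyMeasurable M (Eventually.of_forall hM)
    have hcoe := coe_eq_of_ae hμ (hmem 2).coeFn_toLp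
    refine ⟨(hmem 2).toLp _, ⟨?_, ?_⟩, (hmem 2).coeFn_toLp, hν.ae_iff.mpr fun x => ?_⟩
    · rw [Set.mem_ofPred_eq, hcoe]
      exact energy_mul_lt_top H hu hv
    · rw [hcoe]
      exact (hmem ∞).eLpNorm_lt_top
    · rw [extendLp_incl hν, hcoe]
      exact (congrArg₂ (· * ·) (extendLp_incl hν u x) (extendLp_incl hν v x)).symm
  · intro u _
    rw [L2.inner_def, L2.inner_def]
    have h := measurableEmbedding_incl.integral_map (μ := nodeMeasure lam c) (f := incl lam C₁ C₂)
      fun p => inner ℝ (extendLp lam C₁ C₂ c u p) (extendLp lam C₁ C₂ c u p)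
    simp only [extendLp_incl hν] at h
    exact h
  · rintro u ⟨hu, _⟩
    rw [reflectedForm_eq H hμ u u hu hu, martinForm_eq H hν, hcomp]
    · rw [hcomp]; exact hu
    · rw [hcomp]; exact hu

end

end SierpinskiRep

theorem mainTheorem7 (lam c C₁ C₂ : ℝ) (hlam : 1 / 5 < lam) (hlam' : lam < 1 / 3)
    (hc : 0 < c) (hc' : c < lam) (hC₁ : 0 < C₁) (hC₂ : 0 < C₂) :
    ∃ Φ : Lp ℝ 2 (nodeMeasure lam c) → Lp ℝ 2 (martinMeasure lam C₁ C₂ c),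
      IsRegularRepresentation
        (nodeMeasure lam c) (activeReflectedDomain lam C₁ C₂ c) (reflectedForm lam C₁ C₂ c)
        (martinMeasure lam C₁ C₂ c) (martinDomain lam C₁ C₂ c) (martinForm lam C₁ C₂ c) Φ ∧
      ∀ u ∈ boundedPart (activeReflectedDomain lam C₁ C₂ c),
        ∃ f : C(MartinCompactification lam C₁ C₂, ℝ),
          (∀ x, f (incl lam C₁ C₂ x) = u x) ∧ Φ u =ᵐ[martinMeasure lam C₁ C₂ c] f := by
  have H : Admissible lam C₁ C₂ := ⟨hlam, hlam', hC₁, hC₂⟩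
  have hμ := carries_nodeMeasure H.pos hc hc'
  have hν := carries_martinMeasure (C₁ := C₁) (C₂ := C₂) H.pos hc hc'
  refine ⟨extendLp lam C₁ C₂ c, ⟨?_, isRegularDirichletForm H hν, isFormIsomorphism H hμ hν⟩, ?_⟩
  · rw [activeReflectedDomain_eq H hμ]
    exact hμ.isDirichletForm H (reflectedForm_eq H hμ)
  · rintro u ⟨hu, -⟩
    rw [activeReflectedDomain_eq H hμ] at hu
    obtain ⟨f, hf⟩ := exists_extension_of_energy H hu
    -- The extension by 0 and the continuous extension agree at the nodes, hence almost everywhere.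
    exact ⟨f, hf, hν.ae_iff.mpr fun x => (extendLp_incl hν u x).trans (hf x).symm⟩
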